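/- Let $d\ge 1$, $H,\Lambda>0$, and write $x=(y,z)\in\mathbb R^{d-1}\times\mathbb R$. Let $(T,u,p)$, $u=(v,w)\in\mathbb R^{d-1}\times\mathbb R$, be a classical solution for $t\ge 0$ (with $T,u$ of class $C^2$ on $[0,\infty)\times\mathbb R^{d-1}\times[0,H]$ and $p(t,\cdot)$ of class $C^1$ on $\mathbb R^{d-1}\times[0,H]$) of $$\partial_tT+u\cdot\nabla T-\Delta T=0,\qquad \nabla\cdot u=0,\qquad -\Delta u+\nabla p=Te_z\qquad\text{in }0<z<H,\ t>0,$$ with $T,u,p$ all $\Lambda$-periodic in each horizontal coordinate, $T=1$ at $z=0$, $T=0$ at $z=H$, and $u=0$ at $z\in\{0,H\}$. Put $$\langle f\rangle=\limsup_{t_0\to\infty}\frac1{t_0}\int_0^{t_0}\frac1{\Lambda^{d-1}}\int_{[0,\Lambda)^{d-1}}f(t,y)\,dy\,dt,\qquad \mathrm{Nu}=\frac1H\int_0^H\langle wT-\partial_zT\rangle\,dz .$$ Fix $c>0$ and consider solutions with $\mathrm{Nu}\ge c$. (i) There are constants $C>0$ and $H_0>1$ depending only on $d$ and $c$ such that,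 for all $H\ge H_0$, all $\Lambda>0$, every such solution and every $0\le\delta\le H$, $$\Big\langle\int_0^\delta|\nabla_yv|^2\,dz\Big\rangle+\Big\langle\int_0^\delta|\nabla w|^2\,dz\Big\rangle\le C\,\delta\,(\ln H)\,\mathrm{Nu}.$$ If moreover, for almost every $z\in(0,\delta)$, the upper limits defining $\langle|\nabla_yv|^2\rangle$ and $\langle|\nabla w|^2\rangle$ at height $z$ are limits, then these two averages are integrable in $z$ over $(0,\delta)$ and $$\int_0^\delta\langle|\nabla_yv|^2\rangle\,dz+\int_0^\delta\langle|\nabla w|^2\rangle\,dz\le C\,\delta\,(\ln H)\,\mathrm{Nu}.$$ (ii) For every $M>0$ there are constants $C>0$ and $H_0>1$ depending only on $d$, $c$ and $M$ such that, for all $H\ge H_0$, all $\Lambda>0$, every such solution and every $\delta$ with $\frac1H\le M\delta$ and $\delta\le M\ln H$, the function $z\mapsto\langle|\partial_zv|^2\rangle$ is integrable over $(0,\delta)$ and $$\int_0^\delta\langle|\partial_zv|^2\rangle\,dz\le C\,\delta\,(\ln^3H)\,\mathrm{Nu}.$$ -/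

import Mathlib

open MeasureTheory Filter Topology Set

noncomputable section

namespace RayleighBenard

/-- Points `x = (y, z)` with `n = d - 1` horizontal coordinates `y` and the vertical coordinate `z`. -/
abbrev Space (n : ℕ) : Type := (Fin n → ℝ) × ℝ

/-- The closed layer `ℝⁿ × [0, H]`. -/
def layer (n : ℕ) (H : ℝ) : Set (Space n) := univ ×ˢ Icc 0 H

/-- The horizontal period cell `[0, Λ)ⁿ`. -/
def cell (n : ℕ) (L : ℝ) : Set (Fin n → ℝ) := univ.pi fun _ => Ico 0 L

/-- The horizontal partial derivative `∂f/∂y_j`. -/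
def dY {n : ℕ} (j : Fin n) (f : Space n → ℝ) (x : Space n) : ℝ :=
  fderiv ℝ f x (Pi.single j 1, 0)

/-- The vertical partial derivative `∂f/∂z`. -/
def dZ {n : ℕ} (f : Space n → ℝ) (x : Space n) : ℝ :=
  fderiv ℝ f x (0, 1)

/-- The Laplacian in all `n + 1` variables. -/
def lap {n : ℕ} (f : Space n → ℝ) (x : Space n) : ℝ :=
  (∑ j, dY j (dY j f) x) + dZ (dZ f) x

/-- `|∇_y v|²`, the sum of all `(∂v_i/∂y_j)²`. -/
def gradYSq {n : ℕ} (v : Fin n → Space n → ℝ) (x : Space n) : ℝ :=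
  ∑ i, ∑ j, dY j (v i) x ^ 2

/-- `|∇f|²` for a scalar function `f`. -/
def gradSq {n : ℕ} (f : Space n → ℝ) (x : Space n) : ℝ :=
  (∑ j, dY j f x ^ 2) + dZ f x ^ 2

/-- `|∂_z v|²`. -/
def dZSq {n : ℕ} (v : Fin n → Space n → ℝ) (x : Space n) : ℝ :=
  ∑ i, dZ (v i) x ^ 2

/-- `Λ`-periodicity in every horizontal direction of a function on the layer. -/
def IsHorizPeriodic {n : ℕ} (L H : ℝ) (f : Space n → ℝ) : Prop :=
  ∀ x ∈ layer n H, ∀ j : Fin n, f (x.1 + Pi.single j L, x.2) = f x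

/-- `(T, (v, w), p)` is a classical global solution of the infinite-Prandtl-number Boussinesq system
`∂ₜT + u·∇T - ΔT = 0`, `div u = 0`, `-Δu + ∇p = T e` with `u = (v, w)`, horizontally `L`-periodic,
with `T = 1` at `z = 0`, `T = 0` at `z = H`, and `u = 0` at `z ∈ {0, H}`. Here `v t i` is the `i`-th
horizontal velocity component at time `t`. -/
structure IsSolution (n : ℕ) (L H : ℝ) (T : ℝ → Space n → ℝ) (v : ℝ → Fin n → Space n → ℝ)
    (w p : ℝ → Space n → ℝ) : Prop where
  regular_T : ContDiffOn ℝ 2 (fun q : ℝ × Space n => T q.1 q.2) (Ici 0 ×ˢ layer n H)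
  regular_v : ∀ i, ContDiffOn ℝ 2 (fun q : ℝ × Space n => v q.1 i q.2) (Ici 0 ×ˢ layer n H)
  regular_w : ContDiffOn ℝ 2 (fun q : ℝ × Space n => w q.1 q.2) (Ici 0 ×ˢ layer n H)
  regular_p : ∀ t, 0 ≤ t → ContDiffOn ℝ 1 (p t) (layer n H)
  periodic_T : ∀ t, 0 ≤ t → IsHorizPeriodic L H (T t)
  periodic_v : ∀ t, 0 ≤ t → ∀ i, IsHorizPeriodic L H (v t i)
  periodic_w : ∀ t, 0 ≤ t → IsHorizPeriodic L H (w t)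
  periodic_p : ∀ t, 0 ≤ t → IsHorizPeriodic L H (p t)
  heat : ∀ t, 0 < t → ∀ y : Fin n → ℝ, ∀ z ∈ Ioo 0 H,
    deriv (fun s => T s (y, z)) t
      + ((∑ j, v t j (y, z) * dY j (T t) (y, z)) + w t (y, z) * dZ (T t) (y, z))
      - lap (T t) (y, z) = 0
  divergence : ∀ t, 0 < t → ∀ y : Fin n → ℝ, ∀ z ∈ Ioo 0 H,
    (∑ j, dY j (v t j) (y, z)) + dZ (w t) (y, z) = 0
  stokes_v : ∀ t, 0 < t → ∀ y : Fin n → ℝ, ∀ z ∈ Ioo 0 H, ∀ i,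
    -lap (v t i) (y, z) + dY i (p t) (y, z) = 0
  stokes_w : ∀ t, 0 < t → ∀ y : Fin n → ℝ, ∀ z ∈ Ioo 0 H,
    -lap (w t) (y, z) + dZ (p t) (y, z) = T t (y, z)
  T_bottom : ∀ t, 0 ≤ t → ∀ y : Fin n → ℝ, T t (y, 0) = 1
  T_top : ∀ t, 0 ≤ t → ∀ y : Fin n → ℝ, T t (y, H) = 0
  v_bottom : ∀ t, 0 ≤ t → ∀ y : Fin n → ℝ, ∀ i, v t i (y, 0) = 0
  v_top : ∀ t, 0 ≤ t → ∀ y : Fin n → ℝ, ∀ i, v t i (y, H) = 0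
  w_bottom : ∀ t, 0 ≤ t → ∀ y : Fin n → ℝ, w t (y, 0) = 0
  w_top : ∀ t, 0 ≤ t → ∀ y : Fin n → ℝ, w t (y, H) = 0

/-- The horizontal space average and time average over `[0, t₀]` of `f(t, y)`. -/
def timeAvg {n : ℕ} (L : ℝ) (f : ℝ → (Fin n → ℝ) → ℝ) (t₀ : ℝ) : ℝ :=
  1 / t₀ * ∫ t in (0 : ℝ)..t₀, 1 / L ^ n * ∫ y in cell n L, f t y

/-- The horizontal space and long-time average `⟨f⟩`, the limsup of the finite-time averages. -/
def avg {n : ℕ} (L : ℝ) (f : ℝ → (Fin n → ℝ) → ℝ) : ℝ :=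
  limsup (timeAvg L f) atTop

/-- The Nusselt number, `(1/H) ∫₀ᴴ ⟨wT - ∂_z T⟩ dz`. -/
def nusselt {n : ℕ} (L H : ℝ) (T w : ℝ → Space n → ℝ) : ℝ :=
  1 / H * ∫ z in (0 : ℝ)..H, avg L fun t y => w t (y, z) * T t (y, z) - dZ (T t) (y, z)

/-- At almost every height `z ∈ (0, δ)` the long-time average of `f(t, (y, z))` is a limit. -/
def HasTimeAverages {n : ℕ} (L δ : ℝ) (f : ℝ → Space n → ℝ) : Prop :=
  ∀ᵐ z ∂(volume.restrict (Ioo 0 δ)),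
    ∃ a : ℝ, Tendsto (timeAvg L fun t (y : Fin n → ℝ) => f t (y, z)) atTop (𝓝 a)

end RayleighBenard

end

noncomputable section

namespace RayleighBenard

/-! ### One-dimensional integral inequalities -/

/-! Everything reduces to a logarithmically weighted convective flux, the integral of `⟨wT⟩ / (z +
ε)` over the layer, which has long-time average `O(Nu · ln H)` for every `ε > 0`.

From the flux to the velocity. At a fixed time the Stokes system decouples into horizontal Fourier
modes. With `K = |κ|²`, the vertical velocity `a` of a mode solves `a'''' - 2K a'' + K² a = K τ`
with `a = a' = 0` at both walls, and the horizontal velocity is parallel to `κ`, hence determined by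
`a'`. Testing with `a / (z + ε)` is coercive uniformly in `K` (`mode_weighted_energy`): the weighted
`K a² + 2 a'²` is bounded by twice the weighted `a τ`, and a weighted quantity in `a''` is
controlled as well. Summed by Parseval this is `StokesSlice.weighted_energy`. Since `1 / (z + δ) ≥ 1
/ (2δ)` on `(0, δ)`, the choice `ε = δ` gives the factor `δ` in (i). For (ii), the control of `a''`
with `ε = x` and an interior estimate on `(0, 2x)` bound the shear at height `x` by the weighted
flux plus `x ∫ T²` over `(0, 2x)` (`mode_pointwise`, `StokesSlice.pointwise`). This is a bound at
every height, so integrating over `(0, δ)` costs only `δ`.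

The flux itself. The time-averaged heat flux `⟨wT - ∂_z T⟩` is independent of the height up to
`O(1/t₀)` (`Flow.abs_integral_heatFlux_sub_le`) and equals `Nu`; the weight integrated over `(1/H,
H)` gives `2 ln H`. Below `1/H`, `wT` vanishes linearly at the wall because `w` has zero horizontal
mean and both `w` and `T - 1` vanish there; the slope is controlled by `∫ |∂_z w|² + ∫ |∇T|²`, at
most `(H + 1) Nu` on average. The conductive part is integrated by parts, and `T ≤ 1` makes it
harmless (`weighted_convection_le`). The outcome is `Flow.eventually_weightedConv_le`.

The initial temperature need not lie in `[0, 1]`, so the maximum principle is replaced by decay: the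
fourth powers of the excesses of `T` above `1` and below `0` are integrable over all times, and
their contribution disappears from time averages. The hypothesis `Nu ≥ c` makes the upper limit
defining `Nu` genuine and lets constants be absorbed into `Nu`. -/

theorem intervalIntegral_eq_zero_of_hasDerivAt {f f' : ℝ → ℝ} {a b : ℝ} (hab : a ≤ b)
    (hf : ContinuousOn f (Icc a b)) (hf' : ContinuousOn f' (Icc a b))
    (h : ∀ x ∈ Ioo a b, HasDerivAt f (f' x) x) (ha : f a = 0) (hb : f b = 0) :
    ∫ x in a..b, f' x = 0 := by
  rw [intervalIntegral.integral_eq_sub_of_hasDerivAt_of_le hab hf h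
    (hf'.intervalIntegrable_of_Icc hab), ha, hb, sub_zero]

/-- If `f ≤ g + F'` on an interval and `F` vanishes at both ends, then `∫ f ≤ ∫ g`. -/
theorem intervalIntegral_le_of_le_add_deriv {f g F F' : ℝ → ℝ} {a b : ℝ} (hab : a ≤ b)
    (hf : ContinuousOn f (Icc a b)) (hg : ContinuousOn g (Icc a b))
    (hF : ContinuousOn F (Icc a b)) (hF' : ContinuousOn F' (Icc a b))
    (h : ∀ x ∈ Ioo a b, HasDerivAt F (F' x) x) (ha : F a = 0) (hb : F b = 0)
    (hle : ∀ x ∈ Icc a b, f x ≤ g x + F' x) :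
    ∫ x in a..b, f x ≤ ∫ x in a..b, g x := by
  have h0 := intervalIntegral_eq_zero_of_hasDerivAt hab hF hF' h ha hb
  have h1 : ∫ x in a..b, f x ≤ ∫ x in a..b, (g x + F' x) :=
    intervalIntegral.integral_mono_on hab (hf.intervalIntegrable_of_Icc hab)
      ((hg.add hF').intervalIntegrable_of_Icc hab) hle
  rwa [intervalIntegral.integral_add (hg.intervalIntegrable_of_Icc hab)
    (hF'.intervalIntegrable_of_Icc hab), h0, add_zero] at h1

/-- A Poincaré inequality for functions vanishing at the left end. -/
theorem integral_sq_le_of_left_eq_zero {f f' : ℝ → ℝ} {b : ℝ} (hb : 0 ≤ b)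
    (hf : ContinuousOn f (Icc 0 b)) (hf' : ContinuousOn f' (Icc 0 b))
    (h : ∀ x ∈ Ioo 0 b, HasDerivAt f (f' x) x) (h0 : f 0 = 0) :
    ∫ x in (0 : ℝ)..b, f x ^ 2 ≤ 4 * b ^ 2 * ∫ x in (0 : ℝ)..b, f' x ^ 2 := by
  rw [← intervalIntegral.integral_const_mul]
  -- The multiplier `x - b` removes the boundary term at `b`, and `f 0 = 0` the one at `0`. The
  -- constant 4 comes from completing the square `(f + 2 (x - b) f')²`.
  refine intervalIntegral_le_of_le_add_deriv (F := fun x => 2 * ((x - b) * f x ^ 2))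
    (F' := fun x => 2 * (1 * f x ^ 2 + (x - b) * (2 * f x * f' x))) hb (by fun_prop) (by fun_prop)
    (by fun_prop) (by fun_prop) (fun x hx => ?_) (by simp [h0]) (by simp) fun x hx => ?_
  · have h1 := ((((hasDerivAt_id x).sub_const b).mul ((h x hx).pow 2)).const_mul 2)
    simpa using h1
  · have h1 : (x - b) ^ 2 * f' x ^ 2 ≤ b ^ 2 * f' x ^ 2 := by
      gcongr ?_ * _
      nlinarith [hx.1, hx.2]
    nlinarith [sq_nonneg (f x + 2 * ((x - b) * f' x))]

theorem sq_le_mul_integral_sq {f f' : ℝ → ℝ} {b x : ℝ} (hx : x ∈ Icc 0 b)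
    (hf : ContinuousOn f (Icc 0 b)) (hf' : ContinuousOn f' (Icc 0 b))
    (h : ∀ x ∈ Ioo 0 b, HasDerivAt f (f' x) x) (h0 : f 0 = 0) :
    f x ^ 2 ≤ x * ∫ s in (0 : ℝ)..b, f' s ^ 2 := by
  obtain ⟨hx0, hxb⟩ := hx
  have hs : Icc 0 x ⊆ Icc 0 b := Icc_subset_Icc_right hxb
  have hi : IntervalIntegrable f' volume 0 x := (hf'.mono hs).intervalIntegrable_of_Icc hx0
  have hi2 : IntervalIntegrable (fun s => f' s ^ 2) volume 0 x :=
    ((hf'.pow 2).mono hs).intervalIntegrable_of_Icc hx0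
  have e1 : ∫ s in (0 : ℝ)..x, f' s = f x := by
    rw [intervalIntegral.integral_eq_sub_of_hasDerivAt_of_le hx0 (hf.mono hs)
      (fun s hs => h s ⟨hs.1, hs.2.trans_le hxb⟩) hi, h0, sub_zero]
  have e2 : ∫ s in (0 : ℝ)..x, f' s ^ 2 ≤ ∫ s in (0 : ℝ)..b, f' s ^ 2 :=
    intervalIntegral.integral_mono_interval le_rfl hx0 hxb
      (Eventually.of_forall fun s => sq_nonneg _)
      ((hf'.pow 2).intervalIntegrable_of_Icc (hx0.trans hxb))
  rcases hx0.eq_or_lt with rfl | hx0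
  · simp [h0]
  -- The mean slope on `[0, x]`: expanding `∫ (f' - l)² ≥ 0` is Cauchy–Schwarz.
  set l := f x / x with hl
  have e3 : 0 ≤ ∫ s in (0 : ℝ)..x, (f' s - l) ^ 2 :=
    intervalIntegral.integral_nonneg hx0.le fun s _ => sq_nonneg _
  have e4 : ∫ s in (0 : ℝ)..x, (f' s - l) ^ 2
      = (∫ s in (0 : ℝ)..x, f' s ^ 2) - 2 * l * f x + l ^ 2 * x := by
    have : ∀ s, (f' s - l) ^ 2 = f' s ^ 2 - 2 * l * f' s + l ^ 2 := fun s => by ring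
    simp_rw [this]
    rw [intervalIntegral.integral_add (hi2.sub (hi.const_mul _)) (by simp),
      intervalIntegral.integral_sub hi2 (hi.const_mul _), intervalIntegral.integral_const_mul, e1]
    simp [mul_comm]
  have e5 : l * x = f x := by rw [hl]; field_simp
  have e6 : f x ^ 2 = x * (2 * l * f x - l ^ 2 * x) := by
    rw [← e5]; ring
  rw [e6]
  gcongr
  linarith

/-- The weighted energy inequality for the mode equation `m a'''' - 2 a'' + K a = τ`, `m K = 1`,
with a weight of the form `r z = 1 / (z + ε)`. -/
theorem mode_weighted_energy {K m H : ℝ} {r : ℝ → ℝ} (hm : m * K = 1) (hK : 0 < K) (hH : 0 < H)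
    (cr : ContinuousOn r (Icc 0 H)) (rpos : ∀ z ∈ Icc 0 H, 0 < r z)
    (dr : ∀ z ∈ Ioo 0 H, HasDerivAt r (-(r z ^ 2)) z)
    {a a1 a2 a3 τ : ℝ → ℝ} (ca : Continuous a) (ca1 : Continuous a1) (ca2 : Continuous a2)
    (ca3 : Continuous a3) (cτ : Continuous τ)
    (d0 : ∀ z ∈ Ioo 0 H, HasDerivAt a (a1 z) z) (d1 : ∀ z ∈ Ioo 0 H, HasDerivAt a1 (a2 z) z)
    (d2 : ∀ z ∈ Ioo 0 H, HasDerivAt a2 (a3 z) z)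
    (d3 : ∀ z ∈ Ioo 0 H, HasDerivAt a3 (K * τ z + 2 * K * a2 z - K ^ 2 * a z) z)
    (b0 : a 0 = 0) (b1 : a1 0 = 0) (t0 : a H = 0) (t1 : a1 H = 0) :
    (∫ z in (0 : ℝ)..H, r z * (K * a z ^ 2 + 2 * a1 z ^ 2)
      ≤ 2 * ∫ z in (0 : ℝ)..H, r z * (a z * τ z)) ∧
    (m * ∫ z in (0 : ℝ)..H, r z * ((a1 z * r z - 2 * a z * r z ^ 2) ^ 2
        + (a2 z - 3 * a1 z * r z + 4 * a z * r z ^ 2) ^ 2)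
      ≤ ∫ z in (0 : ℝ)..H, r z * (a z * τ z)) := by
  have hmpos : 0 < m := by
    by_contra hneg
    nlinarith
  have ca' := ca.continuousOn (s := Icc 0 H)
  have ca1' := ca1.continuousOn (s := Icc 0 H)
  have ca2' := ca2.continuousOn (s := Icc 0 H)
  have ca3' := ca3.continuousOn (s := Icc 0 H)
  have cτ' := cτ.continuousOn (s := Icc 0 H)
  -- the two boundary fluxes
  let Q : ℝ → ℝ := fun z => r z ^ 2 * a z ^ 2
  let Q' : ℝ → ℝ := fun z => 2 * r z ^ 2 * a z * a1 z - 2 * r z ^ 3 * a z ^ 2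
  -- Flux obtained by multiplying the equation by `r a`. Because `r' = -r²`, all terms stay
  -- polynomial in `r`; the correction terms turn the fourth-order part into exactly `m r P`, a sum
  -- of squares.
  let E : ℝ → ℝ := fun z => m * (r z * (a z * a3 z) - (r z * a1 z - r z ^ 2 * a z) * a2 z
    - r z ^ 2 * a1 z ^ 2 + 2 * (r z ^ 3 * (a z * a1 z)) + 3 * (r z ^ 4 * a z ^ 2)
    + (-2 * (a z * r z ^ 2) ^ 2 + 4 * (a z * r z ^ 2) * (a1 z * r z - 2 * (a z * r z ^ 2))
      + 3 * (a1 z * r z - 2 * (a z * r z ^ 2)) ^ 2)) - 2 * (r z * (a z * a1 z))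
  -- For `r = 1 / (z + ε)` the two bases are the first and second derivatives of `a r²` in the
  -- variable `log (z + ε)`.
  let P : ℝ → ℝ := fun z => (a1 z * r z - 2 * a z * r z ^ 2) ^ 2
      + (a2 z - 3 * a1 z * r z + 4 * a z * r z ^ 2) ^ 2
  let E' : ℝ → ℝ := fun z => r z * (a z * τ z)
    - (K * r z * a z ^ 2 + 2 * r z * a1 z ^ 2 - 2 * r z ^ 2 * a z * a1 z + m * r z * P z)
  have dQ : ∀ z ∈ Ioo 0 H, HasDerivAt Q (Q' z) z := fun z hz => by
    refine (((dr z hz).pow 2).mul ((d0 z hz).pow 2)).congr_deriv ?_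
    simp only [Q', Pi.pow_apply]
    push_cast
    ring
  have dE : ∀ z ∈ Ioo 0 H, HasDerivAt E (E' z) z := fun z hz => by
    have R := dr z hz
    have A := d0 z hz
    have A1 := d1 z hz
    have A2 := d2 z hz
    have A3 := d3 z hz
    have hφ := A.mul (R.pow 2)
    have hψ := (A1.mul R).sub (hφ.const_mul 2)
    have h1 := (((((((R.mul (A.mul A3)).sub (((R.mul A1).sub ((R.pow 2).mul A)).mul A2)).sub
      ((R.pow 2).mul (A1.pow 2))).add (((R.pow 3).mul (A.mul A1)).const_mul 2)).add
      (((R.pow 4).mul (A.pow 2)).const_mul 3)).add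
      ((((hφ.pow 2).const_mul (-2)).add ((hφ.const_mul 4).mul hψ)).add
        ((hψ.pow 2).const_mul 3))).const_mul m).sub ((R.mul (A.mul A1)).const_mul 2)
    refine h1.congr_deriv ?_
    simp only [E', P, Pi.pow_apply, Pi.mul_apply, Pi.sub_apply]
    push_cast
    linear_combination (r z * a z * τ z + 2 * r z * a z * a2 z - K * r z * a z ^ 2) * hm
  have cP : ContinuousOn P (Icc 0 H) := by fun_prop
  have cQ : ContinuousOn Q (Icc 0 H) := by fun_prop
  have cQ' : ContinuousOn Q' (Icc 0 H) := by fun_prop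
  have cE : ContinuousOn E (Icc 0 H) := by fun_prop
  have cE' : ContinuousOn E' (Icc 0 H) := by fun_prop
  have hP : ∀ z, 0 ≤ P z := fun z => by positivity
  constructor
  · rw [← intervalIntegral.integral_const_mul]
    refine intervalIntegral_le_of_le_add_deriv (F := fun z => -2 * E z + 1 * Q z)
      (F' := fun z => -2 * E' z + 1 * Q' z) hH.le (by fun_prop) (by fun_prop) (by fun_prop)
      (by fun_prop) (fun z hz => ((dE z hz).const_mul _).add ((dQ z hz).const_mul _))
      (by simp [E, Q, b0, b1]) (by simp [E, Q, t0, t1]) fun z hz => ?_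
    have h1 := rpos z hz
    have h2 : 0 ≤ r z * (a1 z - r z * a z) ^ 2 := by positivity
    -- The zeroth-order term has a negative part of size `r³ a²`. Since `m K = 1`, this square
    -- couples `K a²` to the fourth-order part and absorbs it uniformly in `K`.
    have h3 : 0 ≤ m * r z * (K * a z + (a1 z * r z - 2 * a z * r z ^ 2)) ^ 2 := by positivity
    have h4 : 0 ≤ m * r z * ((a1 z * r z - 2 * a z * r z ^ 2) ^ 2
      + 2 * (a2 z - 3 * a1 z * r z + 4 * a z * r z ^ 2) ^ 2) := by positivity
    have h5 : m * r z * (K * a z + (a1 z * r z - 2 * a z * r z ^ 2)) ^ 2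
        = K * r z * a z ^ 2 + 2 * r z * a z * (a1 z * r z - 2 * a z * r z ^ 2)
          + m * r z * (a1 z * r z - 2 * a z * r z ^ 2) ^ 2 := by
      linear_combination (r z * a z ^ 2 * K
        + 2 * r z * a z * (a1 z * r z - 2 * a z * r z ^ 2)) * hm
    rw [h5] at h3
    simp only [E', Q', P]
    linarith
  · rw [← intervalIntegral.integral_const_mul]
    -- The opposite sign of `Q` completes `2 r (a1 - r a)²`, so that the whole of `m r P` survives
    -- on the left.
    refine intervalIntegral_le_of_le_add_deriv (F := fun z => -E z - Q z)
      (F' := fun z => -E' z - Q' z) hH.le (by fun_prop) (by fun_prop) (by fun_prop)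
      (by fun_prop) (fun z hz => (dE z hz).neg.sub (dQ z hz))
      (by simp [E, Q, b0, b1]) (by simp [E, Q, t0, t1]) fun z hz => ?_
    have h1 := rpos z hz
    have h2 : 0 ≤ r z * (a1 z - r z * a z) ^ 2 := by positivity
    have h4 : 0 ≤ K * r z * a z ^ 2 := by positivity
    change m * (r z * P z) ≤ _
    simp only [E', Q']
    linarith

/-- The unweighted energy inequality for the mode equation. -/
theorem mode_energy {K m H : ℝ} (hm : m * K = 1) (hK : 0 < K) (hH : 0 < H)
    {a a1 a2 a3 τ : ℝ → ℝ} (ca : Continuous a) (ca1 : Continuous a1) (ca2 : Continuous a2)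
    (ca3 : Continuous a3) (cτ : Continuous τ)
    (d0 : ∀ z ∈ Ioo 0 H, HasDerivAt a (a1 z) z) (d1 : ∀ z ∈ Ioo 0 H, HasDerivAt a1 (a2 z) z)
    (d2 : ∀ z ∈ Ioo 0 H, HasDerivAt a2 (a3 z) z)
    (d3 : ∀ z ∈ Ioo 0 H, HasDerivAt a3 (K * τ z + 2 * K * a2 z - K ^ 2 * a z) z)
    (b0 : a 0 = 0) (b1 : a1 0 = 0) (t0 : a H = 0) (t1 : a1 H = 0) :
    ∫ z in (0 : ℝ)..H, a1 z ^ 2 ≤ ∫ z in (0 : ℝ)..H, a z * τ z := by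
  have hmpos : 0 < m := by
    by_contra hneg
    nlinarith
  refine intervalIntegral_le_of_le_add_deriv
    (F := fun z => -(m * (a z * a3 z - a1 z * a2 z) - 2 * (a z * a1 z)))
    (F' := fun z => -(m * (a z * (K * τ z + 2 * K * a2 z - K ^ 2 * a z) - a2 z ^ 2)
      - 2 * (a1 z ^ 2 + a z * a2 z))) hH.le (by fun_prop) (by fun_prop) (by fun_prop)
    (by fun_prop) (fun z hz => ?_) (by simp [b0, b1]) (by simp [t0, t1]) fun z hz => ?_
  · refine (((((d0 z hz).mul (d3 z hz)).sub ((d1 z hz).mul (d2 z hz))).const_mul m).sub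
      (((d0 z hz).mul (d1 z hz)).const_mul 2)).neg.congr_deriv ?_
    ring
  · have h1 : m * (a z * (K * τ z + 2 * K * a2 z - K ^ 2 * a z) - a2 z ^ 2)
        = a z * τ z + 2 * a z * a2 z - K * a z ^ 2 - m * a2 z ^ 2 := by
      linear_combination (a z * τ z + 2 * a z * a2 z - K * a z ^ 2) * hm
    have h2 : 0 ≤ m * a2 z ^ 2 := by positivity
    have h3 : 0 ≤ K * a z ^ 2 := by positivity
    simp only [h1]
    nlinarith [sq_nonneg (a1 z)]

/-- An interior estimate for the second derivative in the mode equation. -/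
theorem mode_caccioppoli {K m H x : ℝ} (hm : m * K = 1) (hK : 0 < K) (hx : 0 < x)
    (hxH : 2 * x ≤ H)
    {a a1 a2 a3 τ : ℝ → ℝ} (ca : Continuous a) (ca1 : Continuous a1) (ca2 : Continuous a2)
    (ca3 : Continuous a3) (cτ : Continuous τ)
    (d0 : ∀ z ∈ Ioo 0 H, HasDerivAt a (a1 z) z) (d1 : ∀ z ∈ Ioo 0 H, HasDerivAt a1 (a2 z) z)
    (d2 : ∀ z ∈ Ioo 0 H, HasDerivAt a2 (a3 z) z)
    (d3 : ∀ z ∈ Ioo 0 H, HasDerivAt a3 (K * τ z + 2 * K * a2 z - K ^ 2 * a z) z) :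
    m * a2 x ^ 2 * x ^ 3 ≤ ∫ z in (0 : ℝ)..(2 * x),
      (7 * x ^ 2 * (m * a2 z ^ 2 + K * a z ^ 2) + x ^ 4 * τ z ^ 2) := by
  have hmpos : 0 < m := by
    by_contra hneg
    nlinarith
  have d0' : ∀ z ∈ Ioo 0 (2 * x), HasDerivAt a (a1 z) z := fun z hz => d0 z ⟨hz.1, hz.2.trans_le hxH⟩
  have d1' : ∀ z ∈ Ioo 0 (2 * x), HasDerivAt a1 (a2 z) z := fun z hz => d1 z ⟨hz.1, hz.2.trans_le hxH⟩
  have d2' : ∀ z ∈ Ioo 0 (2 * x), HasDerivAt a2 (a3 z) z := fun z hz => d2 z ⟨hz.1, hz.2.trans_le hxH⟩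
  have d3' : ∀ z ∈ Ioo 0 (2 * x), HasDerivAt a3 (K * τ z + 2 * K * a2 z - K ^ 2 * a z) z :=
    fun z hz => d3 z ⟨hz.1, hz.2.trans_le hxH⟩
  -- Double zeros at `0` and `2 x` remove all boundary terms, so no boundary condition on `a` is
  -- needed. On the interval `η ≤ x⁴` and `η'' ≤ 8 x²`.
  let η : ℝ → ℝ := fun z => z ^ 2 * (2 * x - z) ^ 2
  let η1 : ℝ → ℝ := fun z => 4 * z * (2 * x - z) * (x - z)
  let η2 : ℝ → ℝ := fun z => 12 * (z - x) ^ 2 - 4 * x ^ 2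
  have cη : Continuous η := by fun_prop
  have cη1 : Continuous η1 := by fun_prop
  have cη2 : Continuous η2 := by fun_prop
  have dη : ∀ z, HasDerivAt η (η1 z) z := fun z => by
    refine (((hasDerivAt_id z).pow 2).mul (((hasDerivAt_id z).const_sub (2 * x)).pow 2)).congr_deriv ?_
    simp only [η1, Pi.pow_apply, id_eq]
    push_cast
    ring
  have dη1 : ∀ z, HasDerivAt η1 (η2 z) z := fun z => by
    refine ((((hasDerivAt_id z).const_mul 4).mul ((hasDerivAt_id z).const_sub (2 * x))).mul
      ((hasDerivAt_id z).const_sub x)).congr_deriv ?_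
    simp only [η2, Pi.mul_apply, id_eq]
    ring
  have hη0 : ∀ z, 0 ≤ η z := fun z => by positivity
  -- the third derivative, weighted by the cutoff
  have key : ∫ z in (0 : ℝ)..(2 * x), m * (η z * a3 z ^ 2) ≤ ∫ z in (0 : ℝ)..(2 * x),
      (4 * x ^ 2 * (m * a2 z ^ 2 + K * a z ^ 2) + x ^ 4 * τ z ^ 2) := by
    -- The equation is multiplied by `η a2`; half of `η'' ≤ 8 x²` produces the factor `4 x²`.
    refine intervalIntegral_le_of_le_add_deriv
      (F := fun z => m * (η z * (a3 z * a2 z)) - m * (1 / 2) * (η1 z * a2 z ^ 2)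
        + K * (η z * (a z * a1 z)) - K * (1 / 2) * (η1 z * a z ^ 2))
      (F' := fun z => m * (η1 z * (a3 z * a2 z)
            + η z * ((K * τ z + 2 * K * a2 z - K ^ 2 * a z) * a2 z + a3 z * a3 z))
          - m * (1 / 2) * (η2 z * a2 z ^ 2 + η1 z * (2 * a2 z * a3 z))
          + K * (η1 z * (a z * a1 z) + η z * (a1 z * a1 z + a z * a2 z))
          - K * (1 / 2) * (η2 z * a z ^ 2 + η1 z * (2 * a z * a1 z)))
      (by positivity) (by fun_prop) (by fun_prop) (by fun_prop) (by fun_prop) (fun z hz => ?_)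
      (by simp [η, η1]) (by simp [η, η1]) fun z hz => ?_
    · have A := d0' z hz
      have A1 := d1' z hz
      have A2 := d2' z hz
      have A3 := d3' z hz
      have E0 := dη z
      have E1 := dη1 z
      refine ((((E0.mul (A3.mul A2)).const_mul m).sub ((E1.mul (A2.pow 2)).const_mul _)).add
        ((E0.mul (A.mul A1)).const_mul K)).sub ((E1.mul (A.pow 2)).const_mul _) |>.congr_deriv ?_
      simp only [Pi.mul_apply, Pi.pow_apply]
      push_cast
      ring
    · have h1 : m * (η1 z * (a3 z * a2 z)
            + η z * ((K * τ z + 2 * K * a2 z - K ^ 2 * a z) * a2 z + a3 z * a3 z))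
          - m * (1 / 2) * (η2 z * a2 z ^ 2 + η1 z * (2 * a2 z * a3 z))
          + K * (η1 z * (a z * a1 z) + η z * (a1 z * a1 z + a z * a2 z))
          - K * (1 / 2) * (η2 z * a z ^ 2 + η1 z * (2 * a z * a1 z))
          = m * (η z * a3 z ^ 2) + η z * (τ z * a2 z + 2 * a2 z ^ 2) + K * (η z * a1 z ^ 2)
            - 1 / 2 * (η2 z * (m * a2 z ^ 2 + K * a z ^ 2)) := by
        linear_combination (η z * (τ z * a2 z + 2 * a2 z ^ 2) - K * (η z * (a z * a2 z))) * hm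
      have h2 : η2 z ≤ 8 * x ^ 2 := by
        simp only [η2]
        nlinarith [hz.1, hz.2, mul_nonneg hz.1 (sub_nonneg.2 hz.2)]
      have h3 : η z ≤ x ^ 4 := by
        have e1 : 0 ≤ z * (2 * x - z) := mul_nonneg hz.1 (sub_nonneg.2 hz.2)
        have e2 : z * (2 * x - z) ≤ x ^ 2 := by nlinarith [sq_nonneg (z - x)]
        calc η z = (z * (2 * x - z)) ^ 2 := by simp only [η]; ring
          _ ≤ (x ^ 2) ^ 2 := by gcongr
          _ = x ^ 4 := by ring
      have h4 : η2 z * (m * a2 z ^ 2 + K * a z ^ 2) ≤ 8 * x ^ 2 * (m * a2 z ^ 2 + K * a z ^ 2) := by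
        gcongr
      have h5 : η z * τ z ^ 2 ≤ x ^ 4 * τ z ^ 2 := by gcongr
      have h6 : 0 ≤ η z * (τ z + a2 z) ^ 2 := mul_nonneg (hη0 z) (sq_nonneg _)
      have h7 : 0 ≤ η z * (a2 z) ^ 2 := mul_nonneg (hη0 z) (sq_nonneg _)
      have h8 : 0 ≤ K * (η z * a1 z ^ 2) := by have := hη0 z; positivity
      have h9 : 0 ≤ η z * (τ z) ^ 2 := mul_nonneg (hη0 z) (sq_nonneg _)
      rw [h1]
      nlinarith
  -- The value at `x` comes from integrating the derivative of `z² a2²` over `(0, x)`, where `z⁴ ≤ η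
  -- z`, so the third derivative appears with the cutoff already controlled.
  have fin : m * a2 x ^ 2 * x ^ 3 ≤ ∫ z in (0 : ℝ)..x,
      (3 * x ^ 2 * (m * a2 z ^ 2 + K * a z ^ 2) + m * (η z * a3 z ^ 2)) := by
    have e1 : ∫ z in (0 : ℝ)..x, m * x * (2 * z * a2 z ^ 2 + z ^ 2 * (2 * a2 z * a3 z))
        = m * a2 x ^ 2 * x ^ 3 := by
      rw [intervalIntegral.integral_eq_sub_of_hasDerivAt_of_le hx.le
        (f := fun z => m * x * (z ^ 2 * a2 z ^ 2)) (by fun_prop) (fun z hz => ?_)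
        (Continuous.intervalIntegrable (by fun_prop) _ _)]
      · ring
      · refine (((hasDerivAt_id z).pow 2).mul
          ((d2' z ⟨hz.1, by linarith [hz.2]⟩).pow 2)).const_mul _ |>.congr_deriv ?_
        simp only [Pi.pow_apply, id_eq]
        push_cast
        ring
    rw [← e1]
    refine intervalIntegral.integral_mono_on hx.le (Continuous.intervalIntegrable (by fun_prop) _ _)
      (Continuous.intervalIntegrable (by fun_prop) _ _) fun z hz => ?_
    have h1 : x * (2 * z * a2 z ^ 2 + z ^ 2 * (2 * a2 z * a3 z))
        ≤ 3 * x ^ 2 * a2 z ^ 2 + z ^ 4 * a3 z ^ 2 := by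
      have e2 : x * (2 * z * a2 z ^ 2) ≤ 2 * x ^ 2 * a2 z ^ 2 := by
        nlinarith [mul_nonneg (mul_nonneg hx.le (sub_nonneg.2 hz.2)) (sq_nonneg (a2 z))]
      nlinarith [sq_nonneg (x * a2 z - z ^ 2 * a3 z)]
    have h2 : z ^ 4 * a3 z ^ 2 ≤ η z * a3 z ^ 2 := by
      gcongr
      calc z ^ 4 = z ^ 2 * z ^ 2 := by ring
        _ ≤ z ^ 2 * (2 * x - z) ^ 2 := by
          have := hz.1
          gcongr
          linarith [hz.2]
    have h3 := mul_le_mul_of_nonneg_left (h1.trans (add_le_add_right h2 _)) hmpos.le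
    have h4 : 0 ≤ x ^ 2 * (K * a z ^ 2) := by positivity
    nlinarith
  refine fin.trans ?_
  have mono : ∫ z in (0 : ℝ)..x, (3 * x ^ 2 * (m * a2 z ^ 2 + K * a z ^ 2) + m * (η z * a3 z ^ 2))
      ≤ ∫ z in (0 : ℝ)..(2 * x),
        (3 * x ^ 2 * (m * a2 z ^ 2 + K * a z ^ 2) + m * (η z * a3 z ^ 2)) := by
    refine intervalIntegral.integral_mono_interval le_rfl hx.le (by linarith)
      (Eventually.of_forall fun z => ?_) (Continuous.intervalIntegrable (by fun_prop) _ _)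
    have := hη0 z
    simp only [Pi.zero_apply]
    positivity
  refine mono.trans ?_
  rw [intervalIntegral.integral_add (Continuous.intervalIntegrable (by fun_prop) _ _)
    (Continuous.intervalIntegrable (by fun_prop) _ _)]
  refine (add_le_add_right key _).trans (le_of_eq ?_)
  rw [← intervalIntegral.integral_add (Continuous.intervalIntegrable (by fun_prop) _ _)
    (Continuous.intervalIntegrable (by fun_prop) _ _)]
  congr 1
  funext z
  ring

set_option maxHeartbeats 1000000 in
/-- The pointwise bound for the second derivative in the mode equation. -/
theorem mode_pointwise {K m H x : ℝ} (hm : m * K = 1) (hK : 0 < K) (hx : 0 < x)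
    (hxH : 2 * x ≤ H)
    {a a1 a2 a3 τ : ℝ → ℝ} (ca : Continuous a) (ca1 : Continuous a1) (ca2 : Continuous a2)
    (ca3 : Continuous a3) (cτ : Continuous τ)
    (d0 : ∀ z ∈ Ioo 0 H, HasDerivAt a (a1 z) z) (d1 : ∀ z ∈ Ioo 0 H, HasDerivAt a1 (a2 z) z)
    (d2 : ∀ z ∈ Ioo 0 H, HasDerivAt a2 (a3 z) z)
    (d3 : ∀ z ∈ Ioo 0 H, HasDerivAt a3 (K * τ z + 2 * K * a2 z - K ^ 2 * a z) z)
    (b0 : a 0 = 0) (b1 : a1 0 = 0) (t0 : a H = 0) (t1 : a1 H = 0) :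
    m * a2 x ^ 2 ≤ 3000 * (∫ z in (0 : ℝ)..H, (z + x)⁻¹ * (a z * τ z))
      + x * ∫ z in (0 : ℝ)..(2 * x), τ z ^ 2 := by
  have hmpos : 0 < m := by
    by_contra hneg
    nlinarith
  have hH : 0 < H := by linarith
  -- With `ε = x` the weight is comparable to `1 / x` on `(0, 2x)`: `1 ≤ 3 x r` and `x r ≤ 1`.
  obtain ⟨r, hr⟩ : ∃ r : ℝ → ℝ, r = fun z => (z + x)⁻¹ := ⟨_, rfl⟩
  have hpos : ∀ z ∈ Icc 0 H, 0 < z + x := fun z hz => by linarith [hz.1]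
  have cr : ContinuousOn r (Icc 0 H) := by
    rw [hr]
    exact ContinuousOn.inv₀ (by fun_prop) fun z hz => (hpos z hz).ne'
  have dr : ∀ z ∈ Ioo 0 H, HasDerivAt r (-(r z ^ 2)) z := fun z hz => by
    have h1 := ((hasDerivAt_id z).add_const x).inv (hpos z (Ioo_subset_Icc_self hz)).ne'
    rw [hr]
    refine h1.congr_deriv ?_
    simp only [id_eq]
    field_simp
  have rpos : ∀ z ∈ Icc 0 H, 0 < r z := fun z hz => by rw [hr]; exact inv_pos.2 (hpos z hz)
  obtain ⟨w1, w2⟩ := mode_weighted_energy hm hK hH cr rpos dr ca ca1 ca2 ca3 cτ d0 d1 d2 d3 b0 b1 t0 t1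
  have hI : ∫ z in (0 : ℝ)..H, (z + x)⁻¹ * (a z * τ z) = ∫ z in (0 : ℝ)..H, r z * (a z * τ z) := by
    rw [hr]
  rw [hI]
  set I := ∫ z in (0 : ℝ)..H, r z * (a z * τ z)
  have hsub : Icc 0 (2 * x) ⊆ Icc 0 H := Icc_subset_Icc_right hxH
  let f : ℝ → ℝ := fun z => a1 z * r z - 2 * a z * r z ^ 2
  let g : ℝ → ℝ := fun z => a2 z - 3 * a1 z * r z + 4 * a z * r z ^ 2
  let φ : ℝ → ℝ := fun z => a z * r z ^ 2
  have cφ : ContinuousOn φ (Icc 0 H) := by fun_prop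
  have cf : ContinuousOn f (Icc 0 H) := by fun_prop
  have cg : ContinuousOn g (Icc 0 H) := by fun_prop
  have h3x : ∀ z ∈ Icc 0 (2 * x), 1 ≤ 3 * x * r z := fun z hz => by
    rw [hr, ← div_eq_mul_inv, one_le_div (hpos z (hsub hz))]
    linarith [hz.2]
  have hrx : ∀ z ∈ Icc 0 (2 * x), x * r z ≤ 1 := fun z hz => by
    rw [hr, ← div_eq_mul_inv, div_le_one (hpos z (hsub hz))]
    linarith [hz.1]
  have cr' := cr.mono hsub
  have cφ' := cφ.mono hsub
  have cf' := cf.mono hsub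
  have cg' := cg.mono hsub
  have ii : ∀ {u : ℝ → ℝ}, ContinuousOn u (Icc 0 (2 * x)) → IntervalIntegrable u volume 0 (2 * x) :=
    fun hu => hu.intervalIntegrable_of_Icc (by linarith)
  have loc : ∀ u : ℝ → ℝ, ContinuousOn u (Icc 0 H) → (∀ z ∈ Icc 0 H, 0 ≤ u z) →
      ∫ z in (0 : ℝ)..(2 * x), u z ≤ ∫ z in (0 : ℝ)..H, u z := fun u hu hu0 => by
    rw [intervalIntegral.integral_of_le (by linarith), intervalIntegral.integral_of_le hH.le]
    refine setIntegral_mono_set ((hu.integrableOn_Icc).mono_set Ioc_subset_Icc_self) ?_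
      (Ioc_subset_Ioc_right hxH).eventuallyLE
    filter_upwards [ae_restrict_mem measurableSet_Ioc] with z hz
    exact hu0 z (Ioc_subset_Icc_self hz)
  have hD : m * ∫ z in (0 : ℝ)..(2 * x), r z * (f z ^ 2 + g z ^ 2) ≤ I :=
    (mul_le_mul_of_nonneg_left (loc (fun z => r z * (f z ^ 2 + g z ^ 2)) (by fun_prop)
      fun z hz => by have := rpos z hz; positivity) hmpos.le).trans w2
  have hA : ∫ z in (0 : ℝ)..(2 * x), K * a z ^ 2 ≤ 6 * x * I := by
    have e1 : ∫ z in (0 : ℝ)..(2 * x), r z * (K * a z ^ 2 + 2 * a1 z ^ 2) ≤ 2 * I :=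
      (loc (fun z => r z * (K * a z ^ 2 + 2 * a1 z ^ 2)) (by fun_prop)
        fun z hz => by have := rpos z hz; positivity).trans w1
    have e2 : ∫ z in (0 : ℝ)..(2 * x), K * a z ^ 2
        ≤ ∫ z in (0 : ℝ)..(2 * x), 3 * x * (r z * (K * a z ^ 2 + 2 * a1 z ^ 2)) := by
      refine intervalIntegral.integral_mono_on (by linarith) (ii (by fun_prop)) (ii (by fun_prop))
        fun z hz => ?_
      have e3 := mul_le_mul_of_nonneg_right (h3x z hz)
        (by positivity : 0 ≤ K * a z ^ 2 + 2 * a1 z ^ 2)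
      nlinarith [sq_nonneg (a1 z)]
    rw [intervalIntegral.integral_const_mul (3 * x)] at e2
    have e3 := mul_le_mul_of_nonneg_left e1 (by positivity : 0 ≤ 3 * x)
    linarith
  -- the profile `a r²` is controlled by its logarithmic derivative
  have hφ : ∫ z in (0 : ℝ)..(2 * x), φ z ^ 2
      ≤ 16 * x * ∫ z in (0 : ℝ)..(2 * x), r z * (f z ^ 2 + g z ^ 2) := by
    have e1 := integral_sq_le_of_left_eq_zero (f := φ) (f' := fun z => r z * f z) (b := 2 * x)
      (by linarith) cφ' (by fun_prop) (fun z hz => by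
        have hz' : z ∈ Ioo 0 H := ⟨hz.1, hz.2.trans_le hxH⟩
        refine ((d0 z hz').mul ((dr z hz').pow 2)).congr_deriv ?_
        simp only [f, Pi.pow_apply]
        push_cast
        ring) (by simp [φ, b0])
    refine e1.trans ?_
    rw [← intervalIntegral.integral_const_mul, ← intervalIntegral.integral_const_mul]
    refine intervalIntegral.integral_mono_on (by linarith) (ii (by fun_prop)) (ii (by fun_prop))
      fun z hz => ?_
    have rp := rpos z (hsub hz)
    have e2 : x * r z * (r z * f z ^ 2) ≤ 1 * (r z * f z ^ 2) := by
      have := hrx z hz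
      gcongr
    have e3 : 0 ≤ r z * g z ^ 2 := by positivity
    nlinarith
  -- From `a2 = g + 3 f + 2 φ`, the terms in `f` and `g` cost `27 · 3 x r` and the term `12 φ²`
  -- costs `12 · 16 x`: `273 = 192 + 81`.
  have hB : ∫ z in (0 : ℝ)..(2 * x), a2 z ^ 2
      ≤ 273 * x * ∫ z in (0 : ℝ)..(2 * x), r z * (f z ^ 2 + g z ^ 2) := by
    have e1 : ∫ z in (0 : ℝ)..(2 * x), a2 z ^ 2
        ≤ ∫ z in (0 : ℝ)..(2 * x), (12 * φ z ^ 2 + 81 * x * (r z * (f z ^ 2 + g z ^ 2))) := by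
      refine intervalIntegral.integral_mono_on (by linarith) (ii (by fun_prop)) (ii (by fun_prop))
        fun z hz => ?_
      have e2 : a2 z = g z + 3 * f z + 2 * φ z := by
        simp only [f, g, φ]
        ring
      have e3 := mul_le_mul_of_nonneg_right (h3x z hz) (by positivity : 0 ≤ f z ^ 2 + g z ^ 2)
      rw [e2]
      nlinarith [sq_nonneg (g z - 3 * f z), sq_nonneg (g z - 2 * φ z),
        sq_nonneg (3 * f z - 2 * φ z), sq_nonneg (g z)]
    rw [intervalIntegral.integral_add (ii (by fun_prop)) (ii (by fun_prop)),
      intervalIntegral.integral_const_mul, intervalIntegral.integral_const_mul] at e1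
    linarith
  have hc := mode_caccioppoli hm hK hx hxH ca ca1 ca2 ca3 cτ d0 d1 d2 d3
  rw [intervalIntegral.integral_add (ii (by fun_prop)) (ii (by fun_prop)),
    intervalIntegral.integral_const_mul, intervalIntegral.integral_const_mul,
    intervalIntegral.integral_add (ii (by fun_prop)) (ii (by fun_prop)),
    intervalIntegral.integral_const_mul] at hc
  have hB' : m * ∫ z in (0 : ℝ)..(2 * x), a2 z ^ 2 ≤ 273 * x * I := by
    have e1 := mul_le_mul_of_nonneg_left hB hmpos.le
    have e2 := mul_le_mul_of_nonneg_left hD (by positivity : 0 ≤ 273 * x)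
    linarith
  have hI0 : 0 ≤ I := by
    refine le_trans (mul_nonneg hmpos.le (intervalIntegral.integral_nonneg (by linarith)
      fun z hz => ?_)) hD
    have := rpos z (hsub hz)
    positivity
  -- The interior estimate gives `7 · (273 + 6) = 1953`, rounded up to 3000.
  have fin : m * a2 x ^ 2 * x ^ 3
      ≤ (3000 * I + x * ∫ z in (0 : ℝ)..(2 * x), τ z ^ 2) * x ^ 3 := by
    have e1 : 7 * x ^ 2 * ((m * ∫ z in (0 : ℝ)..(2 * x), a2 z ^ 2)
        + ∫ z in (0 : ℝ)..(2 * x), K * a z ^ 2) ≤ 7 * x ^ 2 * (273 * x * I + 6 * x * I) := by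
      gcongr
    have e2 : 0 ≤ x ^ 3 * I := by positivity
    have e3 : 7 * x ^ 2 * (273 * x * I + 6 * x * I) = 1953 * (x ^ 3 * I) := by ring
    have e4 : (3000 * I + x * ∫ z in (0 : ℝ)..(2 * x), τ z ^ 2) * x ^ 3
        = 3000 * (x ^ 3 * I) + x ^ 4 * ∫ z in (0 : ℝ)..(2 * x), τ z ^ 2 := by ring
    rw [e4]
    linarith
  exact le_of_mul_le_mul_right fin (by positivity)

end RayleighBenard

end

noncomputable section

namespace RayleighBenard

/-! ### The Stokes system for one horizontal Fourier mode -/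

/-- A function with `f'' = K f`, `K ≥ 0`, and zero boundary values vanishes. -/
theorem eq_zero_of_deriv_deriv_eq {K H : ℝ} (hK : 0 ≤ K) (hH : 0 < H) {f f1 f2 : ℝ → ℝ}
    (cf : Continuous f) (cf1 : Continuous f1)
    (d0 : ∀ z ∈ Ioo 0 H, HasDerivAt f (f1 z) z) (d1 : ∀ z ∈ Ioo 0 H, HasDerivAt f1 (f2 z) z)
    (h : ∀ z ∈ Ioo 0 H, f2 z = K * f z) (b0 : f 0 = 0) (t0 : f H = 0) :
    ∀ z ∈ Icc 0 H, f z = 0 := by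
  have e1 := intervalIntegral_eq_zero_of_hasDerivAt (f := fun z => f z * f1 z)
    (f' := fun z => f1 z ^ 2 + K * f z ^ 2) hH.le (by fun_prop) (by fun_prop)
    (fun z hz => ((d0 z hz).mul (d1 z hz)).congr_deriv (by rw [h z hz]; ring))
    (by simp [b0]) (by simp [t0])
  have e2 : ∫ z in (0 : ℝ)..H, f1 z ^ 2 ≤ ∫ z in (0 : ℝ)..H, (f1 z ^ 2 + K * f z ^ 2) :=
    intervalIntegral.integral_mono_on hH.le (Continuous.intervalIntegrable (by fun_prop) _ _)
      (Continuous.intervalIntegrable (by fun_prop) _ _) fun z _ => by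
        have : 0 ≤ K * f z ^ 2 := by positivity
        linarith
  intro z hz
  have e3 := sq_le_mul_integral_sq hz cf.continuousOn cf1.continuousOn d0 b0
  have e4 : z * ∫ s in (0 : ℝ)..H, f1 s ^ 2 ≤ 0 :=
    mul_nonpos_of_nonneg_of_nonpos hz.1 (e2.trans e1.le)
  exact pow_eq_zero_iff two_ne_zero |>.1 (le_antisymm (e3.trans e4) (sq_nonneg _))

/-- The data of one horizontal Fourier mode of the Stokes system with wave vector `κ`: horizontal
velocity `b`, vertical velocity `a`, pressure `q` and forcing `τ`. -/
structure StokesMode (n : ℕ) (H : ℝ) where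
  κ : Fin n → ℝ
  b : Fin n → ℝ → ℝ
  b1 : Fin n → ℝ → ℝ
  b2 : Fin n → ℝ → ℝ
  a : ℝ → ℝ
  a1 : ℝ → ℝ
  a2 : ℝ → ℝ
  q : ℝ → ℝ
  q1 : ℝ → ℝ
  τ : ℝ → ℝ
  cb : ∀ i, Continuous (b i)
  cb1 : ∀ i, Continuous (b1 i)
  cb2 : ∀ i, Continuous (b2 i)
  ca : Continuous a
  ca1 : Continuous a1
  cτ : Continuous τ
  db : ∀ i, ∀ z ∈ Ioo 0 H, HasDerivAt (b i) (b1 i z) z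
  db1 : ∀ i, ∀ z ∈ Ioo 0 H, HasDerivAt (b1 i) (b2 i z) z
  da : ∀ z ∈ Ioo 0 H, HasDerivAt a (a1 z) z
  da1 : ∀ z ∈ Ioo 0 H, HasDerivAt a1 (a2 z) z
  dq : ∀ z ∈ Ioo 0 H, HasDerivAt q (q1 z) z
  divergence : ∀ z ∈ Ioo 0 H, (∑ i, κ i * b i z) + a1 z = 0
  horizontal : ∀ i, ∀ z ∈ Ioo 0 H, -b2 i z + (∑ j, κ j ^ 2) * b i z - κ i * q z = 0
  vertical : ∀ z ∈ Ioo 0 H, -a2 z + (∑ j, κ j ^ 2) * a z + q1 z = τ z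
  b_bottom : ∀ i, b i 0 = 0
  b_top : ∀ i, b i H = 0
  a_bottom : a 0 = 0
  a_top : a H = 0

namespace StokesMode

variable {n : ℕ} {H : ℝ} (S : StokesMode n H)

/-- The squared length of the wave vector. -/
def K : ℝ := ∑ j, S.κ j ^ 2

theorem K_nonneg : 0 ≤ S.K := Finset.sum_nonneg fun _ _ => sq_nonneg _

/-- The horizontal velocity of a mode is parallel to its wave vector. -/
theorem parallel (hH : 0 < H) (i j : Fin n) :
    ∀ z ∈ Icc 0 H, S.κ i * S.b j z = S.κ j * S.b i z := by
  have h := eq_zero_of_deriv_deriv_eq S.K_nonneg hH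
    (f := fun z => S.κ i * S.b j z - S.κ j * S.b i z)
    (f1 := fun z => S.κ i * S.b1 j z - S.κ j * S.b1 i z)
    (f2 := fun z => S.κ i * S.b2 j z - S.κ j * S.b2 i z)
    (((S.cb j).const_mul _).sub ((S.cb i).const_mul _))
    (((S.cb1 j).const_mul _).sub ((S.cb1 i).const_mul _))
    (fun z hz => ((S.db j z hz).const_mul _).sub ((S.db i z hz).const_mul _))
    (fun z hz => ((S.db1 j z hz).const_mul _).sub ((S.db1 i z hz).const_mul _))
    (fun z hz => by
      have h1 := S.horizontal i z hz
      have h2 := S.horizontal j z hz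
      rw [K]
      linear_combination -S.κ i * h2 + S.κ j * h1)
    (by simp [S.b_bottom]) (by simp [S.b_top])
  exact fun z hz => sub_eq_zero.1 (h z hz)

theorem a1_eq {z : ℝ} (hz : z ∈ Ioo 0 H) : S.a1 z = -∑ i, S.κ i * S.b i z := by
  linarith [S.divergence z hz]

theorem hasDerivAt_sum_b {z : ℝ} (hz : z ∈ Ioo 0 H) :
    HasDerivAt (fun z => -∑ i, S.κ i * S.b i z) (-∑ i, S.κ i * S.b1 i z) z :=
  (HasDerivAt.fun_sum fun i _ => (S.db i z hz).const_mul (S.κ i)).neg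

theorem hasDerivAt_sum_b1 {z : ℝ} (hz : z ∈ Ioo 0 H) :
    HasDerivAt (fun z => -∑ i, S.κ i * S.b1 i z) (-∑ i, S.κ i * S.b2 i z) z :=
  (HasDerivAt.fun_sum fun i _ => (S.db1 i z hz).const_mul (S.κ i)).neg

/-- As `b` is parallel to `κ`, it is recovered from the scalar `κ · b`, which is `-a'` in the
interior. Thus all of `b` is controlled by `a`. -/
theorem K_mul_b (hH : 0 < H) (i : Fin n) {z : ℝ} (hz : z ∈ Icc 0 H) :
    S.K * S.b i z = S.κ i * ∑ j, S.κ j * S.b j z := by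
  rw [K, Finset.sum_mul, Finset.mul_sum]
  refine Finset.sum_congr rfl fun j _ => ?_
  linear_combination S.κ j * S.parallel hH j i z hz

theorem K_mul_b1 (hH : 0 < H) (i : Fin n) {z : ℝ} (hz : z ∈ Ioo 0 H) :
    S.K * S.b1 i z = S.κ i * ∑ j, S.κ j * S.b1 j z := by
  have h1 := (S.db i z hz).const_mul S.K
  have h2 := (HasDerivAt.fun_sum fun j (_ : j ∈ Finset.univ) =>
    (S.db j z hz).const_mul (S.κ j)).const_mul (S.κ i)
  refine h1.unique (h2.congr_of_eventuallyEq ?_)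
  filter_upwards [Ioo_mem_nhds hz.1 hz.2] with x hx
  exact S.K_mul_b hH i (Ioo_subset_Icc_self hx)

theorem a2_eq {z : ℝ} (hz : z ∈ Ioo 0 H) : S.a2 z = -∑ i, S.κ i * S.b1 i z := by
  refine (S.da1 z hz).unique ((S.hasDerivAt_sum_b hz).congr_of_eventuallyEq ?_)
  filter_upwards [Ioo_mem_nhds hz.1 hz.2] with x hx
  exact S.a1_eq hx

/-- The left side plays the role of `a'''`. It is found by projecting the horizontal momentum
equation onto `κ`, and the right side can be differentiated once more. -/
theorem sum_b2_eq {z : ℝ} (hz : z ∈ Ioo 0 H) :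
    -∑ i, S.κ i * S.b2 i z = S.K * S.a1 z + S.K * S.q z := by
  have h1 : ∀ i, S.κ i * S.b2 i z = S.K * (S.κ i * S.b i z) - S.κ i ^ 2 * S.q z := fun i => by
    have := S.horizontal i z hz
    rw [K]
    linear_combination -S.κ i * this
  rw [S.a1_eq hz, Finset.sum_congr rfl fun i _ => h1 i, Finset.sum_sub_distrib, ← Finset.mul_sum,
    ← Finset.sum_mul, K]
  ring

/-- The velocity is only `C²`, so a fourth derivative of `a` is not available directly. It exists
here because `κ · b''` is a combination of `a'` and the differentiable pressure, which the vertical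
equation then eliminates. -/
theorem hasDerivAt_sum_b2 {z : ℝ} (hz : z ∈ Ioo 0 H) :
    HasDerivAt (fun z => -∑ i, S.κ i * S.b2 i z)
      (S.K * S.τ z + 2 * S.K * -(∑ i, S.κ i * S.b1 i z) - S.K ^ 2 * S.a z) z := by
  have h1 := ((S.da1 z hz).const_mul S.K).add ((S.dq z hz).const_mul S.K)
  have h2 : HasDerivAt (fun z => -∑ i, S.κ i * S.b2 i z) (S.K * S.a2 z + S.K * S.q1 z) z := by
    refine h1.congr_of_eventuallyEq ?_
    filter_upwards [Ioo_mem_nhds hz.1 hz.2] with x hx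
    exact S.sum_b2_eq hx
  refine h2.congr_deriv ?_
  have h3 := S.vertical z hz
  rw [← S.a2_eq hz, ← h3, ← K]
  ring

theorem sum_b_sq (hH : 0 < H) {z : ℝ} (hz : z ∈ Icc 0 H) :
    S.K * ∑ i, S.b i z ^ 2 = (∑ i, S.κ i * S.b i z) ^ 2 := by
  rw [sq (∑ i, S.κ i * S.b i z), Finset.mul_sum, Finset.sum_mul]
  refine Finset.sum_congr rfl fun i _ => ?_
  have := S.K_mul_b hH i hz
  linear_combination S.b i z * this

theorem sum_b1_sq (hH : 0 < H) {z : ℝ} (hz : z ∈ Ioo 0 H) :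
    S.K * ∑ i, S.b1 i z ^ 2 = (∑ i, S.κ i * S.b1 i z) ^ 2 := by
  rw [sq (∑ i, S.κ i * S.b1 i z), Finset.mul_sum, Finset.sum_mul]
  refine Finset.sum_congr rfl fun i _ => ?_
  have := S.K_mul_b1 hH i hz
  linear_combination S.b1 i z * this

/-! ### The mode of zero wave vector, which vanishes. -/

section Zero

variable {S}

theorem κ_eq_zero (hK : S.K = 0) (i : Fin n) : S.κ i = 0 :=
  pow_eq_zero_iff two_ne_zero |>.1
    ((Finset.sum_eq_zero_iff_of_nonneg fun j _ => sq_nonneg (S.κ j)).1 hK i (Finset.mem_univ i))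

theorem b_eq_zero (hH : 0 < H) (hK : S.K = 0) (i : Fin n) : ∀ z ∈ Icc 0 H, S.b i z = 0 :=
  eq_zero_of_deriv_deriv_eq le_rfl hH (S.cb i) (S.cb1 i) (S.db i) (S.db1 i)
    (fun z hz => by
      have := S.horizontal i z hz
      rw [← K, hK, κ_eq_zero hK i] at this
      linarith) (S.b_bottom i) (S.b_top i)

theorem b1_eq_zero (hH : 0 < H) (hK : S.K = 0) (i : Fin n) {z : ℝ} (hz : z ∈ Ioo 0 H) :
    S.b1 i z = 0 := by
  refine (S.db i z hz).unique ((hasDerivAt_const z (0 : ℝ)).congr_of_eventuallyEq ?_)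
  filter_upwards [Ioo_mem_nhds hz.1 hz.2] with x hx
  exact b_eq_zero hH hK i x (Ioo_subset_Icc_self hx)

theorem a1_eq_zero (hK : S.K = 0) {z : ℝ} (hz : z ∈ Ioo 0 H) : S.a1 z = 0 := by
  rw [S.a1_eq hz, Finset.sum_eq_zero fun i _ => by rw [κ_eq_zero hK i, zero_mul], neg_zero]

theorem a_eq_zero (hH : 0 < H) (hK : S.K = 0) : ∀ z ∈ Icc 0 H, S.a z = 0 :=
  eq_zero_of_deriv_deriv_eq (f1 := fun _ => 0) (f2 := fun _ => 0) le_rfl hH S.ca continuous_const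
    (fun z hz => (S.da z hz).congr_deriv (a1_eq_zero hK hz)) (fun z _ => hasDerivAt_const z 0)
    (fun z _ => by simp) S.a_bottom S.a_top

end Zero

theorem integral_congr_Ioo {f g : ℝ → ℝ} {a b : ℝ} (hab : a ≤ b) (h : ∀ z ∈ Ioo a b, f z = g z) :
    ∫ z in a..b, f z = ∫ z in a..b, g z := by
  rw [intervalIntegral.integral_of_le hab, intervalIntegral.integral_of_le hab,
    integral_Ioc_eq_integral_Ioo, integral_Ioc_eq_integral_Ioo]
  exact setIntegral_congr_fun measurableSet_Ioo h

/-- Representative of `a'` on the closed layer. The divergence equation holds only inside, whereas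
this expression visibly vanishes at the walls; the next two functions likewise represent `a''` and
`a'''`. -/
theorem cA (S : StokesMode n H) : Continuous fun z => -∑ i, S.κ i * S.b i z :=
  (continuous_finsetSum _ fun i _ => (S.cb i).const_mul _).neg

theorem cA1 (S : StokesMode n H) : Continuous fun z => -∑ i, S.κ i * S.b1 i z :=
  (continuous_finsetSum _ fun i _ => (S.cb1 i).const_mul _).neg

theorem cA2 (S : StokesMode n H) : Continuous fun z => -∑ i, S.κ i * S.b2 i z :=
  (continuous_finsetSum _ fun i _ => (S.cb2 i).const_mul _).neg

/-- `K |b|² = (κ · b)² = a'²`, so the term `2 a'²` of `mode_weighted_energy` accounts both for `a'²`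
and for `K |b|²`. -/
theorem weighted_energy (hH : 0 < H) {ε : ℝ} (hε : 0 < ε) :
    ∫ z in (0 : ℝ)..H, (z + ε)⁻¹ * (S.K * S.a z ^ 2 + S.a1 z ^ 2 + S.K * ∑ i, S.b i z ^ 2)
      ≤ 2 * ∫ z in (0 : ℝ)..H, (z + ε)⁻¹ * (S.a z * S.τ z) := by
  rcases S.K_nonneg.eq_or_lt with hK | hK
  · rw [integral_congr_Ioo hH.le (g := fun z => 0 * (S.a z * S.τ z)) fun z hz => by
        rw [← hK, a1_eq_zero hK.symm hz]; ring,
      integral_congr_Ioo (f := fun z => (z + ε)⁻¹ * (S.a z * S.τ z)) hH.le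
        (g := fun z => 0 * (S.a z * S.τ z)) fun z hz => by
        rw [a_eq_zero hH hK.symm z (Ioo_subset_Icc_self hz)]; ring]
    simp
  · have hpos : ∀ z ∈ Icc 0 H, 0 < z + ε := fun z hz => by linarith [hz.1]
    refine le_trans (le_of_eq ?_) (mode_weighted_energy (r := fun z => (z + ε)⁻¹)
      (inv_mul_cancel₀ hK.ne') hK hH
      (ContinuousOn.inv₀ (by fun_prop) fun z hz => (hpos z hz).ne')
      (fun z hz => inv_pos.2 (hpos z hz)) (fun z hz => ?_) S.ca S.cA S.cA1 S.cA2 S.cτ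
      (fun z hz => (S.da z hz).congr_deriv (S.a1_eq hz)) (fun z hz => S.hasDerivAt_sum_b hz)
      (fun z hz => S.hasDerivAt_sum_b1 hz) (fun z hz => S.hasDerivAt_sum_b2 hz) S.a_bottom
      (by simp [S.b_bottom]) S.a_top (by simp [S.b_top])).1
    · refine integral_congr_Ioo hH.le fun z hz => ?_
      rw [S.sum_b_sq hH (Ioo_subset_Icc_self hz), S.a1_eq hz]
      ring
    · refine (((hasDerivAt_id z).add_const ε).inv
        (hpos z (Ioo_subset_Icc_self hz)).ne').congr_deriv ?_
      simp only [id_eq]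
      field_simp

theorem energy (hH : 0 < H) :
    ∫ z in (0 : ℝ)..H, S.a1 z ^ 2 ≤ ∫ z in (0 : ℝ)..H, S.a z * S.τ z := by
  rcases S.K_nonneg.eq_or_lt with hK | hK
  · rw [integral_congr_Ioo hH.le (g := fun z => S.a z * S.τ z) fun z hz => by
        rw [a1_eq_zero hK.symm hz, a_eq_zero hH hK.symm z (Ioo_subset_Icc_self hz)]; ring]
  · refine le_trans (le_of_eq ?_) (mode_energy (inv_mul_cancel₀ hK.ne') hK hH S.ca S.cA S.cA1 S.cA2
      S.cτ (fun z hz => (S.da z hz).congr_deriv (S.a1_eq hz)) (fun z hz => S.hasDerivAt_sum_b hz)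
      (fun z hz => S.hasDerivAt_sum_b1 hz) (fun z hz => S.hasDerivAt_sum_b2 hz) S.a_bottom
      (by simp [S.b_bottom]) S.a_top (by simp [S.b_top]))
    exact integral_congr_Ioo hH.le fun z hz => by rw [S.a1_eq hz]

/-- For `K > 0` the left side is `a''(x)² / K`, because `b'` is also parallel to `κ`; this is what
`mode_pointwise` bounds. -/
theorem pointwise (hH : 0 < H) {x : ℝ} (hx : 0 < x) (hxH : 2 * x ≤ H) :
    ∑ i, S.b1 i x ^ 2 ≤ 3000 * (∫ z in (0 : ℝ)..H, (z + x)⁻¹ * (S.a z * S.τ z))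
      + x * ∫ z in (0 : ℝ)..(2 * x), S.τ z ^ 2 := by
  have hxI : x ∈ Ioo 0 H := ⟨hx, by linarith⟩
  rcases S.K_nonneg.eq_or_lt with hK | hK
  · rw [Finset.sum_eq_zero fun i _ => by rw [b1_eq_zero hH hK.symm i hxI, sq, zero_mul],
      integral_congr_Ioo hH.le (g := fun _ => 0)]
    · have : 0 ≤ ∫ z in (0 : ℝ)..(2 * x), S.τ z ^ 2 :=
        intervalIntegral.integral_nonneg (by linarith) fun z _ => sq_nonneg _
      simp only [intervalIntegral.integral_zero]
      positivity
    · intro z hz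
      rw [a_eq_zero hH hK.symm z (Ioo_subset_Icc_self hz)]
      ring
  · refine le_trans (le_of_eq ?_) (mode_pointwise (inv_mul_cancel₀ hK.ne') hK hx hxH S.ca S.cA S.cA1
      S.cA2 S.cτ (fun z hz => (S.da z hz).congr_deriv (S.a1_eq hz))
      (fun z hz => S.hasDerivAt_sum_b hz) (fun z hz => S.hasDerivAt_sum_b1 hz)
      (fun z hz => S.hasDerivAt_sum_b2 hz) S.a_bottom
      (by simp [S.b_bottom]) S.a_top (by simp [S.b_top]))
    rw [neg_sq, ← S.sum_b1_sq hH hxI]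
    field_simp

end StokesMode

end RayleighBenard

end

noncomputable section

namespace RayleighBenard

/-! ### Horizontal averages -/

/-- The average of `f` over the horizontal period cell. -/
def mean {n : ℕ} (L : ℝ) (f : (Fin n → ℝ) → ℝ) : ℝ := 1 / L ^ n * ∫ y in cell n L, f y

variable {n : ℕ} {L : ℝ}

theorem measurableSet_cell : MeasurableSet (cell n L) :=
  MeasurableSet.univ_pi fun _ => measurableSet_Ico

theorem restrict_cell : volume.restrict (cell n L)
    = volume.restrict (Icc (0 : Fin n → ℝ) fun _ => L) :=
  Measure.restrict_congr_set Measure.univ_pi_Ico_ae_eq_Icc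

theorem cell_subset : cell n L ⊆ Icc (0 : Fin n → ℝ) fun _ => L := fun _ hy =>
  ⟨fun i => (hy i (mem_univ i)).1, fun i => (hy i (mem_univ i)).2.le⟩

theorem integrableOn_cell {f : (Fin n → ℝ) → ℝ} (hf : Continuous f) :
    IntegrableOn f (cell n L) :=
  (hf.continuousOn.integrableOn_compact isCompact_Icc).mono_set cell_subset

theorem mean_congr {f g : (Fin n → ℝ) → ℝ} (h : ∀ y, f y = g y) : mean L f = mean L g := by
  rw [funext h]

theorem mean_add {f g : (Fin n → ℝ) → ℝ} (hf : Continuous f) (hg : Continuous g) :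
    mean L (fun y => f y + g y) = mean L f + mean L g := by
  rw [mean, mean, mean, integral_add (integrableOn_cell hf) (integrableOn_cell hg), mul_add]

theorem mean_sub {f g : (Fin n → ℝ) → ℝ} (hf : Continuous f) (hg : Continuous g) :
    mean L (fun y => f y - g y) = mean L f - mean L g := by
  rw [mean, mean, mean, integral_sub (integrableOn_cell hf) (integrableOn_cell hg), mul_sub]

theorem mean_sum {ι : Type*} (s : Finset ι) {f : ι → (Fin n → ℝ) → ℝ}
    (hf : ∀ i ∈ s, Continuous (f i)) :
    mean L (fun y => ∑ i ∈ s, f i y) = ∑ i ∈ s, mean L (f i) := by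
  simp only [mean]
  rw [integral_finsetSum _ fun i hi => integrableOn_cell (hf i hi), Finset.mul_sum]

theorem mean_const_mul (c : ℝ) (f : (Fin n → ℝ) → ℝ) :
    mean L (fun y => c * f y) = c * mean L f := by
  rw [mean, mean, integral_const_mul]
  ring

theorem mean_neg (f : (Fin n → ℝ) → ℝ) : mean L (fun y => -f y) = -mean L f := by
  rw [mean, mean, integral_neg]
  ring

theorem mean_mono (hL : 0 < L) {f g : (Fin n → ℝ) → ℝ} (hf : Continuous f) (hg : Continuous g)
    (h : ∀ y, f y ≤ g y) : mean L f ≤ mean L g :=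
  mul_le_mul_of_nonneg_left (integral_mono (integrableOn_cell hf) (integrableOn_cell hg) h)
    (by positivity)

theorem mean_nonneg (hL : 0 < L) {f : (Fin n → ℝ) → ℝ} (h : ∀ y, 0 ≤ f y) : 0 ≤ mean L f :=
  mul_nonneg (by positivity) (integral_nonneg h)

theorem mean_const (hL : 0 < L) (c : ℝ) : mean (n := n) L (fun _ => c) = c := by
  rw [mean, setIntegral_const, measureReal_def, cell, Real.volume_pi_Ico_toReal (fun _ => hL.le)]
  simp only [sub_zero, Finset.prod_const, Finset.card_univ, Fintype.card_fin, smul_eq_mul]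
  field_simp

theorem continuous_mean {X : Type*} [TopologicalSpace X] [FirstCountableTopology X]
    [LocallyCompactSpace X] {F : X → (Fin n → ℝ) → ℝ} (hF : Continuous (Function.uncurry F)) :
    Continuous fun x => mean L (F x) := by
  simp only [mean, restrict_cell]
  exact (continuous_parametric_integral_of_continuous hF isCompact_Icc).const_mul _

/-- Differentiation under the integral, dominated by the maximum of `F'` on the compact set `[a, b]`
times the closed cell. -/
theorem hasDerivAt_mean {F F' : ℝ → (Fin n → ℝ) → ℝ} (hF : ∀ s, Continuous (F s))
    (hF' : Continuous (Function.uncurry F')) {a b s : ℝ} (hs : s ∈ Ioo a b)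
    (h : ∀ x ∈ Ioo a b, ∀ y, HasDerivAt (fun x => F x y) (F' x y) x) :
    HasDerivAt (fun x => mean L (F x)) (mean L (F' s)) s := by
  obtain ⟨C, hC⟩ := ((isCompact_Icc (a := a) (b := b)).prod
    (isCompact_Icc (a := (0 : Fin n → ℝ)) (b := fun _ => L))).exists_bound_of_continuousOn
    hF'.continuousOn
  refine ((hasDerivAt_integral_of_dominated_loc_of_deriv_le (bound := fun _ => C)
    (isOpen_Ioo.mem_nhds hs) (Eventually.of_forall fun x => (integrableOn_cell (hF x)).1)
    (integrableOn_cell (hF s)) (integrableOn_cell ?_).1 ?_ ?_ ?_).2).const_mul _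
  · exact hF'.comp (by fun_prop : Continuous fun y => (s, y))
  · filter_upwards [ae_restrict_mem measurableSet_cell] with y hy x hx
    exact hC (x, y) ⟨Ioo_subset_Icc_self hx, cell_subset hy⟩
  · rw [restrict_cell]
    exact (continuousOn_const (c := C)).integrableOn_compact (μ := volume) isCompact_Icc
  · exact Eventually.of_forall fun y x hx => h x hx y

theorem mean_intervalIntegral {f : (Fin n → ℝ) → ℝ → ℝ} (hf : Continuous (Function.uncurry f))
    (a b : ℝ) : mean L (fun y => ∫ z in a..b, f y z) = ∫ z in a..b, mean L fun y => f y z := by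
  simp only [mean, restrict_cell]
  rw [intervalIntegral.integral_const_mul, intervalIntegral_integral_swap]
  rw [Measure.prod_restrict, ← Measure.volume_eq_prod]
  exact ((hf.comp continuous_swap).continuousOn.integrableOn_compact
    (isCompact_uIcc.prod isCompact_Icc)).mono_set (prod_mono uIoc_subset_uIcc subset_rfl)

theorem intervalIntegral_swap_of_continuous {F : ℝ → ℝ → ℝ} (hF : Continuous (Function.uncurry F))
    (a b c d : ℝ) : ∫ x in a..b, ∫ y in c..d, F x y = ∫ y in c..d, ∫ x in a..b, F x y :=
  intervalIntegral_intervalIntegral_swap ((hF.continuousOn.integrableOn_compact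
    (isCompact_uIcc.prod isCompact_uIcc)).mono_set (prod_mono uIoc_subset_uIcc uIoc_subset_uIcc))

/-- The phase `κ · y` of the horizontal Fourier mode `k`. -/
def phase (L : ℝ) (k : Fin n → ℤ) (y : Fin n → ℝ) : ℝ := ∑ j, 2 * Real.pi * k j / L * y j

/-- The cosine coefficient of the horizontal Fourier mode `k`. -/
def cosCoeff (L : ℝ) (k : Fin n → ℤ) (f : (Fin n → ℝ) → ℝ) : ℝ :=
  mean L fun y => Real.cos (phase L k y) * f y

/-- The sine coefficient of the horizontal Fourier mode `k`. -/
def sinCoeff (L : ℝ) (k : Fin n → ℤ) (f : (Fin n → ℝ) → ℝ) : ℝ :=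
  mean L fun y => Real.sin (phase L k y) * f y

@[fun_prop]
theorem continuous_phase (k : Fin n → ℤ) : Continuous (phase L k) := by
  unfold phase
  fun_prop

/-! ### Transfer to the unit torus: translation invariance and Parseval. -/

section Torus

open scoped Pointwise

local instance unitCircleMeasureSpace : MeasureSpace UnitAddCircle := ⟨AddCircle.haarAddCircle⟩

local instance unitCircleIsAddHaar : Measure.IsAddHaarMeasure (volume : Measure UnitAddCircle) :=
  inferInstanceAs (Measure.IsAddHaarMeasure AddCircle.haarAddCircle)

local instance unitCircleIsProbability : IsProbabilityMeasure (volume : Measure UnitAddCircle) :=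
  inferInstanceAs (IsProbabilityMeasure AddCircle.haarAddCircle)

/-- The representative in `(0, 1]ⁿ` of a point of the torus. -/
def rep (x : UnitAddTorus (Fin n)) : Fin n → ℝ := fun i => (AddCircle.equivIoc 1 0 (x i)).1

theorem measurable_rep : Measurable (rep (n := n)) :=
  measurable_pi_lambda _ fun i => measurable_subtype_coe.comp
    ((AddCircle.measurableEquivIoc (1 : ℝ) 0).measurable.comp (measurable_pi_apply i))

theorem coe_rep (x : UnitAddTorus (Fin n)) (i : Fin n) : ((rep x i : ℝ) : UnitAddCircle) = x i :=
  (AddCircle.equivIoc (1 : ℝ) 0).symm_apply_apply (x i)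

theorem rep_coe {y : Fin n → ℝ} (hy : ∀ i, y i ∈ Ioc (0 : ℝ) (0 + 1)) :
    rep (fun i => (y i : UnitAddCircle)) = y := by
  funext i
  exact congrArg Subtype.val ((AddCircle.equivIoc (1 : ℝ) 0).apply_symm_apply ⟨y i, hy i⟩)

theorem rep_mem (x : UnitAddTorus (Fin n)) : rep x ∈ Icc (0 : Fin n → ℝ) 1 :=
  ⟨fun i => (AddCircle.equivIoc 1 0 (x i)).2.1.le,
    fun i => (AddCircle.equivIoc 1 0 (x i)).2.2.trans (by simp)⟩

/-- The cell average becomes an integral against normalised Haar measure. Representatives lie in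
`(0, 1]ⁿ` while the cell is half-open on the other side; the difference is a null set. -/
theorem mean_eq_torus (hL : 0 < L) (f : (Fin n → ℝ) → ℝ) :
    mean L f = ∫ x : UnitAddTorus (Fin n), f (L • rep x) := by
  have h1 := UnitAddTorus.integral_preimage (fun x : UnitAddTorus (Fin n) => f (L • rep x)) 0
  have h2 : MeasurableSet {x : Fin n → ℝ | ∀ i, x i ∈ Ioc ((0 : Fin n → ℝ) i)
      ((0 : Fin n → ℝ) i + 1)} :=
    MeasurableSet.univ_pi' (fun i => measurableSet_Ioc)
  rw [h1, setIntegral_congr_fun (g := fun x => f (L • x)) h2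
    fun y hy => by simp only [rep_coe hy],
    Measure.setIntegral_comp_smul_of_pos _ _ _ hL, mean, Module.finrank_fin_fun, one_div,
    smul_eq_mul]
  congr 1
  have h3 : {x : Fin n → ℝ | ∀ i, x i ∈ Ioc ((0 : Fin n → ℝ) i) ((0 : Fin n → ℝ) i + 1)}
      = univ.pi fun _ => Ioc 0 1 := by
    ext x
    simp [Set.mem_pi]
  have h4 : L • {x : Fin n → ℝ | ∀ i, x i ∈ Ioc ((0 : Fin n → ℝ) i) ((0 : Fin n → ℝ) i + 1)}
      = univ.pi fun _ => Ioc 0 L := by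
    rw [h3, smul_univ_pi]
    congr 1
    funext i
    simp [LinearOrderedField.smul_Ioc hL]
  rw [h4]
  exact setIntegral_congr_set (Measure.univ_pi_Ico_ae_eq_Icc.trans
    Measure.univ_pi_Ioc_ae_eq_Icc.symm)

/-- Averages of periodic functions are translation invariant. -/
theorem mean_translate (hL : 0 < L) {f : (Fin n → ℝ) → ℝ}
    (hf : ∀ j, Function.Periodic f (Pi.single j L)) (c : Fin n → ℝ) :
    mean L (fun y => f (y + c)) = mean L f := by
  have hper : ∀ m : Fin n → ℤ, Function.Periodic f (∑ j, m j • (Pi.single j L : Fin n → ℝ)) :=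
    fun m => Finset.sum_induction _ (fun c => Function.Periodic f c)
      (fun a b ha hb => ha.add_period hb) (fun y => by simp) fun j _ => (hf j).zsmul (m j)
  -- By periodicity the value does not depend on the chosen representative, so a translation of the
  -- torus may be followed on any lift.
  have key : ∀ x : UnitAddTorus (Fin n), ∀ u : Fin n → ℝ, (∀ i, (u i : UnitAddCircle) = x i) →
      f (L • rep x) = f (L • u) := fun x u hu => by
    have h1 : ∀ i, ∃ m : ℤ, rep x i = u i + m := fun i => by
      have h2 : ((rep x i : ℝ) : UnitAddCircle) = (u i : UnitAddCircle) := by rw [coe_rep, hu]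
      obtain ⟨m, hm⟩ := AddSubgroup.mem_zmultiples_iff.1
        ((QuotientAddGroup.eq (s := AddSubgroup.zmultiples (1 : ℝ))).1 h2.symm)
      refine ⟨m, ?_⟩
      rw [zsmul_eq_mul, mul_one] at hm
      linarith
    choose m hm using h1
    rw [← hper m (L • u)]
    congr 1
    funext i
    simp only [Pi.smul_apply, smul_eq_mul, hm, Pi.add_apply, Finset.sum_apply, Pi.single_apply,
      zsmul_eq_mul, Pi.intCast_apply, Pi.mul_apply, mul_ite, mul_zero, Finset.sum_ite_eq,
      Finset.mem_univ, if_true]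
    ring
  rw [mean_eq_torus hL, mean_eq_torus hL]
  let c' : UnitAddTorus (Fin n) := fun i => ((L⁻¹ * c i : ℝ) : UnitAddCircle)
  rw [← integral_add_right_eq_self (fun x : UnitAddTorus (Fin n) => f (L • rep x)) c']
  congr 1
  funext x
  rw [key (x + c') (fun i => rep x i + L⁻¹ * c i) fun i => by
    rw [AddCircle.coe_add, coe_rep]
    rfl]
  congr 1
  funext i
  simp only [Pi.add_apply, Pi.smul_apply, smul_eq_mul]
  field_simp

theorem mFourier_neg_rep (hL : 0 < L) (k : Fin n → ℤ) (x : UnitAddTorus (Fin n)) :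
    UnitAddTorus.mFourier (-k) x = Complex.exp (-(phase L k (L • rep x) : ℂ) * Complex.I) := by
  simp only [UnitAddTorus.mFourier, ContinuousMap.coe_mk, phase]
  have h1 : ∀ i, fourier ((-k) i) (x i)
      = Complex.exp (-((2 * Real.pi * k i / L * (L • rep x) i : ℝ) : ℂ) * Complex.I) := fun i => by
    rw [← coe_rep x i, fourier_coe_apply]
    congr 1
    have : (L : ℂ) ≠ 0 := by exact_mod_cast hL.ne'
    simp only [Pi.neg_apply, Pi.smul_apply, smul_eq_mul]
    push_cast
    field_simp
  rw [Finset.prod_congr rfl fun i _ => h1 i, ← Complex.exp_sum]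
  push_cast
  rw [← Finset.sum_mul, Finset.sum_neg_distrib]

/-- Without periodicity of `f` the lift may jump on the torus; it is still bounded and measurable,
which suffices for Parseval in `L²`. -/
theorem memLp_lift {f : (Fin n → ℝ) → ℝ} (hf : Continuous f) :
    MemLp (fun x : UnitAddTorus (Fin n) => (f (L • rep x) : ℂ)) 2 volume := by
  obtain ⟨C, hC⟩ := (isCompact_Icc (a := (0 : Fin n → ℝ)) (b := 1)).exists_bound_of_continuousOn
    (hf.comp (continuous_const_smul L)).continuousOn
  refine MemLp.of_bound ?_ C (Eventually.of_forall fun x => ?_)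
  · exact (Complex.measurable_ofReal.comp
      (hf.measurable.comp (measurable_rep.const_smul L))).aestronglyMeasurable
  · rw [Complex.norm_real]
    exact hC _ (rep_mem x)

theorem mFourierCoeff_lift (hL : 0 < L) (k : Fin n → ℤ) {f : (Fin n → ℝ) → ℝ} (hf : Continuous f) :
    UnitAddTorus.mFourierCoeff (fun x : UnitAddTorus (Fin n) => (f (L • rep x) : ℂ)) k
      = (cosCoeff L k f : ℂ) - (sinCoeff L k f : ℂ) * Complex.I := by
  have h1 : ∀ g : (Fin n → ℝ) → ℝ, Continuous g →
      Integrable (fun x : UnitAddTorus (Fin n) => (g (L • rep x) : ℂ)) := fun g hg =>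
    (memLp_lift hg).integrable (by norm_num)
  rw [cosCoeff, sinCoeff, mean_eq_torus hL, mean_eq_torus hL, UnitAddTorus.mFourierCoeff,
    ← integral_complex_ofReal, ← integral_complex_ofReal, ← integral_mul_const, ← integral_sub]
  · congr 1
    funext x
    rw [mFourier_neg_rep hL, Complex.exp_mul_I, Complex.cos_neg, Complex.sin_neg, smul_eq_mul]
    push_cast
    ring
  · exact h1 (fun y => Real.cos (phase L k y) * f y) (by fun_prop)
  · exact (h1 (fun y => Real.sin (phase L k y) * f y) (by fun_prop)).mul_const _

/-- Parseval's identity for the horizontal Fourier coefficients. -/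
theorem hasSum_coeff_mul (hL : 0 < L) {f g : (Fin n → ℝ) → ℝ} (hf : Continuous f)
    (hg : Continuous g) :
    HasSum (fun k : Fin n → ℤ => cosCoeff L k f * cosCoeff L k g + sinCoeff L k f * sinCoeff L k g)
      (mean L fun y => f y * g y) := by
  have h1 := UnitAddTorus.hasSum_prod_mFourierCoeff ((memLp_lift (L := L) hf).toLp _)
    ((memLp_lift (L := L) hg).toLp _)
  have e : ∀ {f : (Fin n → ℝ) → ℝ} (hf : Continuous f) (k : Fin n → ℤ),
      UnitAddTorus.mFourierCoeff ((memLp_lift (L := L) hf).toLp _) k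
        = (cosCoeff L k f : ℂ) - (sinCoeff L k f : ℂ) * Complex.I := fun hf k => by
    rw [← mFourierCoeff_lift hL k hf]
    refine integral_congr_ae ?_
    filter_upwards [(memLp_lift (L := L) hf).coeFn_toLp] with x hx
    rw [hx]
  have e2 : ∫ x, (starRingEnd ℂ) (((memLp_lift (L := L) hf).toLp _ : UnitAddTorus (Fin n) → ℂ) x)
      * ((memLp_lift (L := L) hg).toLp _ : UnitAddTorus (Fin n) → ℂ) x
      = ((mean L fun y => f y * g y : ℝ) : ℂ) := by
    rw [mean_eq_torus hL, ← integral_complex_ofReal]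
    refine integral_congr_ae ?_
    filter_upwards [(memLp_lift (L := L) hf).coeFn_toLp, (memLp_lift (L := L) hg).coeFn_toLp]
      with x hx hx'
    rw [hx, hx', Complex.conj_ofReal]
    push_cast
    rfl
  simp_rw [e hf, e hg] at h1
  rw [e2] at h1
  have h2 := Complex.hasSum_re h1
  rw [Complex.ofReal_re] at h2
  refine h2.congr_fun fun k => ?_
  simp

end Torus

/-- The average of a horizontal derivative of a periodic function vanishes. -/
theorem mean_deriv_eq_zero (hL : 0 < L) {f f' : (Fin n → ℝ) → ℝ} (cf : Continuous f)
    (cf' : Continuous f') (hf : ∀ j, Function.Periodic f (Pi.single j L)) {j : Fin n}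
    (h : ∀ y, HasDerivAt (fun s : ℝ => f (y + s • Pi.single j 1)) (f' y) 0) : mean L f' = 0 := by
  -- The average of the translates is constant in `s` by periodicity, and its derivative at `0` is
  -- the average of `f'`.
  have h1 : HasDerivAt (fun s : ℝ => mean L fun y => f (y + s • Pi.single j 1))
      (mean L fun y => f' (y + (0 : ℝ) • Pi.single j 1)) 0 := by
    refine hasDerivAt_mean (F := fun s y => f (y + s • Pi.single j 1))
      (F' := fun s y => f' (y + s • Pi.single j 1)) (fun s => by fun_prop)
      (by fun_prop) (a := -1) (b := 1) (s := 0) (by simp) fun s _ y => ?_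
    have h2 : HasDerivAt (fun x : ℝ => f ((y + s • Pi.single j 1) + x • Pi.single j 1))
        (f' (y + s • Pi.single j 1)) (s - s) := by
      rw [sub_self]
      exact h _
    refine (h2.comp_sub_const s s).congr_of_eventuallyEq (Eventually.of_forall fun x => ?_)
    simp only
    congr 1
    module
  simp only [mean_translate hL hf, zero_smul, add_zero] at h1
  exact h1.unique (hasDerivAt_const 0 _)

end RayleighBenard

end

noncomputable section

namespace RayleighBenard

/-! ### Horizontal Fourier modes of the Stokes system -/

/-- A horizontally periodic function on the layer with continuous first derivatives. -/
structure Slice1 (n : ℕ) (L H : ℝ) where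
  f : (Fin n → ℝ) → ℝ → ℝ
  fz : (Fin n → ℝ) → ℝ → ℝ
  fy : Fin n → (Fin n → ℝ) → ℝ → ℝ
  cf : Continuous (Function.uncurry f)
  cfz : Continuous (Function.uncurry fz)
  cfy : ∀ j, Continuous (Function.uncurry (fy j))
  dz : ∀ y, ∀ z ∈ Ioo 0 H, HasDerivAt (f y) (fz y z) z
  dy : ∀ j y, ∀ z ∈ Ioo 0 H, HasDerivAt (fun s : ℝ => f (y + s • Pi.single j 1) z) (fy j y z) 0
  per : ∀ z ∈ Ioo 0 H, ∀ j, Function.Periodic (fun y => f y z) (Pi.single j L)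

/-- A horizontally periodic function on the layer with continuous first and unmixed second
derivatives. -/
structure Slice2 (n : ℕ) (L H : ℝ) extends Slice1 n L H where
  fzz : (Fin n → ℝ) → ℝ → ℝ
  fyy : Fin n → (Fin n → ℝ) → ℝ → ℝ
  cfzz : Continuous (Function.uncurry fzz)
  cfyy : ∀ j, Continuous (Function.uncurry (fyy j))
  dzz : ∀ y, ∀ z ∈ Ioo 0 H, HasDerivAt (fz y) (fzz y z) z
  dyy : ∀ j y, ∀ z ∈ Ioo 0 H,
    HasDerivAt (fun s : ℝ => fy j (y + s • Pi.single j 1) z) (fyy j y z) 0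
  pery : ∀ z ∈ Ioo 0 H, ∀ i j, Function.Periodic (fun y => fy i y z) (Pi.single j L)

variable {n : ℕ} {L H : ℝ}

/-- A pair of real Fourier modes with wave vector `κ`. -/
structure ModePair (n : ℕ) (L : ℝ) where
  κ : Fin n → ℝ
  φ : (Fin n → ℝ) → ℝ
  ψ : (Fin n → ℝ) → ℝ
  cφ : Continuous φ
  cψ : Continuous ψ
  dφ : ∀ j y, HasDerivAt (fun s : ℝ => φ (y + s • Pi.single j 1)) (-(κ j * ψ y)) 0
  dψ : ∀ j y, HasDerivAt (fun s : ℝ => ψ (y + s • Pi.single j 1)) (κ j * φ y) 0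
  perφ : ∀ j, Function.Periodic φ (Pi.single j L)
  perψ : ∀ j, Function.Periodic ψ (Pi.single j L)

theorem phase_add_single (k : Fin n → ℤ) (y : Fin n → ℝ) (s : ℝ) (j : Fin n) :
    phase L k (y + Pi.single j s) = phase L k y + 2 * Real.pi * k j / L * s := by
  simp only [phase, Pi.add_apply, mul_add, Finset.sum_add_distrib, Pi.single_apply, mul_ite,
    mul_zero, Finset.sum_ite_eq', Finset.mem_univ, if_true]

theorem phase_add_period (hL : 0 < L) (k : Fin n → ℤ) (y : Fin n → ℝ) (j : Fin n) :
    phase L k (y + Pi.single j L) = phase L k y + k j * (2 * Real.pi) := by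
  rw [phase_add_single]
  field_simp

theorem hasDerivAt_phase (k : Fin n → ℤ) (y : Fin n → ℝ) (j : Fin n) :
    HasDerivAt (fun s : ℝ => phase L k (y + s • Pi.single j 1)) (2 * Real.pi * k j / L) 0 := by
  have h : ∀ s : ℝ, phase L k (y + s • Pi.single j 1)
      = phase L k y + 2 * Real.pi * k j / L * s := fun s => by
    rw [← phase_add_single, ← Pi.single_smul, smul_eq_mul, mul_one]
  simp_rw [h]
  simpa using ((hasDerivAt_id (0 : ℝ)).const_mul (2 * Real.pi * k j / L)).const_add (phase L k y)

/-- The pair `cos (κ · y)`, `sin (κ · y)`. -/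
def cosPair (hL : 0 < L) (k : Fin n → ℤ) : ModePair n L where
  κ j := 2 * Real.pi * k j / L
  φ y := Real.cos (phase L k y)
  ψ y := Real.sin (phase L k y)
  cφ := by fun_prop
  cψ := by fun_prop
  dφ j y := by
    have h := (hasDerivAt_phase (L := L) k y j).cos
    simp only [zero_smul, add_zero] at h
    exact h.congr_deriv (by ring)
  dψ j y := by
    have h := (hasDerivAt_phase (L := L) k y j).sin
    simp only [zero_smul, add_zero] at h
    exact h.congr_deriv (by ring)
  perφ j y := by simp only [phase_add_period hL, Real.cos_add_int_mul_two_pi]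
  perψ j y := by simp only [phase_add_period hL, Real.sin_add_int_mul_two_pi]

/-- The pair `sin (κ · y)`, `-cos (κ · y)`. -/
def sinPair (hL : 0 < L) (k : Fin n → ℤ) : ModePair n L where
  κ := (cosPair hL k).κ
  φ := (cosPair hL k).ψ
  ψ y := -(cosPair hL k).φ y
  cφ := (cosPair hL k).cψ
  cψ := (cosPair hL k).cφ.neg
  dφ j y := ((cosPair hL k).dψ j y).congr_deriv (by ring)
  dψ j y := ((cosPair hL k).dφ j y).neg.congr_deriv (by ring)
  perφ := (cosPair hL k).perψ
  perψ j y := by simp only [(cosPair hL k).perφ j y]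

/-- The pairing of a slice with a horizontal mode, as a function of the height. -/
def coeff (L : ℝ) (φ : (Fin n → ℝ) → ℝ) (f : (Fin n → ℝ) → ℝ → ℝ) (z : ℝ) : ℝ :=
  mean L fun y => φ y * f y z

theorem continuous_slice {f : (Fin n → ℝ) → ℝ → ℝ} (hf : Continuous (Function.uncurry f)) (z : ℝ) :
    Continuous fun y => f y z :=
  hf.comp (by fun_prop : Continuous fun y : Fin n → ℝ => (y, z))

theorem continuous_coeff {φ : (Fin n → ℝ) → ℝ} {f : (Fin n → ℝ) → ℝ → ℝ} (hφ : Continuous φ)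
    (hf : Continuous (Function.uncurry f)) : Continuous (coeff L φ f) :=
  continuous_mean (F := fun z y => φ y * f y z)
    ((hφ.comp continuous_snd).mul (hf.comp continuous_swap))

theorem hasDerivAt_coeff {φ : (Fin n → ℝ) → ℝ} {f fz : (Fin n → ℝ) → ℝ → ℝ} (hφ : Continuous φ)
    (hf : Continuous (Function.uncurry f)) (hfz : Continuous (Function.uncurry fz))
    (h : ∀ y, ∀ z ∈ Ioo 0 H, HasDerivAt (f y) (fz y z) z) {z : ℝ} (hz : z ∈ Ioo 0 H) :
    HasDerivAt (coeff L φ f) (coeff L φ fz z) z :=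
  hasDerivAt_mean (F := fun z y => φ y * f y z) (F' := fun z y => φ y * fz y z)
    (fun s => hφ.mul (continuous_slice hf s))
    ((hφ.comp continuous_snd).mul (hfz.comp continuous_swap)) hz
    fun x hx y => (h y x hx).const_mul _

/-- Integration by parts against a horizontal mode. -/
theorem coeff_dy (hL : 0 < L) {φ φ' : (Fin n → ℝ) → ℝ} {f f' : (Fin n → ℝ) → ℝ → ℝ} {z : ℝ}
    (cφ : Continuous φ) (cφ' : Continuous φ') (cf : Continuous fun y => f y z)
    (cf' : Continuous fun y => f' y z) {j : Fin n} {c : ℝ}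
    (dφ : ∀ y, HasDerivAt (fun s : ℝ => φ (y + s • Pi.single j 1)) (c * φ' y) 0)
    (df : ∀ y, HasDerivAt (fun s : ℝ => f (y + s • Pi.single j 1) z) (f' y z) 0)
    (pφ : ∀ j, Function.Periodic φ (Pi.single j L))
    (pf : ∀ j, Function.Periodic (fun y => f y z) (Pi.single j L)) :
    coeff L φ f' z = -(c * coeff L φ' f z) := by
  have h := mean_deriv_eq_zero hL (f := fun y => φ y * f y z)
    (f' := fun y => c * (φ' y * f y z) + φ y * f' y z) (by fun_prop) (by fun_prop)
    (fun j => (pφ j).mul (pf j)) (j := j) fun y => by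
      refine ((dφ y).mul (df y)).congr_deriv ?_
      simp only [zero_smul, add_zero]
      ring
  rw [mean_add (by fun_prop) (by fun_prop), mean_const_mul] at h
  simp only [coeff]
  linarith

namespace ModePair

variable (P : ModePair n L)

/-- A horizontal derivative multiplies by `κ j` and exchanges `φ` and `ψ`. Pairing `w`, `p`, `T`
with `φ` and `v` with `ψ` therefore yields a closed real system for each pair. -/
theorem coeff_φ_fy (hL : 0 < L) (f : Slice1 n L H) (j : Fin n) {z : ℝ} (hz : z ∈ Ioo 0 H) :
    coeff L P.φ (f.fy j) z = P.κ j * coeff L P.ψ f.f z := by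
  rw [coeff_dy hL (c := -P.κ j) P.cφ P.cψ (continuous_slice f.cf z) (continuous_slice (f.cfy j) z)
    (fun y => (P.dφ j y).congr_deriv (by ring)) (fun y => f.dy j y z hz) P.perφ (f.per z hz)]
  ring

theorem coeff_ψ_fy (hL : 0 < L) (f : Slice1 n L H) (j : Fin n) {z : ℝ} (hz : z ∈ Ioo 0 H) :
    coeff L P.ψ (f.fy j) z = -(P.κ j * coeff L P.φ f.f z) :=
  coeff_dy hL P.cψ P.cφ (continuous_slice f.cf z) (continuous_slice (f.cfy j) z)
    (P.dψ j) (fun y => f.dy j y z hz) P.perψ (f.per z hz)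

theorem coeff_φ_fyy (hL : 0 < L) (f : Slice2 n L H) (j : Fin n) {z : ℝ} (hz : z ∈ Ioo 0 H) :
    coeff L P.φ (f.fyy j) z = -(P.κ j ^ 2 * coeff L P.φ f.f z) := by
  rw [coeff_dy hL (c := -P.κ j) P.cφ P.cψ (continuous_slice (f.cfy j) z)
    (continuous_slice (f.cfyy j) z) (fun y => (P.dφ j y).congr_deriv (by ring))
    (fun y => f.dyy j y z hz) P.perφ (f.pery z hz j), coeff_ψ_fy P hL f.toSlice1 j hz]
  ring

theorem coeff_ψ_fyy (hL : 0 < L) (f : Slice2 n L H) (j : Fin n) {z : ℝ} (hz : z ∈ Ioo 0 H) :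
    coeff L P.ψ (f.fyy j) z = -(P.κ j ^ 2 * coeff L P.ψ f.f z) := by
  rw [coeff_dy hL P.cψ P.cφ (continuous_slice (f.cfy j) z) (continuous_slice (f.cfyy j) z)
    (P.dψ j) (fun y => f.dyy j y z hz) P.perψ (f.pery z hz j), coeff_φ_fy P hL f.toSlice1 j hz]
  ring

end ModePair

/-- A solution of the stationary Stokes system in the layer, at a fixed time. -/
structure StokesSlice (n : ℕ) (L H : ℝ) where
  v : Fin n → Slice2 n L H
  w : Slice2 n L H
  p : Slice1 n L H
  T : (Fin n → ℝ) → ℝ → ℝ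
  cT : Continuous (Function.uncurry T)
  divergence : ∀ y, ∀ z ∈ Ioo 0 H, (∑ j, (v j).fy j y z) + w.fz y z = 0
  horizontal : ∀ i y, ∀ z ∈ Ioo 0 H,
    -((∑ j, (v i).fyy j y z) + (v i).fzz y z) + p.fy i y z = 0
  vertical : ∀ y, ∀ z ∈ Ioo 0 H, -((∑ j, w.fyy j y z) + w.fzz y z) + p.fz y z = T y z
  v_bottom : ∀ i y, (v i).f y 0 = 0
  v_top : ∀ i y, (v i).f y H = 0
  w_bottom : ∀ y, w.f y 0 = 0
  w_top : ∀ y, w.f y H = 0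

namespace StokesSlice

variable (S : StokesSlice n L H)

theorem coeff_eq_zero {φ : (Fin n → ℝ) → ℝ} {f : (Fin n → ℝ) → ℝ → ℝ} {z : ℝ}
    (h : ∀ y, f y z = 0) : coeff L φ f z = 0 := by
  simp only [coeff, h, mul_zero]
  simpa using mean_const_mul (n := n) (L := L) 0 (fun _ => 0)

theorem mean_mul_divergence {φ : (Fin n → ℝ) → ℝ} (hφ : Continuous φ) {z : ℝ} (hz : z ∈ Ioo 0 H) :
    (∑ j, coeff L φ ((S.v j).fy j) z) + coeff L φ S.w.fz z = 0 := by
  have hc := fun j => continuous_slice ((S.v j).cfy j) z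
  have hc' := continuous_slice S.w.cfz z
  simp only [coeff]
  rw [← mean_sum (f := fun j y => φ y * (S.v j).fy j y z) _ fun j _ => hφ.mul (hc j),
    ← mean_add (by fun_prop) (by fun_prop)]
  rw [mean_congr (g := fun _ => 0 * 0) fun y => ?_, mean_const_mul, zero_mul]
  rw [← Finset.mul_sum, ← mul_add, S.divergence y z hz]
  ring

theorem mean_mul_horizontal {φ : (Fin n → ℝ) → ℝ} (hφ : Continuous φ) (i : Fin n) {z : ℝ}
    (hz : z ∈ Ioo 0 H) :
    -((∑ j, coeff L φ ((S.v i).fyy j) z) + coeff L φ (S.v i).fzz z) + coeff L φ (S.p.fy i) z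
      = 0 := by
  have hc := fun j => continuous_slice ((S.v i).cfyy j) z
  have hc' := continuous_slice (S.v i).cfzz z
  have hc'' := continuous_slice (S.p.cfy i) z
  simp only [coeff]
  rw [← mean_sum (f := fun j y => φ y * (S.v i).fyy j y z) _ fun j _ => hφ.mul (hc j),
    ← mean_add (by fun_prop) (by fun_prop), ← mean_neg,
    ← mean_add (by fun_prop) (by fun_prop)]
  rw [mean_congr (g := fun _ => 0 * 0) fun y => ?_, mean_const_mul, zero_mul]
  have := S.horizontal i y z hz
  rw [← Finset.mul_sum]
  linear_combination φ y * this

theorem mean_mul_vertical {φ : (Fin n → ℝ) → ℝ} (hφ : Continuous φ) {z : ℝ} (hz : z ∈ Ioo 0 H) :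
    -((∑ j, coeff L φ (S.w.fyy j) z) + coeff L φ S.w.fzz z) + coeff L φ S.p.fz z
      = coeff L φ S.T z := by
  have hc := fun j => continuous_slice (S.w.cfyy j) z
  have hc' := continuous_slice S.w.cfzz z
  have hc'' := continuous_slice S.p.cfz z
  simp only [coeff]
  rw [← mean_sum (f := fun j y => φ y * S.w.fyy j y z) _ fun j _ => hφ.mul (hc j),
    ← mean_add (by fun_prop) (by fun_prop), ← mean_neg,
    ← mean_add (by fun_prop) (by fun_prop)]
  refine mean_congr fun y => ?_
  have := S.vertical y z hz
  rw [← Finset.mul_sum]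
  linear_combination φ y * this

/-- The projection of a Stokes solution onto a pair of Fourier modes. -/
def toMode (hL : 0 < L) (P : ModePair n L) : StokesMode n H where
  κ := P.κ
  b i := coeff L P.ψ (S.v i).f
  b1 i := coeff L P.ψ (S.v i).fz
  b2 i := coeff L P.ψ (S.v i).fzz
  a := coeff L P.φ S.w.f
  a1 := coeff L P.φ S.w.fz
  a2 := coeff L P.φ S.w.fzz
  q := coeff L P.φ S.p.f
  q1 := coeff L P.φ S.p.fz
  τ := coeff L P.φ S.T
  cb i := continuous_coeff P.cψ (S.v i).cf
  cb1 i := continuous_coeff P.cψ (S.v i).cfz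
  cb2 i := continuous_coeff P.cψ (S.v i).cfzz
  ca := continuous_coeff P.cφ S.w.cf
  ca1 := continuous_coeff P.cφ S.w.cfz
  cτ := continuous_coeff P.cφ S.cT
  db i _ hz := hasDerivAt_coeff P.cψ (S.v i).cf (S.v i).cfz (S.v i).dz hz
  db1 i _ hz := hasDerivAt_coeff P.cψ (S.v i).cfz (S.v i).cfzz (S.v i).dzz hz
  da _ hz := hasDerivAt_coeff P.cφ S.w.cf S.w.cfz S.w.dz hz
  da1 _ hz := hasDerivAt_coeff P.cφ S.w.cfz S.w.cfzz S.w.dzz hz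
  dq _ hz := hasDerivAt_coeff P.cφ S.p.cf S.p.cfz S.p.dz hz
  divergence z hz := by
    rw [← S.mean_mul_divergence P.cφ hz]
    simp only [P.coeff_φ_fy hL _ _ hz]
  horizontal i z hz := by
    rw [← S.mean_mul_horizontal P.cψ i hz]
    simp only [P.coeff_ψ_fyy hL _ _ hz, P.coeff_ψ_fy hL _ _ hz, Finset.sum_neg_distrib,
      ← Finset.sum_mul]
    ring
  vertical z hz := by
    rw [← S.mean_mul_vertical P.cφ hz]
    simp only [P.coeff_φ_fyy hL _ _ hz, Finset.sum_neg_distrib, ← Finset.sum_mul]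
    ring
  b_bottom i := coeff_eq_zero fun y => S.v_bottom i y
  b_top i := coeff_eq_zero fun y => S.v_top i y
  a_bottom := coeff_eq_zero fun y => S.w_bottom y
  a_top := coeff_eq_zero fun y => S.w_top y

end StokesSlice

/-! ### Summation over the modes -/

theorem hasSum_coeff_mul_slice (hL : 0 < L) {f g : (Fin n → ℝ) → ℝ → ℝ}
    (hf : Continuous (Function.uncurry f)) (hg : Continuous (Function.uncurry g)) (z : ℝ) :
    HasSum (fun k : Fin n → ℤ => coeff L (cosPair hL k).φ f z * coeff L (cosPair hL k).φ g z
      + coeff L (sinPair hL k).φ f z * coeff L (sinPair hL k).φ g z)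
      (mean L fun y => f y z * g y z) :=
  hasSum_coeff_mul hL (continuous_slice hf z) (continuous_slice hg z)

theorem continuous_mean_mul {f g : (Fin n → ℝ) → ℝ → ℝ}
    (hf : Continuous (Function.uncurry f)) (hg : Continuous (Function.uncurry g)) :
    Continuous fun z => mean L fun y => f y z * g y z :=
  continuous_mean (F := fun z y => f y z * g y z)
    ((hf.comp continuous_swap).mul (hg.comp continuous_swap))

theorem hasSum_of_eq {ι : Type*} {f g : ι → ℝ} {a b : ℝ} (h : HasSum f a) (hfg : ∀ k, g k = f k)
    (hab : b = a) : HasSum g b := by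
  rw [hab, funext hfg]
  exact h

/-- Nonnegativity of the `Q k` makes the sum of the dominating functions `|ω| Q k` equal to the
integrable `|ω| R`, so dominated convergence allows a weight of either sign. -/
theorem hasSum_integral_of_nonneg {ι : Type*} [Countable ι] {Q : ι → ℝ → ℝ} {R ω : ℝ → ℝ} {a b : ℝ}
    (hab : a ≤ b) (hQ : ∀ k, Continuous (Q k)) (hR : Continuous R) (hω : ContinuousOn ω (Icc a b))
    (h0 : ∀ k z, 0 ≤ Q k z) (h : ∀ z ∈ Ioo a b, HasSum (fun k => Q k z) (R z)) :
    HasSum (fun k => ∫ z in a..b, ω z * Q k z) (∫ z in a..b, ω z * R z) := by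
  have hae : ∀ᵐ z ∂(volume : Measure ℝ), z ∈ uIoc a b → z ∈ Ioo a b := by
    filter_upwards [measure_eq_zero_iff_ae_notMem.1 (measure_singleton b)] with z hz hz'
    rw [uIoc_of_le hab] at hz'
    exact ⟨hz'.1, hz'.2.lt_of_ne hz⟩
  have hωi : ∀ {u : ℝ → ℝ}, ContinuousOn u (Icc a b) → IntervalIntegrable u volume a b :=
    fun hu => hu.intervalIntegrable_of_Icc hab
  refine intervalIntegral.hasSum_integral_of_dominated_convergence (fun k z => |ω z| * Q k z)
    (fun k => ?_) (fun k => Eventually.of_forall fun z _ => ?_) ?_ ?_ ?_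
  · exact (hωi (hω.mul (hQ k).continuousOn)).def'.aestronglyMeasurable
  · rw [Real.norm_eq_abs, abs_mul, abs_of_nonneg (h0 k z)]
  · filter_upwards [hae] with z hz hz'
    exact (h z (hz hz')).summable.mul_left _
  · refine (hωi (hω.abs.mul hR.continuousOn)).congr_ae ?_
    rw [EventuallyEq, ae_restrict_iff' measurableSet_uIoc]
    filter_upwards [hae] with z hz hz'
    exact (((h z (hz hz')).mul_left _).tsum_eq).symm
  · filter_upwards [hae] with z hz hz'
    exact (h z (hz hz')).mul_left _

theorem hasSum_integral_coeff_mul (hL : 0 < L) {f g : (Fin n → ℝ) → ℝ → ℝ}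
    (hf : Continuous (Function.uncurry f)) (hg : Continuous (Function.uncurry g)) {ω : ℝ → ℝ}
    {a b : ℝ} (hab : a ≤ b) (hω : ContinuousOn ω (Icc a b)) :
    HasSum (fun k : Fin n → ℤ =>
      (∫ z in a..b, ω z * (coeff L (cosPair hL k).φ f z * coeff L (cosPair hL k).φ g z))
      + ∫ z in a..b, ω z * (coeff L (sinPair hL k).φ f z * coeff L (sinPair hL k).φ g z))
      (∫ z in a..b, ω z * mean L fun y => f y z * g y z) := by
  have cc : ∀ {u : (Fin n → ℝ) → ℝ → ℝ}, Continuous (Function.uncurry u) → ∀ P : ModePair n L,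
      Continuous (coeff L P.φ u) := fun hu P => continuous_coeff P.cφ hu
  have sq : ∀ {u : (Fin n → ℝ) → ℝ → ℝ}, Continuous (Function.uncurry u) →
      HasSum (fun k : Fin n → ℤ => ∫ z in a..b, ω z *
        (coeff L (cosPair hL k).φ u z ^ 2 + coeff L (sinPair hL k).φ u z ^ 2))
        (∫ z in a..b, ω z * mean L fun y => u y z * u y z) := fun {u} hu => by
    refine hasSum_integral_of_nonneg hab (fun k => ?_) (continuous_mean_mul hu hu) hω
      (fun k z => by positivity) fun z _ => ?_
    · have h1 := cc hu (cosPair hL k)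
      have h2 := cc hu (sinPair hL k)
      fun_prop
    · simp_rw [pow_two]
      exact hasSum_coeff_mul_slice hL hu hu z
  have hfg : Continuous (Function.uncurry fun y z => f y z + g y z) := hf.add hg
  -- polarization
  have h1 := (((sq hfg).sub (sq hf)).sub (sq hg)).mul_left (1 / 2)
  have ii : ∀ {u : ℝ → ℝ}, Continuous u → IntervalIntegrable (fun z => ω z * u z) volume a b :=
    fun hu => (hω.mul hu.continuousOn).intervalIntegrable_of_Icc hab
  refine hasSum_of_eq h1 (fun k => ?_) ?_
  · have ccf := cc hf (cosPair hL k)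
    have ccg := cc hg (cosPair hL k)
    have csf := cc hf (sinPair hL k)
    have csg := cc hg (sinPair hL k)
    have e : ∀ P : ModePair n L, ∀ z, coeff L P.φ (fun y z => f y z + g y z) z
        = coeff L P.φ f z + coeff L P.φ g z := fun P z => by
      have h2 := continuous_slice hf z
      have h3 := continuous_slice hg z
      have h4 := P.cφ
      simp only [coeff, mul_add]
      rw [mean_add (by fun_prop) (by fun_prop)]
    simp only [e]
    rw [← intervalIntegral.integral_add (ii (by fun_prop)) (ii (by fun_prop)),
      ← intervalIntegral.integral_sub (ii (by fun_prop)) (ii (by fun_prop)),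
      ← intervalIntegral.integral_sub ((ii (by fun_prop)).sub (ii (by fun_prop))) (ii (by fun_prop)),
      ← intervalIntegral.integral_const_mul]
    congr 1
    funext z
    ring
  · rw [← intervalIntegral.integral_sub (ii (continuous_mean_mul hfg hfg))
        (ii (continuous_mean_mul hf hf)),
      ← intervalIntegral.integral_sub ((ii (continuous_mean_mul hfg hfg)).sub
        (ii (continuous_mean_mul hf hf))) (ii (continuous_mean_mul hg hg)),
      ← intervalIntegral.integral_const_mul]
    congr 1
    funext z
    have h2 := continuous_slice hf z
    have h3 := continuous_slice hg z
    have e : mean L (fun y => (f y z + g y z) * (f y z + g y z))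
        = mean L (fun y => f y z * f y z) + 2 * mean L (fun y => f y z * g y z)
          + mean L fun y => g y z * g y z := by
      rw [← mean_const_mul, ← mean_add (by fun_prop) (by fun_prop),
        ← mean_add (by fun_prop) (by fun_prop)]
      exact mean_congr fun y => by ring
    simp only [e]
    ring

namespace StokesSlice

variable (S : StokesSlice n L H)

theorem sum_mode_sq (κ B B' : Fin n → ℝ) (A A' d d' : ℝ) :
    ((∑ j, κ j ^ 2) * A ^ 2 + d ^ 2 + (∑ j, κ j ^ 2) * ∑ i, B i ^ 2)
      + ((∑ j, κ j ^ 2) * A' ^ 2 + d' ^ 2 + (∑ j, κ j ^ 2) * ∑ i, B' i ^ 2)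
    = (∑ i, ∑ j, (κ j * B i * (κ j * B i) + κ j * B' i * (κ j * B' i)))
      + ((∑ j, (κ j * A' * (κ j * A') + κ j * (-A) * (κ j * (-A)))) + (d * d + d' * d')) := by
  have h1 : ∑ i, ∑ j, (κ j * B i * (κ j * B i) + κ j * B' i * (κ j * B' i))
      = (∑ j, κ j ^ 2) * ∑ i, B i ^ 2 + (∑ j, κ j ^ 2) * ∑ i, B' i ^ 2 := by
    rw [← mul_add, ← Finset.sum_add_distrib, Finset.mul_sum]
    refine Finset.sum_congr rfl fun i _ => ?_
    rw [Finset.sum_mul]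
    exact Finset.sum_congr rfl fun j _ => by ring
  have h2 : ∑ j, (κ j * A' * (κ j * A') + κ j * (-A) * (κ j * (-A)))
      = (∑ j, κ j ^ 2) * A ^ 2 + (∑ j, κ j ^ 2) * A' ^ 2 := by
    rw [← mul_add, Finset.sum_mul]
    exact Finset.sum_congr rfl fun j _ => by ring
  rw [h1, h2]
  ring

/-- Parseval for each component of the gradient. Horizontal derivatives swap the cosine and sine
coefficients, so the identity holds for the sum over both pairs of a wave vector, not for each pair
separately. -/
theorem hasSum_gradient (hL : 0 < L) {z : ℝ} (hz : z ∈ Ioo 0 H) :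
    HasSum (fun k : Fin n → ℤ =>
      ((S.toMode hL (cosPair hL k)).K * (S.toMode hL (cosPair hL k)).a z ^ 2
        + (S.toMode hL (cosPair hL k)).a1 z ^ 2
        + (S.toMode hL (cosPair hL k)).K * ∑ i, (S.toMode hL (cosPair hL k)).b i z ^ 2)
      + ((S.toMode hL (sinPair hL k)).K * (S.toMode hL (sinPair hL k)).a z ^ 2
        + (S.toMode hL (sinPair hL k)).a1 z ^ 2
        + (S.toMode hL (sinPair hL k)).K * ∑ i, (S.toMode hL (sinPair hL k)).b i z ^ 2))
      (mean L fun y => (∑ i, ∑ j, (S.v i).fy j y z ^ 2)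
        + ((∑ j, S.w.fy j y z ^ 2) + S.w.fz y z ^ 2)) := by
  have h1 := fun i j => hasSum_coeff_mul_slice hL ((S.v i).cfy j) ((S.v i).cfy j) z
  have h2 := fun j => hasSum_coeff_mul_slice hL (S.w.cfy j) (S.w.cfy j) z
  have h3 := hasSum_coeff_mul_slice hL S.w.cfz S.w.cfz z
  have h4 := (hasSum_sum (s := Finset.univ) fun i _ => hasSum_sum (s := Finset.univ)
    fun j _ => h1 i j).add ((hasSum_sum (s := Finset.univ) fun j _ => h2 j).add h3)
  have c1 := fun i j => continuous_slice ((S.v i).cfy j) z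
  have c2 := fun j => continuous_slice (S.w.cfy j) z
  have c3 := continuous_slice S.w.cfz z
  refine hasSum_of_eq h4 (fun k => ?_) ?_
  · have hψ : coeff L (sinPair hL k).ψ S.w.f z = -coeff L (cosPair hL k).φ S.w.f z := by
      rw [coeff, coeff, ← mean_neg]
      exact mean_congr fun y => by simp only [sinPair]; ring
    simp only [ModePair.coeff_φ_fy _ hL _ _ hz, hψ]
    exact sum_mode_sq _ _ _ _ _ _ _
  · rw [mean_add (by fun_prop) (by fun_prop), mean_add (by fun_prop) (by fun_prop),
      mean_sum _ (fun i _ => by fun_prop), mean_sum _ (fun i _ => by fun_prop)]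
    simp only [pow_two]
    congr 1
    exact Finset.sum_congr rfl fun i _ => mean_sum _ (fun j _ => (c1 i j).mul (c1 i j))

theorem continuous_mode_gradient (M : StokesMode n H) :
    Continuous fun z => M.K * M.a z ^ 2 + M.a1 z ^ 2 + M.K * ∑ i, M.b i z ^ 2 := by
  have h1 := M.cb
  have h2 := M.ca
  have h3 := M.ca1
  fun_prop

theorem mode_gradient_nonneg (M : StokesMode n H) (z : ℝ) :
    0 ≤ M.K * M.a z ^ 2 + M.a1 z ^ 2 + M.K * ∑ i, M.b i z ^ 2 := by
  have h1 := M.K_nonneg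
  have h2 : 0 ≤ ∑ i, M.b i z ^ 2 := Finset.sum_nonneg fun i _ => sq_nonneg _
  positivity

theorem continuous_gradient : Continuous fun z => mean L fun y =>
    (∑ i, ∑ j, (S.v i).fy j y z ^ 2) + ((∑ j, S.w.fy j y z ^ 2) + S.w.fz y z ^ 2) := by
  refine continuous_mean (F := fun z y => (∑ i, ∑ j, (S.v i).fy j y z ^ 2)
    + ((∑ j, S.w.fy j y z ^ 2) + S.w.fz y z ^ 2)) ?_
  have h1 := fun i j => ((S.v i).cfy j).comp continuous_swap
  have h2 := fun j => (S.w.cfy j).comp continuous_swap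
  have h3 := S.w.cfz.comp continuous_swap
  exact (continuous_finsetSum _ fun i _ => continuous_finsetSum _ fun j _ => (h1 i j).pow 2).add
    ((continuous_finsetSum _ fun j _ => (h2 j).pow 2).add (h3.pow 2))

theorem continuousOn_weight {ε : ℝ} (hε : 0 < ε) :
    ContinuousOn (fun z : ℝ => (z + ε)⁻¹) (Icc 0 H) :=
  ContinuousOn.inv₀ (by fun_prop) fun z hz => by linarith [hz.1]

/-- The weighted energy estimate for the Stokes system. -/
theorem weighted_energy (hL : 0 < L) (hH : 0 < H) {ε : ℝ} (hε : 0 < ε) :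
    ∫ z in (0 : ℝ)..H, (z + ε)⁻¹ * (mean L fun y => (∑ i, ∑ j, (S.v i).fy j y z ^ 2)
        + ((∑ j, S.w.fy j y z ^ 2) + S.w.fz y z ^ 2))
      ≤ 2 * ∫ z in (0 : ℝ)..H, (z + ε)⁻¹ * mean L fun y => S.w.f y z * S.T y z := by
  have cw := continuousOn_weight (H := H) hε
  -- Both sides are sums over the modes, and the inequality holds mode by mode.
  refine hasSum_le (fun k => ?_) (hasSum_integral_of_nonneg hH.le
    (fun k => (continuous_mode_gradient _).add (continuous_mode_gradient _)) S.continuous_gradient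
    cw (fun k z => add_nonneg (mode_gradient_nonneg _ z) (mode_gradient_nonneg _ z))
    fun z hz => S.hasSum_gradient hL hz)
    ((hasSum_integral_coeff_mul hL S.w.cf S.cT hH.le cw).mul_left 2)
  have ii : ∀ {u : ℝ → ℝ}, Continuous u →
      IntervalIntegrable (fun z : ℝ => (z + ε)⁻¹ * u z) volume 0 H :=
    fun hu => (cw.mul hu.continuousOn).intervalIntegrable_of_Icc hH.le
  have h1 := (S.toMode hL (cosPair hL k)).weighted_energy hH hε
  have h2 := (S.toMode hL (sinPair hL k)).weighted_energy hH hε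
  have h3 := intervalIntegral.integral_add
    (ii (continuous_mode_gradient (S.toMode hL (cosPair hL k))))
    (ii (continuous_mode_gradient (S.toMode hL (sinPair hL k))))
  simp only [← mul_add] at h3
  rw [mul_add]
  exact h3.le.trans (add_le_add h1 h2)

/-- The energy estimate for the vertical velocity in the Stokes system. -/
theorem energy (hL : 0 < L) (hH : 0 < H) :
    ∫ z in (0 : ℝ)..H, mean L (fun y => S.w.fz y z ^ 2)
      ≤ ∫ z in (0 : ℝ)..H, mean L fun y => S.w.f y z * S.T y z := by
  have h1 := hasSum_integral_coeff_mul hL S.w.cfz S.w.cfz hH.le (continuousOn_const (c := (1 : ℝ)))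
  have h2 := hasSum_integral_coeff_mul hL S.w.cf S.cT hH.le (continuousOn_const (c := (1 : ℝ)))
  simp only [one_mul] at h1 h2
  simp only [pow_two]
  refine hasSum_le (fun k => ?_) h1 h2
  have h3 := (S.toMode hL (cosPair hL k)).energy hH
  have h4 := (S.toMode hL (sinPair hL k)).energy hH
  simp only [pow_two] at h3 h4
  exact add_le_add h3 h4

/-- The pointwise estimate for the vertical derivative of the horizontal velocity. -/
theorem pointwise (hL : 0 < L) (hH : 0 < H) {x : ℝ} (hx : 0 < x) (hxH : 2 * x ≤ H) :
    mean L (fun y => ∑ i, (S.v i).fz y x ^ 2)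
      ≤ 3000 * (∫ z in (0 : ℝ)..H, (z + x)⁻¹ * mean L fun y => S.w.f y z * S.T y z)
        + x * ∫ z in (0 : ℝ)..(2 * x), mean L fun y => S.T y z ^ 2 := by
  have h1 := hasSum_sum (s := Finset.univ) fun i _ =>
    hasSum_coeff_mul_slice hL (S.v i).cfz (S.v i).cfz x
  have h2 := (hasSum_integral_coeff_mul hL S.w.cf S.cT hH.le
    (continuousOn_weight (H := H) hx)).mul_left 3000
  have h3 := (hasSum_integral_coeff_mul hL S.cT S.cT (by linarith : (0 : ℝ) ≤ 2 * x)
    (continuousOn_const (c := (1 : ℝ)))).mul_left x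
  have h4 := h2.add h3
  simp only [one_mul, ← pow_two] at h1 h4
  rw [mean_sum (f := fun i y => (S.v i).fz y x ^ 2) _
    fun i _ => (continuous_slice (S.v i).cfz x).pow 2]
  refine hasSum_le (fun k => ?_) h1 h4
  have h5 := (S.toMode hL (cosPair hL k)).pointwise hH hx hxH
  have h6 := (S.toMode hL (sinPair hL k)).pointwise hH hx hxH
  -- The second function of the sine pair is minus the cosine; the sign disappears in the square, so
  -- the two pairs together give the full Parseval term.
  have h7 : ∀ i, coeff L (sinPair hL k).ψ (S.v i).fz x = -coeff L (cosPair hL k).φ (S.v i).fz x :=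
    fun i => by
      rw [coeff, coeff, ← mean_neg]
      exact mean_congr fun y => by simp only [sinPair]; ring
  simp only [toMode, h7, neg_sq] at h5 h6
  rw [Finset.sum_add_distrib]
  have h8 : ∑ i, coeff L (sinPair hL k).φ (S.v i).fz x ^ 2
      = ∑ i, coeff L (cosPair hL k).ψ (S.v i).fz x ^ 2 := rfl
  rw [h8]
  linarith

/-- The vertical velocity has zero horizontal average. -/
theorem mean_w_eq_zero (hL : 0 < L) {z : ℝ} (hz : z ∈ Icc 0 H) :
    mean L (fun y => S.w.f y z) = 0 := by
  have h1 : ∀ z ∈ Ioo 0 H, HasDerivAt (fun z => mean L fun y => S.w.f y z) 0 z := fun z hz => by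
    have h2 := hasDerivAt_mean (L := L) (F := fun z y => S.w.f y z) (F' := fun z y => S.w.fz y z)
      (fun s => continuous_slice S.w.cf s) (S.w.cfz.comp continuous_swap) hz
      fun x hx y => S.w.dz y x hx
    refine h2.congr_deriv ?_
    have h3 := S.mean_mul_divergence (L := L) (φ := fun _ => 1) continuous_const hz
    have h4 : ∀ j, coeff L (fun _ => 1) ((S.v j).fy j) z = 0 := fun j => by
      simp only [coeff, one_mul]
      exact mean_deriv_eq_zero hL (continuous_slice (S.v j).cf z) (continuous_slice ((S.v j).cfy j) z)
        ((S.v j).per z hz) fun y => (S.v j).dy j y z hz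
    rw [Finset.sum_eq_zero fun j _ => h4 j, zero_add] at h3
    simpa only [coeff, one_mul] using h3
  have h5 : Continuous fun z => mean L fun y => S.w.f y z :=
    continuous_mean (F := fun z y => S.w.f y z) (S.w.cf.comp continuous_swap)
  have h6 := sq_le_mul_integral_sq (f' := fun _ => 0) hz h5.continuousOn continuousOn_const h1 (by
    simp only [S.w_bottom]
    exact mean_const hL 0)
  simp only [ne_eq, OfNat.ofNat_ne_zero, not_false_eq_true, zero_pow,
    intervalIntegral.integral_zero, mul_zero] at h6
  exact pow_eq_zero_iff two_ne_zero |>.1 (le_antisymm h6 (sq_nonneg _))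

end StokesSlice

end RayleighBenard

end

noncomputable section

namespace RayleighBenard

/-! ### Derivatives on the closed space-time layer -/

variable {n : ℕ} {L H : ℝ}

/-- The closed space-time layer. -/
def slab (n : ℕ) (H : ℝ) : Set (ℝ × Space n) := Ici 0 ×ˢ layer n H

/-- The projection onto the closed space-time layer. -/
def clamp (H : ℝ) (q : ℝ × Space n) : ℝ × Space n :=
  (max q.1 0, (q.2.1, max 0 (min q.2.2 H)))

theorem continuous_clamp : Continuous (clamp (n := n) H) := by
  unfold clamp
  fun_prop

theorem mem_slab {q : ℝ × Space n} : q ∈ slab n H ↔ 0 ≤ q.1 ∧ 0 ≤ q.2.2 ∧ q.2.2 ≤ H := by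
  simp [slab, layer, mem_prod]

theorem clamp_mem (hH : 0 < H) (q : ℝ × Space n) : clamp H q ∈ slab n H :=
  mem_slab.2 ⟨le_max_right _ _, le_max_left _ _, max_le hH.le (min_le_right _ _)⟩

theorem clamp_eq {q : ℝ × Space n} (hq : q ∈ slab n H) : clamp H q = q := by
  obtain ⟨h1, h2, h3⟩ := mem_slab.1 hq
  simp [clamp, h1, h2, h3]

theorem uniqueDiffOn_slab (hH : 0 < H) : UniqueDiffOn ℝ (slab n H) :=
  (uniqueDiffOn_Ici 0).prod (uniqueDiffOn_univ.prod (uniqueDiffOn_Icc hH))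

/-- The directional derivative in the closed layer, extended continuously to the whole space. -/
def pd (H : ℝ) (e : ℝ × Space n) (F : ℝ × Space n → ℝ) (q : ℝ × Space n) : ℝ :=
  fderivWithin ℝ F (slab n H) (clamp H q) e

theorem continuous_pd (hH : 0 < H) {F : ℝ × Space n → ℝ} (hF : ContDiffOn ℝ 1 F (slab n H))
    (e : ℝ × Space n) : Continuous (pd H e F) := by
  have h1 := (hF.continuousOn_fderivWithin (uniqueDiffOn_slab hH) le_rfl).clm_apply
    (continuousOn_const (c := e))
  exact h1.comp_continuous continuous_clamp (clamp_mem hH)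

theorem contDiffOn_pd (hH : 0 < H) {F : ℝ × Space n → ℝ} (hF : ContDiffOn ℝ 2 F (slab n H))
    (e : ℝ × Space n) : ContDiffOn ℝ 1 (pd H e F) (slab n H) := by
  have h1 := (hF.fderivWithin (uniqueDiffOn_slab hH) (m := 1) (by norm_num)).clm_apply
    (contDiffOn_const (c := e))
  exact h1.congr fun q hq => by rw [pd, clamp_eq hq]

/-- A derivative within the slab is an ordinary derivative along a curve that stays in the slab.
Horizontal lines do so at every height, including the walls; vertical lines only at interior
heights. -/
theorem hasDerivAt_comp_curve {F : ℝ × Space n → ℝ} (hF : DifferentiableOn ℝ F (slab n H))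
    {γ : ℝ → ℝ × Space n} {e : ℝ × Space n} {s : ℝ} (hγ : HasDerivAt γ e s)
    (hmem : ∀ᶠ x in 𝓝 s, γ x ∈ slab n H) : HasDerivAt (fun x => F (γ x)) (pd H e F (γ s)) s := by
  have h1 := (hF (γ s) hmem.self_of_nhds).hasFDerivWithinAt
  have h2 := h1.comp_hasDerivWithinAt (t := slab n H) (s := γ ⁻¹' slab n H) s
    hγ.hasDerivWithinAt (mapsTo_preimage _ _)
  rw [pd, clamp_eq hmem.self_of_nhds]
  exact h2.hasDerivAt hmem

/-- The time direction. -/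
def eT (n : ℕ) : ℝ × Space n := (1, 0)

/-- The vertical direction. -/
def eZ (n : ℕ) : ℝ × Space n := (0, (0, 1))

/-- The horizontal directions. -/
def eY (j : Fin n) : ℝ × Space n := (0, (Pi.single j 1, 0))

theorem hasDerivAt_pd_z {F : ℝ × Space n → ℝ} (hF : DifferentiableOn ℝ F (slab n H)) {t z : ℝ}
    (ht : 0 ≤ t) (y : Fin n → ℝ) (hz : z ∈ Ioo 0 H) :
    HasDerivAt (fun z => F (t, (y, z))) (pd H (eZ n) F (t, (y, z))) z := by
  refine hasDerivAt_comp_curve hF (γ := fun z => (t, (y, z)))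
    ((hasDerivAt_const z t).prodMk ((hasDerivAt_const z y).prodMk (hasDerivAt_id z))) ?_
  filter_upwards [Ioo_mem_nhds hz.1 hz.2] with x hx
  exact mem_slab.2 ⟨ht, hx.1.le, hx.2.le⟩

theorem hasDerivAt_pd_y {F : ℝ × Space n → ℝ} (hF : DifferentiableOn ℝ F (slab n H)) {t z : ℝ}
    (ht : 0 ≤ t) (j : Fin n) (y : Fin n → ℝ) (hz : z ∈ Icc 0 H) :
    HasDerivAt (fun s : ℝ => F (t, (y + s • Pi.single j 1, z))) (pd H (eY j) F (t, (y, z))) 0 := by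
  have h1 : HasDerivAt (fun s : ℝ => y + s • (Pi.single j 1 : Fin n → ℝ)) (Pi.single j 1) 0 := by
    simpa using ((hasDerivAt_id (0 : ℝ)).smul_const (Pi.single j 1 : Fin n → ℝ)).const_add y
  have h2 := hasDerivAt_comp_curve hF (γ := fun s => (t, (y + s • Pi.single j 1, z))) (s := 0)
    ((hasDerivAt_const (0 : ℝ) t).prodMk (h1.prodMk (hasDerivAt_const (0 : ℝ) z)))
    (Eventually.of_forall fun x => mem_slab.2 ⟨ht, hz.1, hz.2⟩)
  simp only [zero_smul, add_zero] at h2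
  exact h2

theorem hasDerivAt_pd_t {F : ℝ × Space n → ℝ} (hF : DifferentiableOn ℝ F (slab n H)) {t z : ℝ}
    (ht : 0 < t) (y : Fin n → ℝ) (hz : z ∈ Icc 0 H) :
    HasDerivAt (fun t => F (t, (y, z))) (pd H (eT n) F (t, (y, z))) t := by
  refine hasDerivAt_comp_curve hF (γ := fun t => (t, (y, z)))
    ((hasDerivAt_id t).prodMk (hasDerivAt_const t (y, z))) ?_
  filter_upwards [Ioi_mem_nhds ht] with x hx
  exact mem_slab.2 ⟨(mem_Ioi.1 hx).le, hz.1, hz.2⟩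

theorem hasFDerivAt_slice {F : ℝ × Space n → ℝ} (hF : DifferentiableOn ℝ F (slab n H)) {t z : ℝ}
    (ht : 0 ≤ t) (y : Fin n → ℝ) (hz : z ∈ Ioo 0 H) :
    HasFDerivAt (fun x => F (t, x))
      ((fderivWithin ℝ F (slab n H) (t, (y, z))).comp (ContinuousLinearMap.inr ℝ ℝ (Space n)))
      (y, z) := by
  have h1 := (hF (t, (y, z)) (mem_slab.2 ⟨ht, hz.1.le, hz.2.le⟩)).hasFDerivWithinAt
  have h2 := h1.comp (y, z) (s := layer n H) (hasFDerivAt_prodMk_right t (y, z)).hasFDerivWithinAt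
    fun x hx => ⟨ht, hx⟩
  refine h2.hasFDerivAt ?_
  exact prod_mem_nhds univ_mem (Icc_mem_nhds hz.1 hz.2)

theorem dZ_slice {F : ℝ × Space n → ℝ} (hF : DifferentiableOn ℝ F (slab n H)) {t z : ℝ}
    (ht : 0 ≤ t) (y : Fin n → ℝ) (hz : z ∈ Ioo 0 H) :
    dZ (fun x => F (t, x)) (y, z) = pd H (eZ n) F (t, (y, z)) := by
  rw [dZ, (hasFDerivAt_slice hF ht y hz).fderiv, pd,
    clamp_eq (mem_slab.2 ⟨ht, hz.1.le, hz.2.le⟩)]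
  rfl

theorem dY_slice {F : ℝ × Space n → ℝ} (hF : DifferentiableOn ℝ F (slab n H)) {t z : ℝ}
    (ht : 0 ≤ t) (j : Fin n) (y : Fin n → ℝ) (hz : z ∈ Ioo 0 H) :
    dY j (fun x => F (t, x)) (y, z) = pd H (eY j) F (t, (y, z)) := by
  rw [dY, (hasFDerivAt_slice hF ht y hz).fderiv, pd,
    clamp_eq (mem_slab.2 ⟨ht, hz.1.le, hz.2.le⟩)]
  rfl

theorem eventually_mem_layer {y : Fin n → ℝ} {z : ℝ} (hz : z ∈ Ioo 0 H) :
    ∀ᶠ x : Space n in 𝓝 (y, z), x.2 ∈ Ioo 0 H :=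
  continuous_snd.continuousAt.eventually (isOpen_Ioo.mem_nhds hz)

theorem dZ_congr {f g : Space n → ℝ} {x : Space n} (h : f =ᶠ[𝓝 x] g) : dZ f x = dZ g x := by
  rw [dZ, dZ, h.fderiv_eq]

theorem dY_congr {f g : Space n → ℝ} {x : Space n} {j : Fin n} (h : f =ᶠ[𝓝 x] g) :
    dY j f x = dY j g x := by
  rw [dY, dY, h.fderiv_eq]

theorem lap_slice (hH : 0 < H) {F : ℝ × Space n → ℝ} (hF : ContDiffOn ℝ 2 F (slab n H)) {t z : ℝ}
    (ht : 0 ≤ t) (y : Fin n → ℝ) (hz : z ∈ Ioo 0 H) :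
    lap (fun x => F (t, x)) (y, z) = (∑ j, pd H (eY j) (pd H (eY j) F) (t, (y, z)))
      + pd H (eZ n) (pd H (eZ n) F) (t, (y, z)) := by
  have hd := hF.differentiableOn two_ne_zero
  have hd' := fun e => (contDiffOn_pd hH hF e).differentiableOn one_ne_zero
  rw [lap]
  congr 1
  · refine Finset.sum_congr rfl fun j _ => ?_
    rw [← dY_slice (hd' _) ht j y hz]
    -- The outer derivative needs the formula for the inner one on a whole neighbourhood, not only
    -- at the point.
    refine dY_congr ?_
    filter_upwards [eventually_mem_layer hz] with x hx
    exact dY_slice hd ht j x.1 hx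
  · rw [← dZ_slice (hd' _) ht y hz]
    refine dZ_congr ?_
    filter_upwards [eventually_mem_layer hz] with x hx
    exact dZ_slice hd ht x.1 hx

/-- Horizontal periodicity of a function on the space-time layer. -/
def SlabPeriodic (L H : ℝ) (F : ℝ × Space n → ℝ) : Prop :=
  ∀ t z, 0 ≤ t → z ∈ Icc 0 H → ∀ j, Function.Periodic (fun y => F (t, (y, z))) (Pi.single j L)

theorem SlabPeriodic.pd_y {F : ℝ × Space n → ℝ} (hp : SlabPeriodic L H F)
    (hF : DifferentiableOn ℝ F (slab n H)) (i : Fin n) : SlabPeriodic L H (pd H (eY i) F) := by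
  intro t z ht hz j y
  refine (hasDerivAt_pd_y hF ht i _ hz).unique
    ((hasDerivAt_pd_y hF ht i y hz).congr_of_eventuallyEq (Eventually.of_forall fun s => ?_))
  have := hp t z ht hz j (y + s • Pi.single i 1)
  simp only at this ⊢
  rw [← this]
  congr 3
  abel

/-- The time slice of a function that is `C¹` on the closed layer. -/
def toSlice1 (hH : 0 < H) {F : ℝ × Space n → ℝ} (cF : Continuous F)
    (hF : ContDiffOn ℝ 1 F (slab n H)) (hp : SlabPeriodic L H F) {t : ℝ} (ht : 0 ≤ t) :
    Slice1 n L H where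
  f y z := F (t, (y, z))
  fz y z := pd H (eZ n) F (t, (y, z))
  fy j y z := pd H (eY j) F (t, (y, z))
  cf := cF.comp (by fun_prop : Continuous fun x : (Fin n → ℝ) × ℝ => (t, x))
  cfz := (continuous_pd hH hF _).comp (by fun_prop : Continuous fun x : (Fin n → ℝ) × ℝ => (t, x))
  cfy j := (continuous_pd hH hF _).comp (by fun_prop : Continuous fun x : (Fin n → ℝ) × ℝ => (t, x))
  dz y _ hz := hasDerivAt_pd_z (hF.differentiableOn one_ne_zero) ht y hz
  dy j y _ hz := hasDerivAt_pd_y (hF.differentiableOn one_ne_zero) ht j y (Ioo_subset_Icc_self hz)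
  per z hz j := hp t z ht (Ioo_subset_Icc_self hz) j

/-- The time slice of a function that is `C²` on the closed layer. -/
def toSlice2 (hH : 0 < H) {F : ℝ × Space n → ℝ} (cF : Continuous F)
    (hF : ContDiffOn ℝ 2 F (slab n H)) (hp : SlabPeriodic L H F) {t : ℝ} (ht : 0 ≤ t) :
    Slice2 n L H where
  toSlice1 := toSlice1 hH cF (hF.of_le one_le_two) hp ht
  fzz y z := pd H (eZ n) (pd H (eZ n) F) (t, (y, z))
  fyy j y z := pd H (eY j) (pd H (eY j) F) (t, (y, z))
  cfzz := (continuous_pd hH (contDiffOn_pd hH hF _) _).comp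
    (by fun_prop : Continuous fun x : (Fin n → ℝ) × ℝ => (t, x))
  cfyy j := (continuous_pd hH (contDiffOn_pd hH hF _) _).comp
    (by fun_prop : Continuous fun x : (Fin n → ℝ) × ℝ => (t, x))
  dzz y _ hz := hasDerivAt_pd_z ((contDiffOn_pd hH hF _).differentiableOn one_ne_zero) ht y hz
  dyy j y _ hz := hasDerivAt_pd_y ((contDiffOn_pd hH hF _).differentiableOn one_ne_zero) ht j y
    (Ioo_subset_Icc_self hz)
  pery z hz i j := hp.pd_y (hF.differentiableOn two_ne_zero) i t z ht (Ioo_subset_Icc_self hz) j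

/-- A solution of the infinite-Prandtl-number system, extended continuously to the whole space. -/
structure Flow (n : ℕ) (L H : ℝ) where
  hH : 0 < H
  hL : 0 < L
  T : ℝ × Space n → ℝ
  v : Fin n → ℝ × Space n → ℝ
  w : ℝ × Space n → ℝ
  cT : Continuous T
  cv : ∀ i, Continuous (v i)
  cw : Continuous w
  sT : ContDiffOn ℝ 2 T (slab n H)
  sv : ∀ i, ContDiffOn ℝ 2 (v i) (slab n H)
  sw : ContDiffOn ℝ 2 w (slab n H)
  pT : SlabPeriodic L H T
  pv : ∀ i, SlabPeriodic L H (v i)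
  pw : SlabPeriodic L H w
  p : ∀ t : ℝ, 0 < t → Slice1 n L H
  heat : ∀ t, 0 < t → ∀ y, ∀ z ∈ Ioo 0 H, pd H (eT n) T (t, (y, z))
    + ((∑ j, v j (t, (y, z)) * pd H (eY j) T (t, (y, z)))
      + w (t, (y, z)) * pd H (eZ n) T (t, (y, z)))
    - ((∑ j, pd H (eY j) (pd H (eY j) T) (t, (y, z))) + pd H (eZ n) (pd H (eZ n) T) (t, (y, z))) = 0
  divergence : ∀ t, 0 < t → ∀ y, ∀ z ∈ Ioo 0 H,
    (∑ j, pd H (eY j) (v j) (t, (y, z))) + pd H (eZ n) w (t, (y, z)) = 0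
  horizontal : ∀ t, ∀ ht : 0 < t, ∀ i y, ∀ z ∈ Ioo 0 H,
    -((∑ j, pd H (eY j) (pd H (eY j) (v i)) (t, (y, z)))
      + pd H (eZ n) (pd H (eZ n) (v i)) (t, (y, z))) + (p t ht).fy i y z = 0
  vertical : ∀ t, ∀ ht : 0 < t, ∀ y, ∀ z ∈ Ioo 0 H,
    -((∑ j, pd H (eY j) (pd H (eY j) w) (t, (y, z)))
      + pd H (eZ n) (pd H (eZ n) w) (t, (y, z))) + (p t ht).fz y z = T (t, (y, z))
  T_bottom : ∀ t, 0 ≤ t → ∀ y, T (t, (y, 0)) = 1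
  T_top : ∀ t, 0 ≤ t → ∀ y, T (t, (y, H)) = 0
  v_bottom : ∀ t, 0 ≤ t → ∀ i y, v i (t, (y, 0)) = 0
  v_top : ∀ t, 0 ≤ t → ∀ i y, v i (t, (y, H)) = 0
  w_bottom : ∀ t, 0 ≤ t → ∀ y, w (t, (y, 0)) = 0
  w_top : ∀ t, 0 ≤ t → ∀ y, w (t, (y, H)) = 0

/-- The Stokes system solved by a flow at a positive time. -/
def Flow.stokes (F : Flow n L H) {t : ℝ} (ht : 0 < t) : StokesSlice n L H where
  v i := toSlice2 F.hH (F.cv i) (F.sv i) (F.pv i) ht.le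
  w := toSlice2 F.hH F.cw F.sw F.pw ht.le
  p := F.p t ht
  T y z := F.T (t, (y, z))
  cT := F.cT.comp (by fun_prop : Continuous fun x : (Fin n → ℝ) × ℝ => (t, x))
  divergence := F.divergence t ht
  horizontal := F.horizontal t ht
  vertical := F.vertical t ht
  v_bottom := F.v_bottom t ht.le
  v_top := F.v_top t ht.le
  w_bottom := F.w_bottom t ht.le
  w_top := F.w_top t ht.le

/-! ### The flow attached to a classical solution. -/

section OfSolution

variable {T : ℝ → Space n → ℝ} {v : ℝ → Fin n → Space n → ℝ} {w p : ℝ → Space n → ℝ}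

/-- The continuous extension of a function on the space-time layer. -/
def ext (H : ℝ) (f : ℝ → Space n → ℝ) (q : ℝ × Space n) : ℝ :=
  f (clamp H q).1 (clamp H q).2

theorem ext_eq {f : ℝ → Space n → ℝ} {t : ℝ} (ht : 0 ≤ t) {y : Fin n → ℝ} {z : ℝ}
    (hz : z ∈ Icc 0 H) : ext H f (t, (y, z)) = f t (y, z) := by
  rw [ext, clamp_eq (mem_slab.2 ⟨ht, hz.1, hz.2⟩)]

theorem continuous_ext (hH : 0 < H) {f : ℝ → Space n → ℝ}
    (hf : ContinuousOn (fun q : ℝ × Space n => f q.1 q.2) (slab n H)) : Continuous (ext H f) :=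
  hf.comp_continuous continuous_clamp (clamp_mem hH)

theorem contDiffOn_ext {m : WithTop ℕ∞} {f : ℝ → Space n → ℝ}
    (hf : ContDiffOn ℝ m (fun q : ℝ × Space n => f q.1 q.2) (slab n H)) :
    ContDiffOn ℝ m (ext H f) (slab n H) :=
  hf.congr fun q hq => by rw [ext, clamp_eq hq]

theorem slabPeriodic_ext {f : ℝ → Space n → ℝ}
    (hf : ∀ t, 0 ≤ t → IsHorizPeriodic L H (f t)) : SlabPeriodic L H (ext H f) := by
  intro t z ht hz j y
  simp only [ext_eq ht hz]
  exact hf t ht (y, z) ⟨mem_univ _, hz⟩ j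

theorem eventually_ext_eq {f : ℝ → Space n → ℝ} {t : ℝ} (ht : 0 ≤ t) {y : Fin n → ℝ} {z : ℝ}
    (hz : z ∈ Ioo 0 H) : f t =ᶠ[𝓝 (y, z)] fun x => ext H f (t, x) := by
  filter_upwards [eventually_mem_layer hz] with x hx
  exact (ext_eq ht (Ioo_subset_Icc_self hx)).symm

theorem dZ_ext {f : ℝ → Space n → ℝ} (hf : DifferentiableOn ℝ (ext H f) (slab n H)) {t : ℝ}
    (ht : 0 ≤ t) (y : Fin n → ℝ) {z : ℝ} (hz : z ∈ Ioo 0 H) :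
    dZ (f t) (y, z) = pd H (eZ n) (ext H f) (t, (y, z)) :=
  (dZ_congr (eventually_ext_eq ht hz)).trans (dZ_slice hf ht y hz)

theorem dY_ext {f : ℝ → Space n → ℝ} (hf : DifferentiableOn ℝ (ext H f) (slab n H)) {t : ℝ}
    (ht : 0 ≤ t) (j : Fin n) (y : Fin n → ℝ) {z : ℝ} (hz : z ∈ Ioo 0 H) :
    dY j (f t) (y, z) = pd H (eY j) (ext H f) (t, (y, z)) :=
  (dY_congr (eventually_ext_eq ht hz)).trans (dY_slice hf ht j y hz)

theorem lap_ext (hH : 0 < H) {f : ℝ → Space n → ℝ} (hf : ContDiffOn ℝ 2 (ext H f) (slab n H))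
    {t : ℝ} (ht : 0 ≤ t) (y : Fin n → ℝ) {z : ℝ} (hz : z ∈ Ioo 0 H) :
    lap (f t) (y, z) = (∑ j, pd H (eY j) (pd H (eY j) (ext H f)) (t, (y, z)))
      + pd H (eZ n) (pd H (eZ n) (ext H f)) (t, (y, z)) := by
  rw [← lap_slice hH hf ht y hz, lap, lap]
  congr 1
  · refine Finset.sum_congr rfl fun j _ => dY_congr ?_
    filter_upwards [(eventually_ext_eq (f := f) (y := y) ht hz).eventuallyEq_nhds] with x hx
    exact dY_congr hx
  · refine dZ_congr ?_
    filter_upwards [(eventually_ext_eq (f := f) (y := y) ht hz).eventuallyEq_nhds] with x hx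
    exact dZ_congr hx

/-- The pressure has no regularity in time. It is frozen at one instant and regarded as constant in
time, so that the space-time lemmas apply to it. -/
theorem contDiffOn_const_time {f : Space n → ℝ} {m : WithTop ℕ∞} (hf : ContDiffOn ℝ m f (layer n H)) :
    ContDiffOn ℝ m (fun q : ℝ × Space n => (fun _ : ℝ => f) q.1 q.2) (slab n H) :=
  hf.comp contDiffOn_snd fun _ hq => hq.2

/-- The flow of a classical solution. -/
def IsSolution.toFlow (hH : 0 < H) (hL : 0 < L) (h : IsSolution n L H T v w p) : Flow n L H where
  hH := hH
  hL := hL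
  T := ext H T
  v i := ext H fun t => v t i
  w := ext H w
  cT := continuous_ext hH h.regular_T.continuousOn
  cv i := continuous_ext hH (h.regular_v i).continuousOn
  cw := continuous_ext hH h.regular_w.continuousOn
  sT := contDiffOn_ext h.regular_T
  sv i := contDiffOn_ext (h.regular_v i)
  sw := contDiffOn_ext h.regular_w
  pT := slabPeriodic_ext h.periodic_T
  pv i := slabPeriodic_ext fun t ht => h.periodic_v t ht i
  pw := slabPeriodic_ext h.periodic_w
  p t ht := toSlice1 hH (F := ext H fun _ => p t)
    (continuous_ext hH (contDiffOn_const_time (h.regular_p t ht.le)).continuousOn)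
    (contDiffOn_ext (contDiffOn_const_time (h.regular_p t ht.le)))
    (slabPeriodic_ext fun _ _ => h.periodic_p t ht.le) ht.le
  heat t ht y z hz := by
    have hd := (contDiffOn_ext h.regular_T).differentiableOn two_ne_zero
    have h1 := h.heat t ht y z hz
    have hz' := Ioo_subset_Icc_self hz
    rw [lap_ext hH (contDiffOn_ext h.regular_T) ht.le y hz, dZ_ext hd ht.le y hz] at h1
    simp only [dY_ext hd ht.le _ y hz] at h1
    rw [← h1, ext_eq ht.le hz']
    simp only [ext_eq ht.le hz']
    congr 2
    refine ((hasDerivAt_pd_t hd ht y hz').congr_of_eventuallyEq ?_).deriv.symm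
    filter_upwards [Ioi_mem_nhds ht] with s hs
    exact (ext_eq (mem_Ioi.1 hs).le hz').symm
  divergence t ht y z hz := by
    have hd := (contDiffOn_ext h.regular_w).differentiableOn two_ne_zero
    have hd' := fun i => (contDiffOn_ext (f := fun t => v t i) (h.regular_v i)).differentiableOn two_ne_zero
    rw [← h.divergence t ht y z hz, dZ_ext hd ht.le y hz]
    congr 1
    exact Finset.sum_congr rfl fun j _ => (dY_ext (hd' j) ht.le j y hz).symm
  horizontal t ht i y z hz := by
    have hd := (contDiffOn_ext (f := fun _ => p t)
      (contDiffOn_const_time (h.regular_p t ht.le))).differentiableOn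
      one_ne_zero
    have h1 := h.stokes_v t ht y z hz i
    rw [lap_ext hH (f := fun t => v t i) (contDiffOn_ext (h.regular_v i)) ht.le y hz,
      dY_ext (f := fun _ => p t) hd ht.le i y hz] at h1
    exact h1
  vertical t ht y z hz := by
    have hd := (contDiffOn_ext (f := fun _ => p t)
      (contDiffOn_const_time (h.regular_p t ht.le))).differentiableOn
      one_ne_zero
    have h1 := h.stokes_w t ht y z hz
    rw [← ext_eq (f := T) ht.le (Ioo_subset_Icc_self hz), lap_ext hH (contDiffOn_ext h.regular_w) ht.le y hz,
      dZ_ext (f := fun _ => p t) hd ht.le y hz] at h1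
    exact h1
  T_bottom t ht y := by rw [ext_eq ht ⟨le_rfl, hH.le⟩, h.T_bottom t ht]
  T_top t ht y := by rw [ext_eq ht ⟨hH.le, le_rfl⟩, h.T_top t ht]
  v_bottom t ht i y := by rw [ext_eq ht ⟨le_rfl, hH.le⟩, h.v_bottom t ht]
  v_top t ht i y := by rw [ext_eq ht ⟨hH.le, le_rfl⟩, h.v_top t ht]
  w_bottom t ht y := by rw [ext_eq ht ⟨le_rfl, hH.le⟩, h.w_bottom t ht]
  w_top t ht y := by rw [ext_eq ht ⟨hH.le, le_rfl⟩, h.w_top t ht]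

end OfSolution

end RayleighBenard

end

noncomputable section

namespace RayleighBenard

/-! ### Balance laws for the temperature -/

variable {n : ℕ} {L H : ℝ}

/-- The horizontal average at time `t` and height `z`. -/
def hmean (L : ℝ) (G : ℝ × Space n → ℝ) (t z : ℝ) : ℝ := mean L fun y => G (t, (y, z))

theorem continuous_hmean {G : ℝ × Space n → ℝ} (hG : Continuous G) :
    Continuous fun x : ℝ × ℝ => hmean L G x.1 x.2 :=
  continuous_mean (F := fun (x : ℝ × ℝ) y => G (x.1, (y, x.2)))
    (hG.comp (by fun_prop : Continuous fun p : (ℝ × ℝ) × (Fin n → ℝ) => (p.1.1, (p.2, p.1.2))))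

theorem continuous_hmean_z {G : ℝ × Space n → ℝ} (hG : Continuous G) (t : ℝ) :
    Continuous fun z => hmean L G t z :=
  (continuous_hmean hG).comp (by fun_prop : Continuous fun z : ℝ => (t, z))

theorem continuous_hmean_t {G : ℝ × Space n → ℝ} (hG : Continuous G) (z : ℝ) :
    Continuous fun t => hmean L G t z :=
  (continuous_hmean hG).comp (by fun_prop : Continuous fun t : ℝ => (t, z))

theorem continuous_integral_hmean {G : ℝ × Space n → ℝ} (hG : Continuous G) (a b : ℝ) :
    Continuous fun t => ∫ z in a..b, hmean L G t z :=
  intervalIntegral.continuous_parametric_intervalIntegral_of_continuous' (continuous_hmean hG) a b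

theorem continuous_y {G : ℝ × Space n → ℝ} (hG : Continuous G) (t z : ℝ) :
    Continuous fun y => G (t, (y, z)) :=
  hG.comp (by fun_prop : Continuous fun y : Fin n → ℝ => (t, (y, z)))

theorem hmean_add {G K : ℝ × Space n → ℝ} (hG : Continuous G) (hK : Continuous K) (t z : ℝ) :
    hmean L (fun q => G q + K q) t z = hmean L G t z + hmean L K t z :=
  mean_add (continuous_y hG t z) (continuous_y hK t z)

theorem hmean_mono (hL : 0 < L) {G K : ℝ × Space n → ℝ} (hG : Continuous G) (hK : Continuous K)
    {t z : ℝ} (h : ∀ y, G (t, (y, z)) ≤ K (t, (y, z))) : hmean L G t z ≤ hmean L K t z :=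
  mean_mono hL (continuous_y hG t z) (continuous_y hK t z) h

/-- A twice continuously differentiable function with its derivatives. -/
structure C2Fun where
  f : ℝ → ℝ
  f1 : ℝ → ℝ
  f2 : ℝ → ℝ
  d1 : ∀ x, HasDerivAt f (f1 x) x
  d2 : ∀ x, HasDerivAt f1 (f2 x) x
  cf2 : Continuous f2

theorem C2Fun.cf (Φ : C2Fun) : Continuous Φ.f :=
  continuous_iff_continuousAt.2 fun x => (Φ.d1 x).continuousAt

theorem C2Fun.cf1 (Φ : C2Fun) : Continuous Φ.f1 :=
  continuous_iff_continuousAt.2 fun x => (Φ.d2 x).continuousAt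

namespace Flow

variable (F : Flow n L H) (Φ : C2Fun)

/-- The vertical temperature derivative. -/
def Tz : ℝ × Space n → ℝ := pd H (eZ n) F.T

/-- The temporal temperature derivative. -/
def Tt : ℝ × Space n → ℝ := pd H (eT n) F.T

/-- The vertical derivative of the vertical velocity. -/
def wz : ℝ × Space n → ℝ := pd H (eZ n) F.w

/-- The squared temperature gradient. -/
def gradT (q : ℝ × Space n) : ℝ := (∑ j, pd H (eY j) F.T q ^ 2) + F.Tz q ^ 2

theorem cTz : Continuous F.Tz := continuous_pd F.hH (F.sT.of_le one_le_two) _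

theorem cTt : Continuous F.Tt := continuous_pd F.hH (F.sT.of_le one_le_two) _

theorem cTy (j : Fin n) : Continuous (pd H (eY j) F.T) :=
  continuous_pd F.hH (F.sT.of_le one_le_two) _

theorem cwz : Continuous F.wz := continuous_pd F.hH (F.sw.of_le one_le_two) _

theorem cgradT : Continuous F.gradT :=
  (continuous_finsetSum _ fun j _ => (F.cTy j).pow 2).add (F.cTz.pow 2)

theorem dT : DifferentiableOn ℝ F.T (slab n H) := F.sT.differentiableOn two_ne_zero

theorem dw : DifferentiableOn ℝ F.w (slab n H) := F.sw.differentiableOn two_ne_zero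

/-- The vertical flux of `Φ(T)`. -/
def flux (q : ℝ × Space n) : ℝ := F.w q * Φ.f (F.T q) - Φ.f1 (F.T q) * F.Tz q

theorem cflux : Continuous (F.flux Φ) :=
  (F.cw.mul (Φ.cf.comp F.cT)).sub ((Φ.cf1.comp F.cT).mul F.cTz)

theorem mean_dy_eq_zero (hL : 0 < L) {G G' : ℝ × Space n → ℝ} (hG : Continuous G) (hG' : Continuous G')
    {t z : ℝ} {j : Fin n} (hp : ∀ j, Function.Periodic (fun y => G (t, (y, z))) (Pi.single j L))
    (h : ∀ y, HasDerivAt (fun s : ℝ => G (t, (y + s • Pi.single j 1, z))) (G' (t, (y, z))) 0) :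
    hmean L G' t z = 0 :=
  mean_deriv_eq_zero hL (f := fun y => G (t, (y, z))) (continuous_y hG t z)
    (continuous_y hG' t z) hp h

/-- The heat equation times `Φ'(T)`, with `div u = 0`, reads `∂ₜ Φ(T) + div (u Φ(T) - Φ'(T) ∇T) +
Φ''(T) |∇T|² = 0`; averaging over a period leaves only the vertical part of the divergence. -/
theorem hasDerivAt_flux {t z : ℝ} (ht : 0 < t) (hz : z ∈ Ioo 0 H) :
    HasDerivAt (fun z => hmean L (F.flux Φ) t z)
      (-(hmean L (fun q => Φ.f1 (F.T q) * F.Tt q) t z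
        + hmean L (fun q => Φ.f2 (F.T q) * F.gradT q) t z)) z := by
  have cf := Φ.cf.comp F.cT
  have cf1 := Φ.cf1.comp F.cT
  have cf2 := Φ.cf2.comp F.cT
  have cTzz : Continuous (pd H (eZ n) F.Tz) := continuous_pd F.hH (contDiffOn_pd F.hH F.sT _) _
  have cTyy : ∀ j, Continuous (pd H (eY j) (pd H (eY j) F.T)) := fun j =>
    continuous_pd F.hH (contDiffOn_pd F.hH F.sT _) _
  have cvy : ∀ j, Continuous (pd H (eY j) (F.v j)) := fun j =>
    continuous_pd F.hH ((F.sv j).of_le one_le_two) _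
  have hz' := Ioo_subset_Icc_self hz
  -- the vertical derivative of the flux
  let R : ℝ × Space n → ℝ := fun q => (F.wz q * Φ.f (F.T q) + F.w q * (Φ.f1 (F.T q) * F.Tz q))
    - ((Φ.f2 (F.T q) * F.Tz q) * F.Tz q + Φ.f1 (F.T q) * pd H (eZ n) F.Tz q)
  have cR : Continuous R := by
    have h1 := F.cwz
    have h2 := F.cw
    have h3 := F.cTz
    exact ((h1.mul cf).add (h2.mul (cf1.mul h3))).sub (((cf2.mul h3).mul h3).add (cf1.mul cTzz))
  have h1 : HasDerivAt (fun z => hmean L (F.flux Φ) t z) (hmean L R t z) z := by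
    refine hasDerivAt_mean (F := fun z y => F.flux Φ (t, (y, z))) (F' := fun z y => R (t, (y, z)))
      (fun s => continuous_y (F.cflux Φ) t s)
      (cR.comp (by fun_prop : Continuous fun p : ℝ × (Fin n → ℝ) => (t, (p.2, p.1)))) hz
      fun x hx y => ?_
    have eT := hasDerivAt_pd_z F.dT ht.le y hx
    have ew := hasDerivAt_pd_z F.dw ht.le y hx
    have eTz := hasDerivAt_pd_z ((contDiffOn_pd F.hH F.sT (eZ n)).differentiableOn one_ne_zero)
      ht.le y hx
    exact (ew.mul ((Φ.d1 _).comp x eT)).sub (((Φ.d2 _).comp x eT).mul eTz)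
  refine h1.congr_deriv ?_
  -- the horizontal fluxes
  have h2 : ∀ j, hmean L (fun q => pd H (eY j) (F.v j) q * Φ.f (F.T q)
      + F.v j q * (Φ.f1 (F.T q) * pd H (eY j) F.T q)) t z = 0 := fun j => by
    refine mean_dy_eq_zero F.hL (G := fun q => F.v j q * Φ.f (F.T q)) ((F.cv j).mul cf)
      (((cvy j).mul cf).add ((F.cv j).mul (cf1.mul (F.cTy j)))) (j := j) (fun i y => ?_)
      fun y => ?_
    · have e1 := F.pv j t z ht.le hz' i y
      have e2 := F.pT t z ht.le hz' i y
      simp only at e1 e2 ⊢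
      rw [e1, e2]
    · have e1 := hasDerivAt_pd_y ((F.sv j).differentiableOn two_ne_zero) ht.le j y hz'
      have e2 := hasDerivAt_pd_y F.dT ht.le j y hz'
      have e3 := e1.mul ((Φ.d1 _).comp 0 e2)
      simp only [Function.comp_apply, zero_smul, add_zero] at e3
      exact e3
  have h3 : ∀ j, hmean L (fun q => (Φ.f2 (F.T q) * pd H (eY j) F.T q) * pd H (eY j) F.T q
      + Φ.f1 (F.T q) * pd H (eY j) (pd H (eY j) F.T) q) t z = 0 := fun j => by
    refine mean_dy_eq_zero F.hL (G := fun q => Φ.f1 (F.T q) * pd H (eY j) F.T q) (cf1.mul (F.cTy j))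
      (((cf2.mul (F.cTy j)).mul (F.cTy j)).add (cf1.mul (cTyy j))) (j := j) (fun i y => ?_)
      fun y => ?_
    · have e1 := F.pT.pd_y F.dT j t z ht.le hz' i y
      have e2 := F.pT t z ht.le hz' i y
      simp only at e1 e2 ⊢
      rw [e1, e2]
    · have e1 := hasDerivAt_pd_y ((contDiffOn_pd F.hH F.sT (eY j)).differentiableOn one_ne_zero)
        ht.le j y hz'
      have e2 := hasDerivAt_pd_y F.dT ht.le j y hz'
      have e3 := ((Φ.d2 _).comp 0 e2).mul e1
      simp only [Function.comp_apply, zero_smul, add_zero] at e3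
      exact e3
  let A : Fin n → ℝ × Space n → ℝ := fun j q => pd H (eY j) (F.v j) q * Φ.f (F.T q)
      + F.v j q * (Φ.f1 (F.T q) * pd H (eY j) F.T q)
  let B : Fin n → ℝ × Space n → ℝ := fun j q =>
      (Φ.f2 (F.T q) * pd H (eY j) F.T q) * pd H (eY j) F.T q
      + Φ.f1 (F.T q) * pd H (eY j) (pd H (eY j) F.T) q
  have cA : ∀ j, Continuous (A j) := fun j =>
    ((cvy j).mul cf).add ((F.cv j).mul (cf1.mul (F.cTy j)))
  have cB : ∀ j, Continuous (B j) := fun j =>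
    ((cf2.mul (F.cTy j)).mul (F.cTy j)).add (cf1.mul (cTyy j))
  -- The vertical derivative of the flux is the desired expression plus the horizontal divergences
  -- `B j - A j`, whose averages vanish.
  have h4 : hmean L R t z = hmean L (fun q => -(Φ.f1 (F.T q) * F.Tt q + Φ.f2 (F.T q) * F.gradT q)) t z
      + hmean L (fun q => ∑ j, (B j q - A j q)) t z := by
    rw [← hmean_add (G := fun q => -(Φ.f1 (F.T q) * F.Tt q + Φ.f2 (F.T q) * F.gradT q))
      (K := fun q => ∑ j, (B j q - A j q)) ((cf1.mul F.cTt).add (cf2.mul F.cgradT)).neg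
      (continuous_finsetSum _ fun j _ => (cB j).sub (cA j))]
    refine mean_congr fun y => ?_
    have e1 := F.heat t ht y z hz
    have e2 := F.divergence t ht y z hz
    simp only [R, A, B, Tt, Tz, wz, gradT, Finset.sum_sub_distrib, Finset.sum_add_distrib]
    have e3 : ∀ q, ∑ j, pd H (eY j) (F.v j) q * Φ.f (F.T q)
        = (∑ j, pd H (eY j) (F.v j) q) * Φ.f (F.T q) := fun q => by rw [Finset.sum_mul]
    have e4 : ∀ q, ∑ j, F.v j q * (Φ.f1 (F.T q) * pd H (eY j) F.T q)
        = Φ.f1 (F.T q) * ∑ j, F.v j q * pd H (eY j) F.T q := fun q => by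
      rw [Finset.mul_sum]
      exact Finset.sum_congr rfl fun j _ => by ring
    have e5 : ∀ q, ∑ j, Φ.f2 (F.T q) * pd H (eY j) F.T q * pd H (eY j) F.T q
        = Φ.f2 (F.T q) * ∑ j, pd H (eY j) F.T q ^ 2 := fun q => by
      rw [Finset.mul_sum]
      exact Finset.sum_congr rfl fun j _ => by ring
    have e6 : ∀ q, ∑ j, Φ.f1 (F.T q) * pd H (eY j) (pd H (eY j) F.T) q
        = Φ.f1 (F.T q) * ∑ j, pd H (eY j) (pd H (eY j) F.T) q := fun q => by rw [Finset.mul_sum]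
    rw [e3, e4, e5, e6]
    linear_combination Φ.f1 (F.T (t, (y, z))) * e1 + Φ.f (F.T (t, (y, z))) * e2
  have h5 : hmean L (fun q => ∑ j, (B j q - A j q)) t z = 0 := by
    rw [hmean, mean_sum (f := fun j y => B j (t, (y, z)) - A j (t, (y, z))) _
      fun j _ => continuous_y ((cB j).sub (cA j)) t z]
    refine Finset.sum_eq_zero fun j _ => ?_
    rw [mean_sub (continuous_y (cB j) t z) (continuous_y (cA j) t z)]
    have e1 := h2 j
    have e2 := h3 j
    simp only [hmean] at e1 e2
    simp only [A, B, e1, e2, sub_zero]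
  rw [h4, h5, add_zero, ← hmean_add (G := fun q => Φ.f1 (F.T q) * F.Tt q)
    (K := fun q => Φ.f2 (F.T q) * F.gradT q) (cf1.mul F.cTt) (cf2.mul F.cgradT), hmean, mean_neg,
    hmean]

theorem hasDerivAt_time {t z : ℝ} (ht : 0 < t) (hz : z ∈ Icc 0 H) :
    HasDerivAt (fun t => hmean L (fun q => Φ.f (F.T q)) t z)
      (hmean L (fun q => Φ.f1 (F.T q) * F.Tt q) t z) t := by
  refine hasDerivAt_mean (F := fun t y => Φ.f (F.T (t, (y, z))))
    (F' := fun t y => Φ.f1 (F.T (t, (y, z))) * F.Tt (t, (y, z)))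
    (fun s => continuous_y (Φ.cf.comp F.cT) s z)
    (((Φ.cf1.comp F.cT).mul F.cTt).comp
      (by fun_prop : Continuous fun p : ℝ × (Fin n → ℝ) => (p.1, (p.2, z))))
    (a := 0) (b := t + 1) ⟨ht, by linarith⟩ fun x hx y => ?_
  exact (Φ.d1 _).comp x (hasDerivAt_pd_t F.dT hx.1 y hz)

/-- The balance law for `Φ(T)` in the layer between the heights `a` and `b`. -/
theorem balance {a b t₀ : ℝ} (ha : 0 ≤ a) (hab : a ≤ b) (hb : b ≤ H) (ht₀ : 0 ≤ t₀) :
    ∫ t in (0 : ℝ)..t₀, (hmean L (F.flux Φ) t a - hmean L (F.flux Φ) t b)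
      = (∫ z in a..b, (hmean L (fun q => Φ.f (F.T q)) t₀ z - hmean L (fun q => Φ.f (F.T q)) 0 z))
        + ∫ t in (0 : ℝ)..t₀, ∫ z in a..b, hmean L (fun q => Φ.f2 (F.T q) * F.gradT q) t z := by
  have c1 : Continuous fun q => Φ.f1 (F.T q) * F.Tt q := (Φ.cf1.comp F.cT).mul F.cTt
  have c2 : Continuous fun q => Φ.f2 (F.T q) * F.gradT q := (Φ.cf2.comp F.cT).mul F.cgradT
  have h1 : ∫ t in (0 : ℝ)..t₀, (hmean L (F.flux Φ) t a - hmean L (F.flux Φ) t b)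
      = ∫ t in (0 : ℝ)..t₀, ((∫ z in a..b, hmean L (fun q => Φ.f1 (F.T q) * F.Tt q) t z)
        + ∫ z in a..b, hmean L (fun q => Φ.f2 (F.T q) * F.gradT q) t z) := by
    refine StokesMode.integral_congr_Ioo ht₀ fun t ht => ?_
    rw [← intervalIntegral.integral_add ((continuous_hmean_z c1 t).intervalIntegrable _ _)
      ((continuous_hmean_z c2 t).intervalIntegrable _ _)]
    have h2 := intervalIntegral.integral_eq_sub_of_hasDerivAt_of_le hab
      (continuous_hmean_z (L := L) (F.cflux Φ) t).continuousOn
      (fun z hz => F.hasDerivAt_flux Φ ht.1 ⟨ha.trans_lt hz.1, hz.2.trans_le hb⟩)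
      (((continuous_hmean_z c1 t).add (continuous_hmean_z c2 t)).neg.intervalIntegrable _ _)
    rw [intervalIntegral.integral_neg] at h2
    linarith
  rw [h1, intervalIntegral.integral_add ((continuous_integral_hmean c1 a b).intervalIntegrable _ _)
    ((continuous_integral_hmean c2 a b).intervalIntegrable _ _)]
  congr 1
  rw [intervalIntegral_swap_of_continuous
    (F := fun t z => hmean L (fun q => Φ.f1 (F.T q) * F.Tt q) t z) (continuous_hmean c1)]
  refine intervalIntegral.integral_congr fun z hz => ?_
  rw [uIcc_of_le hab] at hz
  exact intervalIntegral.integral_eq_sub_of_hasDerivAt_of_le ht₀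
    (continuous_hmean_t (Φ.cf.comp F.cT) z).continuousOn
    (fun t ht => F.hasDerivAt_time Φ ht.1 ⟨ha.trans hz.1, hz.2.trans hb⟩)
    ((continuous_hmean_t c1 z).intervalIntegrable _ _)

end Flow

end RayleighBenard

end

noncomputable section

namespace RayleighBenard

/-! ### A priori bounds for the temperature -/

/-- At the corner, the function is `O(|x|^(m+2))` with exponent at least 2, hence its derivative is
zero. -/
theorem hasDerivAt_max_zero_pow (m : ℕ) (x : ℝ) :
    HasDerivAt (fun x : ℝ => max x 0 ^ (m + 2)) ((m + 2) * max x 0 ^ (m + 1)) x := by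
  rcases lt_trichotomy x 0 with hx | rfl | hx
  · rw [max_eq_right hx.le, zero_pow (by omega), mul_zero]
    refine (hasDerivAt_const x (0 : ℝ)).congr_of_eventuallyEq ?_
    filter_upwards [Iio_mem_nhds hx] with y hy
    rw [max_eq_right (mem_Iio.1 hy).le, zero_pow (by omega)]
  · rw [max_self, zero_pow (by omega), mul_zero]
    have h1 : (fun x : ℝ => max x 0 ^ (m + 2)) =O[𝓝 0] fun x => ‖x - 0‖ ^ (m + 2) := by
      refine Asymptotics.IsBigO.of_bound 1 (Eventually.of_forall fun y => ?_)
      rw [one_mul, sub_zero, norm_pow, norm_pow, norm_norm]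
      gcongr
      rw [Real.norm_eq_abs, Real.norm_eq_abs, abs_of_nonneg (le_max_right _ _)]
      exact max_le (le_abs_self y) (abs_nonneg y)
    exact (h1.hasFDerivAt (by omega)).hasDerivAt
  · rw [max_eq_left hx.le]
    have h1 := hasDerivAt_pow (m + 2) x
    simp only [Nat.add_succ_sub_one, Nat.cast_add, Nat.cast_ofNat] at h1
    refine h1.congr_of_eventuallyEq ?_
    filter_upwards [Ioi_mem_nhds hx] with y hy
    rw [max_eq_left (mem_Ioi.1 hy).le]

/-- The identity. -/
def C2Fun.id : C2Fun where
  f s := s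
  f1 _ := 1
  f2 _ := 0
  d1 := hasDerivAt_id
  d2 x := hasDerivAt_const x 1
  cf2 := continuous_const

/-- Half of the square. -/
def C2Fun.halfSq : C2Fun where
  f s := s ^ 2 / 2
  f1 s := s
  f2 _ := 1
  d1 x := by simpa using (hasDerivAt_pow 2 x).div_const 2
  d2 := hasDerivAt_id
  cf2 := continuous_const

/-- The positive part of `σ s - τ`. -/
def excess (σ τ s : ℝ) : ℝ := max (σ * s - τ) 0

theorem excess_nonneg (σ τ s : ℝ) : 0 ≤ excess σ τ s := le_max_right _ _

theorem continuous_excess (σ τ : ℝ) : Continuous (excess σ τ) := by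
  unfold excess
  fun_prop

theorem hasDerivAt_excess_pow (σ τ : ℝ) (m : ℕ) (x : ℝ) :
    HasDerivAt (fun s => excess σ τ s ^ (m + 2)) (((m + 2) * excess σ τ x ^ (m + 1)) * σ) x :=
  HasDerivAt.comp x (h := fun s => σ * s - τ) (hasDerivAt_max_zero_pow m (σ * x - τ))
    (by simpa using ((hasDerivAt_id x).const_mul σ).sub_const τ)

/-- The fourth power of the positive part of `σ s - τ`. -/
def C2Fun.excess (σ τ : ℝ) : C2Fun where
  f s := RayleighBenard.excess σ τ s ^ 4
  f1 s := 4 * σ * RayleighBenard.excess σ τ s ^ 3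
  f2 s := 12 * σ ^ 2 * RayleighBenard.excess σ τ s ^ 2
  d1 x := (hasDerivAt_excess_pow σ τ 2 x).congr_deriv (by push_cast; ring)
  d2 x := ((hasDerivAt_excess_pow σ τ 1 x).const_mul (4 * σ)).congr_deriv (by push_cast; ring)
  cf2 := ((continuous_excess σ τ).pow 2).const_mul _

theorem sub_one_le_excess (s : ℝ) : s ≤ 1 + excess 1 1 s := by
  have := le_max_left (1 * s - 1) 0
  unfold excess
  linarith

/-- Trades a linear excess for its fourth power, at the cost of a threshold `l` that is later taken
of order `Nu / H`. -/
theorem le_add_inv_pow_mul_pow {l s : ℝ} (hl : 0 < l) (hs : 0 ≤ s) : s ≤ l + (l ^ 3)⁻¹ * s ^ 4 := by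
  rcases le_total s l with h | h
  · have : 0 ≤ (l ^ 3)⁻¹ * s ^ 4 := by positivity
    linarith
  · have h1 : l ^ 3 ≤ s ^ 3 := by gcongr
    have h2 : s ≤ (l ^ 3)⁻¹ * s ^ 4 := by
      rw [inv_mul_eq_div, le_div_iff₀ (by positivity)]
      nlinarith
    linarith

/-- For `s > 1`, `s² ≤ 2 + 2 (s - 1)²` and `2 x² ≤ 1 + x⁴`, which explains the constant 3. -/
theorem sq_le_excess (s : ℝ) : s ^ 2 ≤ 3 + excess 1 1 s ^ 4 + excess (-1) 0 s ^ 4 := by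
  have h1 : ∀ x : ℝ, x ^ 2 ≤ 1 / 2 + 1 / 2 * x ^ 4 := fun x => by nlinarith [sq_nonneg (x ^ 2 - 1)]
  have h0 : ∀ x : ℝ, 0 ≤ x ^ 4 := fun x => by positivity
  rcases le_total s 0 with h | h
  · have e : excess (-1) 0 s = -s := by
      rw [excess, max_eq_left] <;> linarith
    rw [e]
    have := h1 s
    nlinarith [h0 s, h0 (excess 1 1 s), (by ring : (-s) ^ 4 = s ^ 4)]
  · rcases le_total s 1 with h' | h'
    · nlinarith [h0 (excess 1 1 s), h0 (excess (-1) 0 s)]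
    · have e : excess 1 1 s = s - 1 := by
        rw [excess, max_eq_left] <;> linarith
      rw [e]
      have := h1 (s - 1)
      nlinarith [h0 (excess (-1) 0 s), sq_nonneg (s - 2)]

/-- The estimate of the weighted convective flux by the total flux, at a fixed time. -/
theorem weighted_convection_le {m m' h q : ℝ → ℝ} {H a ε l P : ℝ} (ha : 0 < a) (haH : a ≤ H)
    (hε : 0 < ε) (hl : 0 < l) (cm : Continuous m) (cm' : Continuous m') (ch : Continuous h)
    (cq : Continuous q) (dm : ∀ z ∈ Ioo 0 H, HasDerivAt m (m' z) z) (m0 : m 0 = 1) (mH : m H = 0)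
    (hh : ∀ z ∈ Icc 0 H, |h z| ≤ z * P / 2) (hq : ∀ z, 0 ≤ q z)
    (hm : ∀ z ∈ Icc 0 H, m z ≤ 1 + l + (l ^ 3)⁻¹ * q z) :
    ∫ z in (0 : ℝ)..H, (z + ε)⁻¹ * h z
      ≤ 3 / 4 * a * P + (∫ z in a..H, (z + ε)⁻¹ * (h z - m' z))
        + (a + ε)⁻¹ * (∫ z in (0 : ℝ)..a, (h z - m' z)) + l / a
        + (l ^ 3)⁻¹ * (a ^ 2)⁻¹ * ∫ z in (0 : ℝ)..H, q z := by
  have hH : 0 < H := ha.trans_le haH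
  have cg : ContinuousOn (fun z : ℝ => (z + ε)⁻¹) (Icc 0 H) := StokesSlice.continuousOn_weight hε
  have cg1 := cg.mono (Icc_subset_Icc_right haH)
  have cg2 := cg.mono (Icc_subset_Icc_left ha.le)
  have ii1 : ∀ {u : ℝ → ℝ}, Continuous u →
      IntervalIntegrable (fun z : ℝ => (z + ε)⁻¹ * u z) volume 0 a :=
    fun hu => (cg1.mul hu.continuousOn).intervalIntegrable_of_Icc ha.le
  have ii2 : ∀ {u : ℝ → ℝ}, Continuous u →
      IntervalIntegrable (fun z : ℝ => (z + ε)⁻¹ * u z) volume a H :=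
    fun hu => (cg2.mul hu.continuousOn).intervalIntegrable_of_Icc haH
  have ii3 : ∀ {u : ℝ → ℝ}, Continuous u →
      IntervalIntegrable (fun z : ℝ => ((z + ε) ^ 2)⁻¹ * u z) volume a H := fun hu => by
    refine ContinuousOn.intervalIntegrable_of_Icc haH (ContinuousOn.mul ?_ hu.continuousOn)
    exact (cg2.pow 2).congr fun z _ => (inv_pow _ _).symm
  have hP : 0 ≤ P := by
    have := (abs_nonneg _).trans (hh H ⟨hH.le, le_rfl⟩)
    by_contra! hc
    nlinarith
  -- the layer below `a`
  have h1 : ∫ z in (0 : ℝ)..a, (z + ε)⁻¹ * h z ≤ a * P / 2 := by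
    have e1 : ∫ z in (0 : ℝ)..a, (z + ε)⁻¹ * h z ≤ ∫ _ in (0 : ℝ)..a, P / 2 := by
      refine intervalIntegral.integral_mono_on ha.le (ii1 ch) (by simp) fun z hz => ?_
      have e2 := (abs_le.1 (hh z ⟨hz.1, hz.2.trans haH⟩)).2
      have e3 : 0 < z + ε := by linarith [hz.1]
      rw [inv_mul_le_iff₀ e3]
      nlinarith
    simp only [intervalIntegral.integral_const, smul_eq_mul] at e1
    linarith
  have h2 : -(∫ z in (0 : ℝ)..a, h z) ≤ a ^ 2 * P / 4 := by
    have e1 : ∫ z in (0 : ℝ)..a, -h z ≤ ∫ z in (0 : ℝ)..a, z * (P / 2) := by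
      refine intervalIntegral.integral_mono_on ha.le (ch.neg.intervalIntegrable _ _)
        ((continuous_id.mul continuous_const).intervalIntegrable _ _) fun z hz => ?_
      have e2 := (abs_le.1 (hh z ⟨hz.1, hz.2.trans haH⟩)).1
      linarith
    rw [intervalIntegral.integral_neg, intervalIntegral.integral_mul_const, integral_id] at e1
    linarith
  -- The integration by parts leaves `(1 - m a) / (a + ε)`. Writing `1 - m a` through the total flux
  -- below `a` avoids an error of size `1 / a`.
  have h3 : ∫ z in (0 : ℝ)..a, (h z - m' z) = (∫ z in (0 : ℝ)..a, h z) - (m a - 1) := by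
    rw [intervalIntegral.integral_sub (ch.intervalIntegrable _ _) (cm'.intervalIntegrable _ _),
      intervalIntegral.integral_eq_sub_of_hasDerivAt_of_le ha.le cm.continuousOn
      (fun z hz => dm z ⟨hz.1, hz.2.trans_le haH⟩) (cm'.intervalIntegrable _ _), m0]
  -- integration by parts above `a`
  have h4 : ∫ z in a..H, (z + ε)⁻¹ * m' z
      = -((a + ε)⁻¹ * m a) + ∫ z in a..H, ((z + ε) ^ 2)⁻¹ * m z := by
    have e1 := intervalIntegral.integral_eq_sub_of_hasDerivAt_of_le
      (f := fun z => (z + ε)⁻¹ * m z)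
      (f' := fun z => -((z + ε) ^ 2)⁻¹ * m z + (z + ε)⁻¹ * m' z) haH (cg2.mul cm.continuousOn)
      (fun z hz => by
        have e2 : z + ε ≠ 0 := by linarith [hz.1]
        have e3 := (((hasDerivAt_id z).add_const ε).inv e2).mul (dm z ⟨ha.trans hz.1, hz.2⟩)
        refine e3.congr_deriv ?_
        simp only [id_eq, neg_div, one_div, Pi.inv_apply])
      (by
        simp only [neg_mul]
        exact (ii3 cm).neg.add (ii2 cm'))
    simp only [neg_mul] at e1
    have e4 : IntervalIntegrable (fun z => -(((z + ε) ^ 2)⁻¹ * m z)) volume a H := (ii3 cm).neg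
    rw [intervalIntegral.integral_add e4 (ii2 cm'), intervalIntegral.integral_neg, mH] at e1
    linarith
  -- Here `m ≤ 1` up to the excess replaces the maximum principle; the main part `(a + ε)⁻¹` cancels
  -- against the boundary term.
  have h5 : ∫ z in a..H, ((z + ε) ^ 2)⁻¹ * m z
      ≤ (1 + l) * (a + ε)⁻¹ + (l ^ 3)⁻¹ * (a ^ 2)⁻¹ * ∫ z in (0 : ℝ)..H, q z := by
    have e1 : ∫ z in a..H, ((z + ε) ^ 2)⁻¹ * m z
        ≤ ∫ z in a..H, (((z + ε) ^ 2)⁻¹ * (1 + l) + (l ^ 3)⁻¹ * (a ^ 2)⁻¹ * q z) := by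
      refine intervalIntegral.integral_mono_on haH (ii3 cm)
        ((ii3 continuous_const).add ((cq.const_mul _).intervalIntegrable _ _)) fun z hz => ?_
      have e2 : ((z + ε) ^ 2)⁻¹ ≤ (a ^ 2)⁻¹ := by
        gcongr
        linarith [hz.1]
      have e3 : 0 ≤ (l ^ 3)⁻¹ * q z := mul_nonneg (by positivity) (hq z)
      calc ((z + ε) ^ 2)⁻¹ * m z ≤ ((z + ε) ^ 2)⁻¹ * (1 + l + (l ^ 3)⁻¹ * q z) :=
            mul_le_mul_of_nonneg_left (hm z ⟨ha.le.trans hz.1, hz.2⟩) (by positivity)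
        _ = ((z + ε) ^ 2)⁻¹ * (1 + l) + ((z + ε) ^ 2)⁻¹ * ((l ^ 3)⁻¹ * q z) := by ring
        _ ≤ ((z + ε) ^ 2)⁻¹ * (1 + l) + (a ^ 2)⁻¹ * ((l ^ 3)⁻¹ * q z) := by gcongr
        _ = _ := by ring
    rw [intervalIntegral.integral_add (ii3 continuous_const)
      ((cq.const_mul _).intervalIntegrable _ _), intervalIntegral.integral_mul_const,
      intervalIntegral.integral_const_mul] at e1
    have e4 : ∫ z in a..H, ((z + ε) ^ 2)⁻¹ ≤ (a + ε)⁻¹ := by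
      have e5 := intervalIntegral.integral_eq_sub_of_hasDerivAt_of_le
        (f := fun z => -(z + ε)⁻¹) (f' := fun z => ((z + ε) ^ 2)⁻¹) haH cg2.neg
        (fun z hz => by
          have e2 : z + ε ≠ 0 := by linarith [hz.1]
          have e3 := ((((hasDerivAt_id z).add_const ε).inv e2)).neg
          refine e3.congr_deriv ?_
          simp only [id_eq, neg_div, one_div, neg_neg])
        (by simpa using ii3 (u := fun _ => 1) continuous_const)
      rw [e5]
      have : 0 < (H + ε)⁻¹ := by positivity
      linarith
    have e6 : ∫ z in a..H, q z ≤ ∫ z in (0 : ℝ)..H, q z :=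
      intervalIntegral.integral_mono_interval ha.le haH le_rfl (ae_of_all _ hq)
        (cq.intervalIntegrable _ _)
    have e7 : (l ^ 3)⁻¹ * (a ^ 2)⁻¹ * ∫ z in a..H, q z
        ≤ (l ^ 3)⁻¹ * (a ^ 2)⁻¹ * ∫ z in (0 : ℝ)..H, q z := by gcongr
    have e8 : (∫ z in a..H, ((z + ε) ^ 2)⁻¹) * (1 + l) ≤ (a + ε)⁻¹ * (1 + l) := by gcongr
    linarith
  have h6 : ∫ z in a..H, (z + ε)⁻¹ * (h z - m' z)
      = (∫ z in a..H, (z + ε)⁻¹ * h z) - ∫ z in a..H, (z + ε)⁻¹ * m' z := by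
    rw [← intervalIntegral.integral_sub (ii2 ch) (ii2 cm')]
    simp only [mul_sub]
  rw [← intervalIntegral.integral_add_adjacent_intervals (ii1 ch) (ii2 ch)]
  have h7 : (a + ε)⁻¹ ≤ a⁻¹ := by
    gcongr
    linarith
  have h8 : (a + ε)⁻¹ * -(∫ z in (0 : ℝ)..a, h z) ≤ a * P / 4 :=
    calc (a + ε)⁻¹ * -(∫ z in (0 : ℝ)..a, h z) ≤ (a + ε)⁻¹ * (a ^ 2 * P / 4) := by gcongr
      _ ≤ a⁻¹ * (a ^ 2 * P / 4) := by gcongr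
      _ = a * P / 4 := by field_simp
  have h9 : (a + ε)⁻¹ * l ≤ l / a := by
    rw [div_eq_inv_mul]
    gcongr
  rw [h3]
  linarith

end RayleighBenard

end

noncomputable section

namespace RayleighBenard

/-! ### Time-integrated estimates -/

variable {n : ℕ} {L H : ℝ}

theorem hmean_congr {G K : ℝ × Space n → ℝ} {t z : ℝ} (h : ∀ y, G (t, (y, z)) = K (t, (y, z))) :
    hmean L G t z = hmean L K t z :=
  mean_congr h

theorem hmean_nonneg (hL : 0 < L) {G : ℝ × Space n → ℝ} (h : ∀ q, 0 ≤ G q) (t z : ℝ) :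
    0 ≤ hmean L G t z :=
  mean_nonneg hL fun _ => h _

theorem hmean_const (hL : 0 < L) (c t z : ℝ) : hmean (n := n) L (fun _ => c) t z = c :=
  mean_const hL c

theorem hmean_const_mul (c : ℝ) (G : ℝ × Space n → ℝ) (t z : ℝ) :
    hmean L (fun q => c * G q) t z = c * hmean L G t z :=
  mean_const_mul c _

theorem intervalIntegral_hmean {G : ℝ × Space n → ℝ} (hG : Continuous G) (t a b : ℝ) :
    ∫ z in a..b, hmean L G t z = mean L fun y => ∫ z in a..b, G (t, (y, z)) :=
  (mean_intervalIntegral (f := fun y z => G (t, (y, z)))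
    (hG.comp (by fun_prop : Continuous fun x : (Fin n → ℝ) × ℝ => (t, x))) a b).symm

theorem continuous_integral_y {G : ℝ × Space n → ℝ} (hG : Continuous G) (t a b : ℝ) :
    Continuous fun y => ∫ z in a..b, G (t, (y, z)) :=
  intervalIntegral.continuous_parametric_intervalIntegral_of_continuous'
    (f := fun y z => G (t, (y, z)))
    (hG.comp (by fun_prop : Continuous fun x : (Fin n → ℝ) × ℝ => (t, x))) a b

namespace Flow

variable (F : Flow n L H)

/-- The horizontally averaged vertical heat flux. -/
def heatFlux (t z : ℝ) : ℝ := hmean L (F.flux C2Fun.id) t z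

/-- The horizontally averaged convective heat flux. -/
def conv (t z : ℝ) : ℝ := hmean L (fun q => F.w q * F.T q) t z

/-- The horizontally averaged dissipation in the layer. -/
def dissipation (t : ℝ) : ℝ := ∫ z in (0 : ℝ)..H, hmean L F.gradT t z

/-- The fourth power of the excess of the temperature, integrated over the layer. -/
def excessEnergy (σ τ t : ℝ) : ℝ := ∫ z in (0 : ℝ)..H, hmean L (fun q => excess σ τ (F.T q) ^ 4) t z

theorem continuous_excess_T (σ τ : ℝ) (m : ℕ) : Continuous fun q => excess σ τ (F.T q) ^ m :=
  ((continuous_excess σ τ).comp F.cT).pow m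

theorem continuous_wT : Continuous fun q => F.w q * F.T q := F.cw.mul F.cT

theorem continuous_heatFlux : Continuous fun x : ℝ × ℝ => F.heatFlux x.1 x.2 :=
  continuous_hmean (F.cflux _)

theorem continuous_excessEnergy (σ τ : ℝ) : Continuous (F.excessEnergy σ τ) :=
  continuous_integral_hmean (F.continuous_excess_T σ τ 4) 0 H

theorem continuous_dissipation : Continuous F.dissipation :=
  continuous_integral_hmean F.cgradT 0 H

theorem excessEnergy_nonneg (σ τ t : ℝ) : 0 ≤ F.excessEnergy σ τ t :=
  intervalIntegral.integral_nonneg F.hH.le fun _ _ =>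
    hmean_nonneg F.hL (fun _ => by positivity) _ _

theorem gradT_nonneg (q : ℝ × Space n) : 0 ≤ F.gradT q := by
  unfold gradT
  positivity

theorem dissipation_nonneg (t : ℝ) : 0 ≤ F.dissipation t :=
  intervalIntegral.integral_nonneg F.hH.le fun _ _ => hmean_nonneg F.hL F.gradT_nonneg _ _

theorem heatFlux_eq (t z : ℝ) : F.heatFlux t z = F.conv t z - hmean L F.Tz t z := by
  rw [heatFlux, conv, hmean, hmean, hmean,
    ← mean_sub (continuous_y F.continuous_wT t z) (continuous_y F.cTz t z)]
  exact mean_congr fun y => by simp [flux, C2Fun.id]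

theorem integral_heatFlux_sub {a b t₀ : ℝ} (ha : 0 ≤ a) (hab : a ≤ b) (hb : b ≤ H) (ht₀ : 0 ≤ t₀) :
    (∫ t in (0 : ℝ)..t₀, F.heatFlux t a) - ∫ t in (0 : ℝ)..t₀, F.heatFlux t b
      = (∫ z in a..b, hmean L F.T t₀ z) - ∫ z in a..b, hmean L F.T 0 z := by
  have h1 := F.balance C2Fun.id ha hab hb ht₀
  rw [intervalIntegral.integral_sub ((continuous_hmean_t (F.cflux _) a).intervalIntegrable _ _)
    ((continuous_hmean_t (F.cflux _) b).intervalIntegrable _ _)] at h1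
  have h2 : ∀ t z, hmean L (fun q => C2Fun.id.f2 (F.T q) * F.gradT q) t z = 0 := fun t z => by
    simp [C2Fun.id, hmean_const F.hL]
  simp only [h2, intervalIntegral.integral_zero, add_zero] at h1
  rw [intervalIntegral.integral_sub ((continuous_hmean_z (G := fun q => C2Fun.id.f (F.T q))
    F.cT _).intervalIntegrable _ _) ((continuous_hmean_z (G := fun q => C2Fun.id.f (F.T q))
    F.cT _).intervalIntegrable _ _)] at h1
  exact h1

/-- Balance law for `Φ(s) = s² / 2`: at the bottom `T = 1`, so the flux of `Φ` there is the heat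
flux; at the top it vanishes. -/
theorem integral_dissipation_le {t₀ : ℝ} (ht₀ : 0 ≤ t₀) :
    ∫ t in (0 : ℝ)..t₀, F.dissipation t ≤ (∫ t in (0 : ℝ)..t₀, F.heatFlux t 0)
      + ∫ z in (0 : ℝ)..H, hmean L (fun q => F.T q ^ 2 / 2) 0 z := by
  have h1 := F.balance C2Fun.halfSq le_rfl F.hH.le le_rfl ht₀
  have c : Continuous fun q => F.T q ^ 2 / 2 := (F.cT.pow 2).div_const 2
  have h2 : ∫ t in (0 : ℝ)..t₀, (hmean L (F.flux C2Fun.halfSq) t 0 - hmean L (F.flux C2Fun.halfSq) t H)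
      = ∫ t in (0 : ℝ)..t₀, F.heatFlux t 0 := by
    refine StokesMode.integral_congr_Ioo ht₀ fun t ht => ?_
    have e1 : hmean L (F.flux C2Fun.halfSq) t H = 0 := by
      rw [← hmean_const (n := n) F.hL 0 t H]
      exact hmean_congr fun y => by
        simp [flux, C2Fun.halfSq, F.T_top t ht.1.le, F.w_top t ht.1.le]
    rw [e1, sub_zero]
    exact hmean_congr fun y => by
      simp [flux, C2Fun.halfSq, C2Fun.id, F.T_bottom t ht.1.le, F.w_bottom t ht.1.le]
  rw [h2, intervalIntegral.integral_sub ((continuous_hmean_z (G := fun q => C2Fun.halfSq.f (F.T q))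
    c _).intervalIntegrable _ _) ((continuous_hmean_z (G := fun q => C2Fun.halfSq.f (F.T q))
    c _).intervalIntegrable _ _)] at h1
  have h3 : 0 ≤ ∫ z in (0 : ℝ)..H, hmean L (fun q => C2Fun.halfSq.f (F.T q)) t₀ z :=
    intervalIntegral.integral_nonneg F.hH.le fun z _ =>
      hmean_nonneg F.hL (fun q => by simp only [C2Fun.halfSq]; positivity) _ _
  simp only [C2Fun.halfSq, one_mul] at h1 h3
  simp only [dissipation]
  linarith

/-- The excess vanishes at both wall temperatures, so nothing enters through the boundary and the
energy only dissipates. -/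
theorem excess_balance {σ τ t₀ : ℝ} (hσ : σ ^ 2 = 1) (h0 : excess σ τ 0 = 0)
    (h1 : excess σ τ 1 = 0) (ht₀ : 0 ≤ t₀) :
    F.excessEnergy σ τ t₀
      + 12 * ∫ t in (0 : ℝ)..t₀, ∫ z in (0 : ℝ)..H,
        hmean L (fun q => excess σ τ (F.T q) ^ 2 * F.gradT q) t z
      = F.excessEnergy σ τ 0 := by
  have h2 := F.balance (C2Fun.excess σ τ) le_rfl F.hH.le le_rfl ht₀
  have h3 : ∫ t in (0 : ℝ)..t₀, (hmean L (F.flux (C2Fun.excess σ τ)) t 0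
      - hmean L (F.flux (C2Fun.excess σ τ)) t H) = ∫ t in (0 : ℝ)..t₀, (0 : ℝ) := by
    refine StokesMode.integral_congr_Ioo ht₀ fun t ht => ?_
    have e1 : hmean L (F.flux (C2Fun.excess σ τ)) t H = 0 := by
      rw [← hmean_const (n := n) F.hL 0 t H]
      exact hmean_congr fun y => by
        simp [flux, C2Fun.excess, F.T_top t ht.1.le, h0]
    have e2 : hmean L (F.flux (C2Fun.excess σ τ)) t 0 = 0 := by
      refine (hmean_congr (K := fun _ => 0) fun y => ?_).trans (hmean_const F.hL 0 t 0)
      simp [flux, C2Fun.excess, F.T_bottom t ht.1.le, h1]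
    rw [e1, e2, sub_zero]
  have c := F.continuous_excess_T σ τ 4
  rw [h3, intervalIntegral.integral_zero, intervalIntegral.integral_sub
    ((continuous_hmean_z (G := fun q => (C2Fun.excess σ τ).f (F.T q)) c _).intervalIntegrable _ _)
    ((continuous_hmean_z (G := fun q => (C2Fun.excess σ τ).f (F.T q)) c _).intervalIntegrable _ _)]
    at h2
  have h4 : ∀ t z, hmean L (fun q => (C2Fun.excess σ τ).f2 (F.T q) * F.gradT q) t z
      = 12 * hmean L (fun q => excess σ τ (F.T q) ^ 2 * F.gradT q) t z := fun t z => by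
    rw [← hmean_const_mul]
    exact hmean_congr fun y => by simp only [C2Fun.excess, hσ]; ring
  simp only [h4, intervalIntegral.integral_const_mul] at h2
  simp only [C2Fun.excess] at h2
  simp only [excessEnergy]
  linarith

/-- The vertical Poincaré inequality for the square of the excess: its gradient squared is `4 ·
excess² |∇T|²`, precisely the dissipation belonging to the fourth power. -/
theorem excessEnergy_le_poincare {σ τ t : ℝ} (hσ : σ ^ 2 = 1) (h1 : excess σ τ 1 = 0) (ht : 0 ≤ t) :
    F.excessEnergy σ τ t ≤ 16 * H ^ 2 * ∫ z in (0 : ℝ)..H,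
      hmean L (fun q => excess σ τ (F.T q) ^ 2 * F.gradT q) t z := by
  have c4 := F.continuous_excess_T σ τ 4
  have c2 : Continuous fun q => excess σ τ (F.T q) ^ 2 * F.gradT q :=
    (F.continuous_excess_T σ τ 2).mul F.cgradT
  have hc : Continuous fun z : ℝ => (t, z) := by fun_prop
  rw [excessEnergy, intervalIntegral_hmean c4, intervalIntegral_hmean c2, ← mean_const_mul]
  refine mean_mono F.hL (continuous_integral_y c4 t 0 H)
    ((continuous_integral_y c2 t 0 H).const_mul _) fun y => ?_
  have cy : Continuous fun z : ℝ => (t, ((y, z) : Space n)) := by fun_prop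
  have cT := F.cT.comp cy
  have cTz := F.cTz.comp cy
  have cθ : Continuous fun z => excess σ τ (F.T (t, (y, z))) := (continuous_excess σ τ).comp cT
  have h2 := integral_sq_le_of_left_eq_zero (f := fun z => excess σ τ (F.T (t, (y, z))) ^ 2)
    (f' := fun z => 2 * σ * excess σ τ (F.T (t, (y, z))) * F.Tz (t, (y, z))) F.hH.le
    (cθ.pow 2).continuousOn ((cθ.const_mul _).mul cTz).continuousOn
    (fun z hz => by
      have e := (hasDerivAt_excess_pow σ τ 0 (F.T (t, (y, z)))).comp z
        (hasDerivAt_pd_z F.dT ht y hz)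
      refine e.congr_deriv ?_
      simp only [Tz]
      push_cast
      ring)
    (by simp only [F.T_bottom t ht, h1]; norm_num)
  have h3 : ∫ z in (0 : ℝ)..H, (2 * σ * excess σ τ (F.T (t, (y, z))) * F.Tz (t, (y, z))) ^ 2
      ≤ ∫ z in (0 : ℝ)..H, 4 * (excess σ τ (F.T (t, (y, z))) ^ 2 * F.gradT (t, (y, z))) := by
    refine intervalIntegral.integral_mono_on F.hH.le
      ((((cθ.const_mul _).mul cTz).pow 2).intervalIntegrable _ _)
      (((c2.comp cy).const_mul 4).intervalIntegrable _ _) fun z _ => ?_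
    have e : F.Tz (t, (y, z)) ^ 2 ≤ F.gradT (t, (y, z)) := by
      unfold gradT
      have : 0 ≤ ∑ j, pd H (eY j) F.T (t, (y, z)) ^ 2 := by positivity
      linarith
    calc (2 * σ * excess σ τ (F.T (t, (y, z))) * F.Tz (t, (y, z))) ^ 2
        = 4 * σ ^ 2 * (excess σ τ (F.T (t, (y, z))) ^ 2 * F.Tz (t, (y, z)) ^ 2) := by ring
      _ ≤ 4 * σ ^ 2 * (excess σ τ (F.T (t, (y, z))) ^ 2 * F.gradT (t, (y, z))) := by gcongr
      _ = _ := by rw [hσ]; ring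
  rw [intervalIntegral.integral_const_mul] at h3
  have h4 : ∀ z, (excess σ τ (F.T (t, (y, z))) ^ 2) ^ 2 = excess σ τ (F.T (t, (y, z))) ^ 4 :=
    fun z => by ring
  simp only [h4] at h2
  have h5 : 4 * H ^ 2 * ∫ z in (0 : ℝ)..H, (2 * σ * excess σ τ (F.T (t, (y, z))) * F.Tz (t, (y, z))) ^ 2
      ≤ 4 * H ^ 2 * (4 * ∫ z in (0 : ℝ)..H, excess σ τ (F.T (t, (y, z))) ^ 2 * F.gradT (t, (y, z))) := by
    gcongr
  linarith

theorem integral_excess_grad_nonneg (σ τ t : ℝ) :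
    0 ≤ ∫ z in (0 : ℝ)..H, hmean L (fun q => excess σ τ (F.T q) ^ 2 * F.gradT q) t z :=
  intervalIntegral.integral_nonneg F.hH.le fun _ _ =>
    hmean_nonneg F.hL (fun q => mul_nonneg (sq_nonneg _) (F.gradT_nonneg q)) _ _

theorem excessEnergy_le {σ τ t₀ : ℝ} (hσ : σ ^ 2 = 1) (h0 : excess σ τ 0 = 0)
    (h1 : excess σ τ 1 = 0) (ht₀ : 0 ≤ t₀) : F.excessEnergy σ τ t₀ ≤ F.excessEnergy σ τ 0 := by
  have h2 := F.excess_balance hσ h0 h1 ht₀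
  have h3 := intervalIntegral.integral_nonneg (μ := volume) ht₀ fun t _ => F.integral_excess_grad_nonneg σ τ t
  linarith

/-- Balance and Poincaré give a bound independent of `t₀`: the long-time substitute for `0 ≤ T ≤ 1`.
The factor is `16 / 12`, rounded up to 2. -/
theorem integral_excessEnergy_le {σ τ t₀ : ℝ} (hσ : σ ^ 2 = 1) (h0 : excess σ τ 0 = 0)
    (h1 : excess σ τ 1 = 0) (ht₀ : 0 ≤ t₀) :
    ∫ t in (0 : ℝ)..t₀, F.excessEnergy σ τ t ≤ 2 * H ^ 2 * F.excessEnergy σ τ 0 := by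
  have c2 : Continuous fun q => excess σ τ (F.T q) ^ 2 * F.gradT q :=
    (F.continuous_excess_T σ τ 2).mul F.cgradT
  have h2 := F.excess_balance hσ h0 h1 ht₀
  have h3 : ∫ t in (0 : ℝ)..t₀, F.excessEnergy σ τ t ≤ ∫ t in (0 : ℝ)..t₀, (16 * H ^ 2 *
      ∫ z in (0 : ℝ)..H, hmean L (fun q => excess σ τ (F.T q) ^ 2 * F.gradT q) t z) :=
    intervalIntegral.integral_mono_on ht₀ ((F.continuous_excessEnergy σ τ).intervalIntegrable _ _)
      (((continuous_integral_hmean c2 0 H).const_mul _).intervalIntegrable _ _)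
      fun t ht => F.excessEnergy_le_poincare hσ h1 ht.1
  rw [intervalIntegral.integral_const_mul] at h3
  have h4 := F.excessEnergy_nonneg σ τ t₀
  have h5 : 0 ≤ H ^ 2 := sq_nonneg H
  have h6 : 12 * ∫ t in (0 : ℝ)..t₀, ∫ z in (0 : ℝ)..H,
      hmean L (fun q => excess σ τ (F.T q) ^ 2 * F.gradT q) t z ≤ F.excessEnergy σ τ 0 := by linarith
  have h7 := F.excessEnergy_nonneg σ τ 0
  nlinarith [mul_le_mul_of_nonneg_left h6 h5]

/-- A bound for the thermal energy in the layer. -/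
def energyBound : ℝ := 3 * H + F.excessEnergy 1 1 0 + F.excessEnergy (-1) 0 0

theorem energyBound_nonneg : 0 ≤ F.energyBound := by
  have h1 := F.excessEnergy_nonneg 1 1 0
  have h2 := F.excessEnergy_nonneg (-1) 0 0
  have h3 := F.hH
  unfold energyBound
  positivity

theorem integral_sq_T_le {b : ℝ} (hb : 0 ≤ b) (hbH : b ≤ H) (t : ℝ) :
    ∫ z in (0 : ℝ)..b, hmean L (fun q => F.T q ^ 2) t z
      ≤ 3 * b + F.excessEnergy 1 1 t + F.excessEnergy (-1) 0 t := by
  have c1 := F.continuous_excess_T 1 1 4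
  have c2 := F.continuous_excess_T (-1) 0 4
  have h1 : ∫ z in (0 : ℝ)..b, hmean L (fun q => F.T q ^ 2) t z
      ≤ ∫ z in (0 : ℝ)..b, (3 + hmean L (fun q => excess 1 1 (F.T q) ^ 4) t z
        + hmean L (fun q => excess (-1) 0 (F.T q) ^ 4) t z) := by
    refine intervalIntegral.integral_mono_on hb
      ((continuous_hmean_z (F.cT.pow 2) t).intervalIntegrable _ _)
      (((continuous_const.add (continuous_hmean_z c1 t)).add
        (continuous_hmean_z c2 t)).intervalIntegrable _ _) fun z _ => ?_
    rw [← hmean_const (n := n) F.hL 3 t z, ← hmean_add continuous_const c1,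
      ← hmean_add (G := fun q => 3 + excess 1 1 (F.T q) ^ 4) (continuous_const.add c1) c2]
    exact hmean_mono F.hL (F.cT.pow 2) ((continuous_const.add c1).add c2) fun y => sq_le_excess _
  have c3 : Continuous fun z => 3 + hmean L (fun q => excess 1 1 (F.T q) ^ 4) t z :=
    continuous_const.add (continuous_hmean_z c1 t)
  rw [intervalIntegral.integral_add (c3.intervalIntegrable _ _)
      ((continuous_hmean_z c2 t).intervalIntegrable _ _),
    intervalIntegral.integral_add (continuous_const.intervalIntegrable _ _)
      ((continuous_hmean_z c1 t).intervalIntegrable _ _), intervalIntegral.integral_const,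
    smul_eq_mul, sub_zero] at h1
  have h2 : ∀ σ τ, Continuous (fun q => excess σ τ (F.T q) ^ 4) →
      ∫ z in (0 : ℝ)..b, hmean L (fun q => excess σ τ (F.T q) ^ 4) t z ≤ F.excessEnergy σ τ t :=
    fun σ τ c => intervalIntegral.integral_mono_interval le_rfl hb hbH
      (ae_of_all _ fun z => hmean_nonneg F.hL (fun _ => by positivity) _ _)
      ((continuous_hmean_z c t).intervalIntegrable _ _)
  have h3 := h2 1 1 c1
  have h4 := h2 (-1) 0 c2
  linarith

theorem excess_one_one_zero : excess 1 1 0 = 0 := by norm_num [excess]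

theorem excess_one_one_one : excess 1 1 1 = 0 := by norm_num [excess]

theorem excess_neg_zero : excess (-1) 0 0 = 0 := by norm_num [excess]

theorem excess_neg_one : excess (-1) 0 1 = 0 := by norm_num [excess]

theorem abs_integral_T_le {a b t : ℝ} (ha : 0 ≤ a) (hab : a ≤ b) (hb : b ≤ H) (ht : 0 ≤ t) :
    |∫ z in a..b, hmean L F.T t z| ≤ F.energyBound + H := by
  have hH := F.hH
  have c2 : Continuous fun q => F.T q ^ 2 := F.cT.pow 2
  have c4 : Continuous fun q => 1 + F.T q ^ 2 := continuous_const.add c2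
  have h1 : ∀ z, |hmean L F.T t z| ≤ 1 + hmean L (fun q => F.T q ^ 2) t z := fun z => by
    rw [← hmean_const (n := n) F.hL 1 t z, ← hmean_add continuous_const c2, abs_le]
    constructor
    · rw [hmean, hmean, ← mean_neg]
      exact mean_mono F.hL (continuous_y c4 t z).neg
        (continuous_y F.cT t z) fun y => by nlinarith [sq_nonneg (F.T (t, (y, z)) + 1)]
    · exact hmean_mono F.hL F.cT c4 fun y => by
        nlinarith [sq_nonneg (F.T (t, (y, z)) - 1)]
  have c3 : Continuous fun z => 1 + hmean L (fun q => F.T q ^ 2) t z :=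
    continuous_const.add (continuous_hmean_z c2 t)
  calc |∫ z in a..b, hmean L F.T t z| ≤ ∫ z in a..b, |hmean L F.T t z| :=
        intervalIntegral.abs_integral_le_integral_abs hab
    _ ≤ ∫ z in a..b, (1 + hmean L (fun q => F.T q ^ 2) t z) :=
        intervalIntegral.integral_mono_on hab
          ((continuous_hmean_z F.cT t).abs.intervalIntegrable _ _) (c3.intervalIntegrable _ _)
          fun z _ => h1 z
    _ ≤ ∫ z in (0 : ℝ)..H, (1 + hmean L (fun q => F.T q ^ 2) t z) :=
        intervalIntegral.integral_mono_interval ha hab hb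
          (ae_of_all _ fun z => (abs_nonneg _).trans (h1 z)) (c3.intervalIntegrable _ _)
    _ = H + ∫ z in (0 : ℝ)..H, hmean L (fun q => F.T q ^ 2) t z := by
        rw [intervalIntegral.integral_add (continuous_const.intervalIntegrable _ _)
          ((continuous_hmean_z c2 t).intervalIntegrable _ _)]
        simp
    _ ≤ H + (3 * H + F.excessEnergy 1 1 t + F.excessEnergy (-1) 0 t) := by
        gcongr
        exact F.integral_sq_T_le F.hH.le le_rfl t
    _ ≤ F.energyBound + H := by
        have e1 := F.excessEnergy_le (by norm_num) excess_one_one_zero excess_one_one_one ht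
        have e2 := F.excessEnergy_le (by norm_num) excess_neg_zero excess_neg_one ht
        unfold energyBound
        linarith

/-- The time-integrated heat flux is almost independent of the height. -/
theorem abs_integral_heatFlux_sub_le {z t₀ : ℝ} (hz : z ∈ Icc 0 H) (ht₀ : 0 ≤ t₀) :
    |(∫ t in (0 : ℝ)..t₀, F.heatFlux t z) - ∫ t in (0 : ℝ)..t₀, F.heatFlux t 0|
      ≤ 2 * (F.energyBound + H) := by
  have h1 := F.integral_heatFlux_sub le_rfl hz.1 hz.2 ht₀
  have h2 := abs_le.1 (F.abs_integral_T_le le_rfl hz.1 hz.2 ht₀)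
  have h3 := abs_le.1 (F.abs_integral_T_le le_rfl hz.1 hz.2 le_rfl)
  rw [abs_le]
  constructor <;> linarith

end Flow

end RayleighBenard

end

noncomputable section

namespace RayleighBenard

/-! ### The logarithmically weighted convective flux -/

variable {n : ℕ} {L H : ℝ}

/-- With `|z|` the weight is continuous on the whole line, as the continuity and Fubini statements
require. -/
theorem integral_weight_congr {a b ε : ℝ} (ha : 0 ≤ a) (hab : a ≤ b) (k : ℝ → ℝ) :
    ∫ z in a..b, (z + ε)⁻¹ * k z = ∫ z in a..b, (|z| + ε)⁻¹ * k z := by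
  refine StokesMode.integral_congr_Ioo hab fun z hz => ?_
  rw [abs_of_pos (ha.trans_lt hz.1)]

theorem continuous_weight {ε : ℝ} (hε : 0 < ε) : Continuous fun z : ℝ => (|z| + ε)⁻¹ :=
  Continuous.inv₀ (by fun_prop) fun z => by positivity

theorem continuous_integral_weight {K : ℝ → ℝ → ℝ} (hK : Continuous (Function.uncurry K))
    {a b ε : ℝ} (hε : 0 < ε) (ha : 0 ≤ a) (hab : a ≤ b) :
    Continuous fun t => ∫ z in a..b, (z + ε)⁻¹ * K t z := by
  simp only [integral_weight_congr ha hab]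
  exact intervalIntegral.continuous_parametric_intervalIntegral_of_continuous'
    (f := fun t z => (|z| + ε)⁻¹ * K t z) (((continuous_weight hε).comp continuous_snd).mul hK) a b

theorem integral_weight_swap {K : ℝ → ℝ → ℝ} (hK : Continuous (Function.uncurry K))
    {a b ε : ℝ} (hε : 0 < ε) (ha : 0 ≤ a) (hab : a ≤ b) (t₀ : ℝ) :
    ∫ t in (0 : ℝ)..t₀, ∫ z in a..b, (z + ε)⁻¹ * K t z
      = ∫ z in a..b, (z + ε)⁻¹ * ∫ t in (0 : ℝ)..t₀, K t z := by
  simp only [integral_weight_congr ha hab]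
  rw [intervalIntegral_swap_of_continuous (F := fun t z => (|z| + ε)⁻¹ * K t z)
    (((continuous_weight hε).comp continuous_snd).mul hK)]
  simp only [intervalIntegral.integral_const_mul]

theorem integral_weight_le_log {a b ε : ℝ} (hε : 0 < ε) (ha : 0 < a) (hab : a ≤ b) :
    ∫ z in a..b, (z + ε)⁻¹ ≤ Real.log (b / a) := by
  rw [← integral_inv_of_pos ha (ha.trans_le hab)]
  refine intervalIntegral.integral_mono_on hab
    (ContinuousOn.intervalIntegrable_of_Icc hab (ContinuousOn.inv₀ (by fun_prop) fun z hz => by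
      linarith [hz.1]))
    (ContinuousOn.intervalIntegrable_of_Icc hab (ContinuousOn.inv₀ (by fun_prop) fun z hz => by
      linarith [hz.1])) fun z hz => ?_
  have : 0 < z := ha.trans_le hz.1
  gcongr
  linarith

namespace Flow

variable (F : Flow n L H)

/-- The horizontally averaged squared vertical derivative of `w`, integrated over the layer. -/
def stretching (t : ℝ) : ℝ := ∫ z in (0 : ℝ)..H, hmean L (fun q => F.wz q ^ 2) t z

/-- The weighted convective heat flux. -/
def weightedConv (ε t : ℝ) : ℝ := ∫ z in (0 : ℝ)..H, (z + ε)⁻¹ * F.conv t z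

theorem continuous_stretching : Continuous F.stretching :=
  continuous_integral_hmean (F.cwz.pow 2) 0 H

theorem continuous_conv : Continuous fun x : ℝ × ℝ => F.conv x.1 x.2 :=
  continuous_hmean F.continuous_wT

theorem continuous_weightedConv {ε : ℝ} (hε : 0 < ε) : Continuous (F.weightedConv ε) :=
  continuous_integral_weight F.continuous_conv hε le_rfl F.hH.le

/-- As `w` has zero horizontal mean, `T` may be replaced by `T - 1`. Both factors vanish at the
bottom, so by Cauchy–Schwarz each is at most `√z` times the `L²` norm of its vertical derivative. -/
theorem abs_conv_le {t z : ℝ} (ht : 0 < t) (hz : z ∈ Icc 0 H) :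
    |F.conv t z| ≤ z * (F.stretching t + F.dissipation t) / 2 := by
  have cw2 : Continuous fun q => F.wz q ^ 2 := F.cwz.pow 2
  have cT2 : Continuous fun q => F.Tz q ^ 2 := F.cTz.pow 2
  have h1 : ∀ y, |F.w (t, (y, z)) * (F.T (t, (y, z)) - 1)|
      ≤ z / 2 * ((∫ s in (0 : ℝ)..H, F.wz (t, (y, s)) ^ 2) + ∫ s in (0 : ℝ)..H, F.Tz (t, (y, s)) ^ 2) :=
    fun y => by
    have cy : Continuous fun z : ℝ => (t, ((y, z) : Space n)) := by fun_prop
    have e1 := sq_le_mul_integral_sq hz (F.cw.comp cy).continuousOn (F.cwz.comp cy).continuousOn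
      (fun x hx => hasDerivAt_pd_z F.dw ht.le y hx) (F.w_bottom t ht.le y)
    have e2 := sq_le_mul_integral_sq (f := fun z => F.T (t, (y, z)) - 1) hz
      ((F.cT.comp cy).sub continuous_const).continuousOn (F.cTz.comp cy).continuousOn
      (fun x hx => (hasDerivAt_pd_z F.dT ht.le y hx).sub_const 1) (by simp [F.T_bottom t ht.le y])
    simp only [Function.comp_apply] at e1 e2
    rw [abs_le]
    constructor
    · nlinarith [sq_nonneg (F.w (t, (y, z)) + (F.T (t, (y, z)) - 1))]
    · nlinarith [sq_nonneg (F.w (t, (y, z)) - (F.T (t, (y, z)) - 1))]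
  have h2 : F.conv t z = mean L fun y => F.w (t, (y, z)) * (F.T (t, (y, z)) - 1) := by
    have e1 := (F.stokes ht).mean_w_eq_zero F.hL hz
    have e2 : mean L (fun y => F.w (t, (y, z))) = 0 := e1
    simp only [mul_sub, mul_one]
    rw [mean_sub (continuous_y F.continuous_wT t z) (continuous_y F.cw t z), e2, sub_zero, conv, hmean]
  have c1 : Continuous fun y => F.w (t, (y, z)) * (F.T (t, (y, z)) - 1) :=
    (continuous_y F.cw t z).mul ((continuous_y F.cT t z).sub continuous_const)
  have c2 := continuous_integral_y cw2 t 0 H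
  have c3 := continuous_integral_y cT2 t 0 H
  have h3 : ∀ u : (Fin n → ℝ) → ℝ, Continuous u → (∀ y, u y ≤ |F.w (t, (y, z)) * (F.T (t, (y, z)) - 1)|) →
      mean L u ≤ z * (F.stretching t + F.dissipation t) / 2 := fun u cu hu => by
    have e1 := mean_mono (g := fun y => z / 2 * ((∫ s in (0 : ℝ)..H, F.wz (t, (y, s)) ^ 2)
      + ∫ s in (0 : ℝ)..H, F.Tz (t, (y, s)) ^ 2)) F.hL cu ((c2.add c3).const_mul (z / 2)) fun y => (hu y).trans (h1 y)
    rw [mean_const_mul, mean_add c2 c3, ← intervalIntegral_hmean cw2, ← intervalIntegral_hmean cT2] at e1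
    have e2 : ∫ z in (0 : ℝ)..H, hmean L (fun q => F.Tz q ^ 2) t z ≤ F.dissipation t :=
      intervalIntegral.integral_mono_on F.hH.le ((continuous_hmean_z cT2 t).intervalIntegrable _ _)
        ((continuous_hmean_z F.cgradT t).intervalIntegrable _ _) fun z _ =>
        hmean_mono F.hL cT2 F.cgradT fun y => by
          unfold gradT
          have : 0 ≤ ∑ j, pd H (eY j) F.T (t, (y, z)) ^ 2 := by positivity
          linarith
    have e3 := mul_le_mul_of_nonneg_left e2 (by linarith [hz.1] : 0 ≤ z / 2)
    simp only [stretching]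
    linarith
  rw [h2, abs_le']
  refine ⟨h3 _ c1 fun y => le_abs_self _, ?_⟩
  rw [← mean_neg]
  exact h3 _ c1.neg fun y => neg_le_abs _

theorem hasDerivAt_hmean_T {t z : ℝ} (ht : 0 ≤ t) (hz : z ∈ Ioo 0 H) :
    HasDerivAt (fun z => hmean L F.T t z) (hmean L F.Tz t z) z :=
  hasDerivAt_mean (F := fun z y => F.T (t, (y, z))) (F' := fun z y => F.Tz (t, (y, z)))
    (fun s => continuous_y F.cT t s)
    (F.cTz.comp (by fun_prop : Continuous fun p : ℝ × (Fin n → ℝ) => (t, (p.2, p.1)))) hz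
    fun _ hx y => hasDerivAt_pd_z F.dT ht y hx

theorem hmean_T_bottom {t : ℝ} (ht : 0 ≤ t) : hmean L F.T t 0 = 1 :=
  (hmean_congr (K := fun _ => 1) fun y => F.T_bottom t ht y).trans (hmean_const F.hL 1 t 0)

theorem hmean_T_top {t : ℝ} (ht : 0 ≤ t) : hmean L F.T t H = 0 :=
  (hmean_congr (K := fun _ => 0) fun y => F.T_top t ht y).trans (hmean_const F.hL 0 t H)

/-- The Stokes energy bounds the left side by the integral of `wT`, which is the integrated heat
flux minus one, the temperature drop. -/
theorem stretching_le {t : ℝ} (ht : 0 < t) :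
    F.stretching t ≤ ∫ z in (0 : ℝ)..H, F.heatFlux t z := by
  have h1 : F.stretching t ≤ ∫ z in (0 : ℝ)..H, F.conv t z := (F.stokes ht).energy F.hL F.hH
  have h2 := intervalIntegral.integral_eq_sub_of_hasDerivAt_of_le F.hH.le
    (continuous_hmean_z (L := L) F.cT t).continuousOn
    (fun z hz => F.hasDerivAt_hmean_T ht.le hz) ((continuous_hmean_z F.cTz t).intervalIntegrable _ _)
  rw [F.hmean_T_bottom ht.le, F.hmean_T_top ht.le] at h2
  have c : Continuous fun z => F.conv t z := continuous_hmean_z F.continuous_wT t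
  simp only [heatFlux_eq]
  rw [intervalIntegral.integral_sub (c.intervalIntegrable _ _)
    ((continuous_hmean_z F.cTz t).intervalIntegrable _ _), h2]
  linarith

theorem weightedConv_le {a ε l t : ℝ} (ha : 0 < a) (haH : a ≤ H) (hε : 0 < ε) (hl : 0 < l)
    (ht : 0 < t) :
    F.weightedConv ε t ≤ 3 / 4 * a * (F.stretching t + F.dissipation t)
      + (∫ z in a..H, (z + ε)⁻¹ * F.heatFlux t z) + (a + ε)⁻¹ * (∫ z in (0 : ℝ)..a, F.heatFlux t z)
      + l / a + (l ^ 3)⁻¹ * (a ^ 2)⁻¹ * F.excessEnergy 1 1 t := by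
  have cq := F.continuous_excess_T 1 1 4
  have h1 := weighted_convection_le (q := fun z => hmean L (fun q => excess 1 1 (F.T q) ^ 4) t z)
    ha haH hε hl (continuous_hmean_z (L := L) F.cT t) (continuous_hmean_z F.cTz t)
    (continuous_hmean_z F.continuous_wT t)
    (continuous_hmean_z cq t) (fun z hz => F.hasDerivAt_hmean_T ht.le hz) (F.hmean_T_bottom ht.le)
    (F.hmean_T_top ht.le) (fun z hz => F.abs_conv_le ht hz)
    (fun z => hmean_nonneg F.hL (fun _ => by positivity) _ _) fun z hz => by
      rw [← hmean_const (n := n) F.hL (1 + l) t z, ← hmean_const_mul,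
        ← hmean_add continuous_const (cq.const_mul _)]
      refine hmean_mono F.hL F.cT (continuous_const.add (cq.const_mul _)) fun y => ?_
      have e1 := sub_one_le_excess (F.T (t, (y, z)))
      have e2 := le_add_inv_pow_mul_pow hl (excess_nonneg 1 1 (F.T (t, (y, z))))
      simp only [Pi.add_apply]
      linarith
  simp only [heatFlux_eq]
  exact h1

/-- A constant that bounds the transient effects of the initial temperature. -/
def transient : ℝ :=
  2 * (F.energyBound + H) + ∫ z in (0 : ℝ)..H, hmean L (fun q => F.T q ^ 2 / 2) 0 z

theorem transient_ge : 2 * (F.energyBound + H) ≤ F.transient := by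
  have h1 : 0 ≤ ∫ z in (0 : ℝ)..H, hmean L (fun q => F.T q ^ 2 / 2) 0 z :=
    intervalIntegral.integral_nonneg F.hH.le fun z _ =>
      hmean_nonneg F.hL (fun q => by positivity) _ _
  unfold transient
  linarith

theorem integral_heatFlux_le {z t₀ : ℝ} (hz : z ∈ Icc 0 H) (ht₀ : 0 ≤ t₀) :
    ∫ t in (0 : ℝ)..t₀, F.heatFlux t z ≤ (∫ t in (0 : ℝ)..t₀, F.heatFlux t 0) + F.transient := by
  have h1 := (abs_le.1 (F.abs_integral_heatFlux_sub_le hz ht₀)).2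
  have h2 := F.transient_ge
  linarith

theorem integral_dissipation_le_transient {t₀ : ℝ} (ht₀ : 0 ≤ t₀) :
    ∫ t in (0 : ℝ)..t₀, F.dissipation t
      ≤ (∫ t in (0 : ℝ)..t₀, F.heatFlux t 0) + F.transient := by
  have h1 := F.integral_dissipation_le ht₀
  have h2 := F.energyBound_nonneg
  have h3 := F.hH
  unfold transient
  linarith

/-- The time-integrated weighted convective flux is controlled by the flux through the bottom. -/
theorem integral_weightedConv_le {a ε l t₀ : ℝ} (ha : 0 < a) (haH : a ≤ H) (hε : 0 < ε) (hl : 0 < l)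
    (ht₀ : 0 ≤ t₀) :
    ∫ t in (0 : ℝ)..t₀, F.weightedConv ε t
      ≤ ((∫ t in (0 : ℝ)..t₀, F.heatFlux t 0) + F.transient)
          * (3 / 4 * a * (H + 1) + 1 + Real.log (H / a))
        + t₀ * (l / a) + (l ^ 3)⁻¹ * (a ^ 2)⁻¹ * (2 * H ^ 2 * F.excessEnergy 1 1 0) := by
  set N := (∫ t in (0 : ℝ)..t₀, F.heatFlux t 0) + F.transient with hN
  -- The heat flux has no sign, but `N` dominates the time-integrated dissipation.
  have hN0 : 0 ≤ N := (intervalIntegral.integral_nonneg ht₀ fun t _ => F.dissipation_nonneg t).trans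
    (F.integral_dissipation_le_transient ht₀)
  have hH := F.hH
  have cfl := F.continuous_heatFlux
  have cI : Continuous fun z => ∫ t in (0 : ℝ)..t₀, F.heatFlux t z :=
    intervalIntegral.continuous_parametric_intervalIntegral_of_continuous'
      (f := fun z t => F.heatFlux t z) (cfl.comp continuous_swap) 0 t₀
  have hI : ∀ z ∈ Icc 0 H, ∫ t in (0 : ℝ)..t₀, F.heatFlux t z ≤ N := fun z hz =>
    F.integral_heatFlux_le hz ht₀
  have hII : ∀ b ∈ Icc 0 H, ∫ t in (0 : ℝ)..t₀, ∫ z in (0 : ℝ)..b, F.heatFlux t z ≤ b * N :=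
    fun b hb => by
    rw [intervalIntegral_swap_of_continuous (F := F.heatFlux) cfl]
    have e1 : ∫ z in (0 : ℝ)..b, ∫ t in (0 : ℝ)..t₀, F.heatFlux t z ≤ ∫ _ in (0 : ℝ)..b, N :=
      intervalIntegral.integral_mono_on hb.1 (cI.intervalIntegrable _ _) (by simp)
        fun z hz => hI z ⟨hz.1, hz.2.trans hb.2⟩
    simpa using e1
  have c1 := F.continuous_stretching
  have c2 := F.continuous_dissipation
  have c3 : Continuous fun t => ∫ z in a..H, (z + ε)⁻¹ * F.heatFlux t z :=
    continuous_integral_weight cfl hε ha.le haH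
  have cb : ∀ b, Continuous fun t => ∫ z in (0 : ℝ)..b, F.heatFlux t z := fun b =>
    continuous_integral_hmean (F.cflux _) 0 b
  have c5 := F.continuous_excessEnergy 1 1
  have h1 : ∫ t in (0 : ℝ)..t₀, F.weightedConv ε t ≤ ∫ t in (0 : ℝ)..t₀,
      (3 / 4 * a * (F.stretching t + F.dissipation t)
      + (∫ z in a..H, (z + ε)⁻¹ * F.heatFlux t z) + (a + ε)⁻¹ * (∫ z in (0 : ℝ)..a, F.heatFlux t z)
      + l / a + (l ^ 3)⁻¹ * (a ^ 2)⁻¹ * F.excessEnergy 1 1 t) := by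
    refine intervalIntegral.integral_mono_on_of_le_Ioo ht₀
      ((F.continuous_weightedConv hε).intervalIntegrable _ _)
      (Continuous.intervalIntegrable ?_ _ _) fun t ht => F.weightedConv_le ha haH hε hl ht.1
    exact ((((c1.add c2).const_mul _).add c3).add ((cb a).const_mul _)).add continuous_const |>.add
      (c5.const_mul _)
  have i1 := c1.intervalIntegrable (μ := volume) 0 t₀
  have i2 := c2.intervalIntegrable (μ := volume) 0 t₀
  have i3 := c3.intervalIntegrable (μ := volume) 0 t₀
  have i4 := (cb a).intervalIntegrable (μ := volume) 0 t₀
  have i5 := c5.intervalIntegrable (μ := volume) 0 t₀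
  have j1 := (i1.add i2).const_mul (3 / 4 * a)
  have j4 := i4.const_mul ((a + ε)⁻¹)
  have j5 := i5.const_mul ((l ^ 3)⁻¹ * (a ^ 2)⁻¹)
  have j0 : IntervalIntegrable (fun _ : ℝ => l / a) volume 0 t₀ := by simp
  have h2 : ∫ t in (0 : ℝ)..t₀,
      (3 / 4 * a * (F.stretching t + F.dissipation t)
      + (∫ z in a..H, (z + ε)⁻¹ * F.heatFlux t z) + (a + ε)⁻¹ * (∫ z in (0 : ℝ)..a, F.heatFlux t z)
      + l / a + (l ^ 3)⁻¹ * (a ^ 2)⁻¹ * F.excessEnergy 1 1 t)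
      = 3 / 4 * a * ((∫ t in (0 : ℝ)..t₀, F.stretching t) + ∫ t in (0 : ℝ)..t₀, F.dissipation t)
        + (∫ t in (0 : ℝ)..t₀, ∫ z in a..H, (z + ε)⁻¹ * F.heatFlux t z)
        + (a + ε)⁻¹ * (∫ t in (0 : ℝ)..t₀, ∫ z in (0 : ℝ)..a, F.heatFlux t z)
        + t₀ * (l / a) + (l ^ 3)⁻¹ * (a ^ 2)⁻¹ * ∫ t in (0 : ℝ)..t₀, F.excessEnergy 1 1 t := by
    rw [intervalIntegral.integral_add (((j1.add i3).add j4).add j0) j5,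
      intervalIntegral.integral_add ((j1.add i3).add j4) j0,
      intervalIntegral.integral_add (j1.add i3) j4, intervalIntegral.integral_add j1 i3,
      intervalIntegral.integral_const_mul, intervalIntegral.integral_add i1 i2,
      intervalIntegral.integral_const_mul, intervalIntegral.integral_const_mul]
    simp only [intervalIntegral.integral_const, smul_eq_mul, sub_zero]
  have h3 : ∫ t in (0 : ℝ)..t₀, F.stretching t ≤ H * N :=
    (intervalIntegral.integral_mono_on_of_le_Ioo ht₀ i1 ((cb H).intervalIntegrable _ _)
      fun t ht => F.stretching_le ht.1).trans (hII H ⟨hH.le, le_rfl⟩)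
  have h4 := F.integral_dissipation_le_transient ht₀
  have h5 : ∫ t in (0 : ℝ)..t₀, ∫ z in a..H, (z + ε)⁻¹ * F.heatFlux t z ≤ Real.log (H / a) * N := by
    rw [integral_weight_swap (K := F.heatFlux) cfl hε ha.le haH]
    have cg : ContinuousOn (fun z : ℝ => (z + ε)⁻¹) (Icc a H) :=
      (StokesSlice.continuousOn_weight hε).mono (Icc_subset_Icc_left ha.le)
    have e1 : ∫ z in a..H, (z + ε)⁻¹ * ∫ t in (0 : ℝ)..t₀, F.heatFlux t z
        ≤ ∫ z in a..H, (z + ε)⁻¹ * N := by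
      refine intervalIntegral.integral_mono_on haH
        ((cg.mul cI.continuousOn).intervalIntegrable_of_Icc haH)
        ((cg.mul continuousOn_const).intervalIntegrable_of_Icc haH) fun z hz => ?_
      have : 0 < z + ε := by linarith [hz.1]
      have := hI z ⟨ha.le.trans hz.1, hz.2⟩
      gcongr
    rw [intervalIntegral.integral_mul_const] at e1
    exact e1.trans (mul_le_mul_of_nonneg_right (integral_weight_le_log hε ha haH) hN0)
  have h6 : (a + ε)⁻¹ * (∫ t in (0 : ℝ)..t₀, ∫ z in (0 : ℝ)..a, F.heatFlux t z) ≤ N := by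
    rw [inv_mul_le_iff₀ (by positivity)]
    have := hII a ⟨ha.le, haH⟩
    nlinarith
  have h7 : (l ^ 3)⁻¹ * (a ^ 2)⁻¹ * (∫ t in (0 : ℝ)..t₀, F.excessEnergy 1 1 t)
      ≤ (l ^ 3)⁻¹ * (a ^ 2)⁻¹ * (2 * H ^ 2 * F.excessEnergy 1 1 0) := by
    gcongr
    exact F.integral_excessEnergy_le (by norm_num) excess_one_one_zero excess_one_one_one ht₀
  have h8 : 3 / 4 * a * ((∫ t in (0 : ℝ)..t₀, F.stretching t) + ∫ t in (0 : ℝ)..t₀, F.dissipation t)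
      ≤ 3 / 4 * a * (H * N + N) := by gcongr
  rw [h2] at h1
  linarith

end Flow

end RayleighBenard

end

noncomputable section

namespace RayleighBenard

/-! ### Upper limits of time averages -/

/-- No boundedness is needed: the sets of eventual upper bounds of `f` and `g` are empty, or
unbounded below, simultaneously, and in those cases both upper limits take the default value `0`. -/
theorem limsup_eq_of_tendsto_sub {ι : Type*} {l : Filter ι} {f g : ι → ℝ}
    (h : Tendsto (fun t => f t - g t) l (𝓝 0)) : limsup f l = limsup g l := by
  have key : ∀ {f g : ι → ℝ}, Tendsto (fun t => f t - g t) l (𝓝 0) →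
      ∀ a, (∀ᶠ t in l, f t ≤ a) → ∀ ε > 0, ∀ᶠ t in l, g t ≤ a + ε := fun h a ha ε hε => by
    filter_upwards [ha, h.eventually (lt_mem_nhds (neg_lt_zero.2 hε))] with t h1 h2
    linarith
  have h' : Tendsto (fun t => g t - f t) l (𝓝 0) := by simpa using h.neg
  have le : ∀ {f g : ι → ℝ}, Tendsto (fun t => f t - g t) l (𝓝 0) →
      Tendsto (fun t => g t - f t) l (𝓝 0) → limsup f l ≤ limsup g l := fun {f g} h h' => by
    rw [limsup_eq, limsup_eq]
    rcases Set.eq_empty_or_nonempty {a | ∀ᶠ t in l, g t ≤ a} with hg | hg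
    · have hf : {a | ∀ᶠ t in l, f t ≤ a} = ∅ := by
        refine Set.eq_empty_of_forall_notMem fun a ha => ?_
        have : a + 1 ∈ {a | ∀ᶠ t in l, g t ≤ a} := key h a ha 1 one_pos
        rw [hg] at this
        exact this
      rw [hf, hg]
    · by_cases hb : BddBelow {a | ∀ᶠ t in l, f t ≤ a}
      · refine le_csInf hg fun a ha => le_of_forall_pos_le_add fun ε hε => ?_
        exact csInf_le hb (key h' a ha ε hε)
      · have hb' : ¬BddBelow {a | ∀ᶠ t in l, g t ≤ a} := fun ⟨m, hm⟩ => by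
          refine hb ⟨m - 1, fun a ha => ?_⟩
          have := hm (key h a ha 1 one_pos)
          linarith
        rw [Real.sInf_of_not_bddBelow hb, Real.sInf_of_not_bddBelow hb']
  exact le_antisymm (le h h') (le h' h)

/-- Positivity of the upper limit excludes the default value `0` attached to a function with no
eventual upper bound. This is where `Nu ≥ c > 0` becomes an actual bound on the flux. -/
theorem eventually_le_of_limsup_lt {ι : Type*} {l : Filter ι} {f : ι → ℝ} {K : ℝ}
    (h0 : 0 < limsup f l) (h : limsup f l < K) : ∀ᶠ t in l, f t ≤ K := by
  rw [limsup_eq] at h0 h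
  have hne : {a | ∀ᶠ t in l, f t ≤ a}.Nonempty := by
    by_contra! he
    rw [he, Real.sInf_empty] at h0
    exact lt_irrefl _ h0
  obtain ⟨a, ha, haK⟩ := exists_lt_of_csInf_lt hne h
  filter_upwards [ha] with t ht
  exact ht.trans haK.le

theorem limsup_le_of_eventually_le {f : ℝ → ℝ} {K : ℝ} (h0 : ∀ᶠ t in atTop, 0 ≤ f t)
    (h : ∀ᶠ t in atTop, f t ≤ K) : limsup f atTop ≤ K :=
  limsup_le_of_le (IsBoundedUnder.isCoboundedUnder_le ⟨0, eventually_map.2 h0⟩) h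

theorem limsup_nonneg_of_eventually {f : ℝ → ℝ} {K : ℝ} (h0 : ∀ᶠ t in atTop, 0 ≤ f t)
    (h : ∀ᶠ t in atTop, f t ≤ K) : 0 ≤ limsup f atTop :=
  le_limsup_of_frequently_le h0.frequently ⟨K, eventually_map.2 h⟩

/-- The upper limit of a family of continuous functions is measurable where it is bounded. -/
theorem aestronglyMeasurable_limsup {A : ℝ → ℝ → ℝ} (hA : ∀ t, Continuous fun z => A z t) {K : ℝ}
    {s : Set ℝ} (hs : MeasurableSet s) (h0 : ∀ z ∈ s, ∀ᶠ t in atTop, 0 ≤ A z t)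
    (h : ∀ z ∈ s, ∀ᶠ t in atTop, A z t ≤ K) :
    AEStronglyMeasurable (fun z => limsup (A z) atTop) (volume.restrict s) := by
  have h1 : Measurable fun z => limsup (fun t => ENNReal.ofReal (A z t)) atTop := by
    -- A countable infimum of suprema over half-lines; each supremum is uncountable, but lower
    -- semicontinuous in `z` and so measurable.
    have e : ∀ z, limsup (fun t => ENNReal.ofReal (A z t)) atTop
        = ⨅ m : ℕ, ⨆ t ∈ Ici (m : ℝ), ENNReal.ofReal (A z t) := fun z => by
      simpa using (atTop_hasAntitoneBasis_of_archimedean (R := ℝ)).1.limsup_eq_iInf_iSup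
        (u := fun t => ENNReal.ofReal (A z t))
    simp only [e]
    exact Measurable.iInf fun m => (lowerSemicontinuous_biSup fun t _ =>
      (ENNReal.continuous_ofReal.comp (hA t)).lowerSemicontinuous).measurable
  refine (h1.ennreal_toReal.aestronglyMeasurable).congr ?_
  filter_upwards [ae_restrict_mem hs] with z hz
  rw [← ENNReal.limsup_toReal_eq (b := ENNReal.ofReal K) ENNReal.ofReal_ne_top]
  · refine limsup_congr ?_
    filter_upwards [h0 z hz] with t ht
    exact ENNReal.toReal_ofReal ht
  · filter_upwards [h z hz] with t ht
    exact ENNReal.ofReal_le_ofReal ht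

/-- A form of Fatou's lemma for averages that converge almost everywhere. -/
theorem integrable_of_tendsto_of_integral_le {A : ℝ → ℝ → ℝ} (hA : ∀ t, Continuous fun z => A z t)
    {g : ℝ → ℝ} {δ K : ℝ} (hδ : 0 ≤ δ) (hK : 0 ≤ K)
    (hlim : ∀ᵐ z ∂(volume.restrict (Ioo 0 δ)), Tendsto (A z) atTop (𝓝 (g z)))
    (h0' : ∀ t, 0 < t → ∀ z, 0 ≤ A z t)
    (hle : ∀ᶠ t in atTop, ∫ z in (0 : ℝ)..δ, A z t ≤ K) :
    IntervalIntegrable g volume 0 δ ∧ ∫ z in (0 : ℝ)..δ, g z ≤ K := by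
  have hm : AEStronglyMeasurable g (volume.restrict (Ioo 0 δ)) :=
    aestronglyMeasurable_of_tendsto_ae atTop (fun t => (hA t).aestronglyMeasurable) hlim
  have h1 : ∫⁻ z in Ioo 0 δ, ENNReal.ofReal (g z) ≤ ENNReal.ofReal K := by
    calc ∫⁻ z in Ioo 0 δ, ENNReal.ofReal (g z)
        = ∫⁻ z in Ioo 0 δ, liminf (fun t => ENNReal.ofReal (A z t)) atTop := by
          refine lintegral_congr_ae ?_
          filter_upwards [hlim] with z hz
          exact ((ENNReal.continuous_ofReal.tendsto _).comp hz).liminf_eq.symm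
      _ ≤ liminf (fun t => ∫⁻ z in Ioo 0 δ, ENNReal.ofReal (A z t)) atTop :=
          lintegral_liminf_le fun t => (ENNReal.continuous_ofReal.comp (hA t)).measurable
      _ ≤ ENNReal.ofReal K := by
          refine (liminf_le_limsup).trans (limsup_le_of_le (by isBoundedDefault) ?_)
          filter_upwards [hle, Ioi_mem_atTop 0] with t ht ht0
          rw [← ofReal_integral_eq_lintegral_ofReal
            (((hA t).continuousOn.integrableOn_compact isCompact_Icc).mono_set Ioo_subset_Icc_self)
            (ae_of_all _ (h0' t ht0)), ← integral_Ioc_eq_integral_Ioo,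
            ← intervalIntegral.integral_of_le hδ]
          exact ENNReal.ofReal_le_ofReal ht
  have hg0 : 0 ≤ᵐ[volume.restrict (Ioo 0 δ)] g := by
    filter_upwards [hlim] with z hz
    refine ge_of_tendsto hz ?_
    filter_upwards [Ioi_mem_atTop 0] with t ht0
    exact h0' t ht0 z
  have hi : IntegrableOn g (Ioo 0 δ) :=
    ⟨hm, (hasFiniteIntegral_iff_ofReal hg0).2 (h1.trans_lt ENNReal.ofReal_lt_top)⟩
  refine ⟨(intervalIntegrable_iff_integrableOn_Ioo_of_le hδ).2 hi, ?_⟩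
  rw [intervalIntegral.integral_of_le hδ, integral_Ioc_eq_integral_Ioo,
    integral_eq_lintegral_of_nonneg_ae hg0 hm]
  exact ENNReal.toReal_le_of_le_ofReal hK h1

variable {n : ℕ} {L H : ℝ}

/-- The time average of a horizontal average. -/
def tmean (L : ℝ) (G : ℝ × Space n → ℝ) (z t₀ : ℝ) : ℝ :=
  1 / t₀ * ∫ t in (0 : ℝ)..t₀, hmean L G t z

theorem continuous_tmean {G : ℝ × Space n → ℝ} (hG : Continuous G) (t₀ : ℝ) :
    Continuous fun z => tmean L G z t₀ :=
  (intervalIntegral.continuous_parametric_intervalIntegral_of_continuous'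
    (f := fun z t => hmean L G t z) ((continuous_hmean hG).comp continuous_swap) 0 t₀).const_mul _

theorem integral_tmean {G : ℝ × Space n → ℝ} (hG : Continuous G) (a b t₀ : ℝ) :
    ∫ z in a..b, tmean L G z t₀ = 1 / t₀ * ∫ t in (0 : ℝ)..t₀, ∫ z in a..b, hmean L G t z := by
  rw [intervalIntegral_swap_of_continuous (F := hmean L G) (continuous_hmean hG)]
  simp only [tmean, intervalIntegral.integral_const_mul]

theorem tmean_nonneg (hL : 0 < L) {G : ℝ × Space n → ℝ} (h : ∀ q, 0 ≤ G q) {t₀ : ℝ} (ht₀ : 0 < t₀)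
    (z : ℝ) : 0 ≤ tmean L G z t₀ :=
  mul_nonneg (by positivity) (intervalIntegral.integral_nonneg ht₀.le fun t _ => hmean_nonneg hL h t z)

theorem timeAvg_eq_tmean {f : ℝ → Space n → ℝ} {G : ℝ × Space n → ℝ}
    (hfG : ∀ t, 0 ≤ t → ∀ y, ∀ z ∈ Ioo 0 H, f t (y, z) = G (t, (y, z))) {z t₀ : ℝ}
    (hz : z ∈ Ioo 0 H) (ht₀ : 0 ≤ t₀) :
    timeAvg L (fun t (y : Fin n → ℝ) => f t (y, z)) t₀ = tmean L G z t₀ := by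
  rw [timeAvg, tmean]
  congr 1
  refine StokesMode.integral_congr_Ioo ht₀ fun t ht => ?_
  exact mean_congr fun y => hfG t ht.1.le y z hz

theorem timeAvg_integral_eq {f : ℝ → Space n → ℝ} {G : ℝ × Space n → ℝ} (hG : Continuous G)
    (hfG : ∀ t, 0 ≤ t → ∀ y, ∀ z ∈ Ioo 0 H, f t (y, z) = G (t, (y, z))) {δ t₀ : ℝ}
    (hδ : 0 ≤ δ) (hδH : δ ≤ H) (ht₀ : 0 ≤ t₀) :
    timeAvg L (fun t (y : Fin n → ℝ) => ∫ z in (0 : ℝ)..δ, f t (y, z)) t₀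
      = 1 / t₀ * ∫ t in (0 : ℝ)..t₀, ∫ z in (0 : ℝ)..δ, hmean L G t z := by
  rw [timeAvg]
  congr 1
  refine StokesMode.integral_congr_Ioo ht₀ fun t ht => ?_
  rw [intervalIntegral_hmean hG]
  exact mean_congr fun y => StokesMode.integral_congr_Ioo hδ fun z hz =>
    hfG t ht.1.le y z ⟨hz.1, hz.2.trans_le hδH⟩

theorem avg_eq_limsup_tmean {f : ℝ → Space n → ℝ} {G : ℝ × Space n → ℝ}
    (hfG : ∀ t, 0 ≤ t → ∀ y, ∀ z ∈ Ioo 0 H, f t (y, z) = G (t, (y, z))) {z : ℝ} (hz : z ∈ Ioo 0 H) :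
    avg L (fun t (y : Fin n → ℝ) => f t (y, z)) = limsup (tmean L G z) atTop := by
  refine limsup_congr ?_
  filter_upwards [Ici_mem_atTop 0] with t₀ ht₀
  exact timeAvg_eq_tmean hfG hz ht₀

end RayleighBenard

end

noncomputable section

namespace RayleighBenard

/-! ### Velocity gradients -/

variable {n : ℕ} {L H : ℝ}

namespace Flow

variable (F : Flow n L H)

/-- The squared horizontal gradient of the horizontal velocity. -/
def gradV (q : ℝ × Space n) : ℝ := ∑ i, ∑ j, pd H (eY j) (F.v i) q ^ 2

/-- The squared gradient of the vertical velocity. -/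
def gradW (q : ℝ × Space n) : ℝ := (∑ j, pd H (eY j) F.w q ^ 2) + F.wz q ^ 2

/-- The squared vertical derivative of the horizontal velocity. -/
def shear (q : ℝ × Space n) : ℝ := ∑ i, pd H (eZ n) (F.v i) q ^ 2

theorem continuous_gradV : Continuous F.gradV :=
  continuous_finsetSum _ fun i _ => continuous_finsetSum _ fun _ _ =>
    (continuous_pd F.hH ((F.sv i).of_le one_le_two) _).pow 2

theorem continuous_gradW : Continuous F.gradW :=
  (continuous_finsetSum _ fun _ _ => (continuous_pd F.hH (F.sw.of_le one_le_two) _).pow 2).add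
    (F.cwz.pow 2)

theorem continuous_shear : Continuous F.shear :=
  continuous_finsetSum _ fun i _ => (continuous_pd F.hH ((F.sv i).of_le one_le_two) _).pow 2

theorem gradV_nonneg (q : ℝ × Space n) : 0 ≤ F.gradV q := by
  unfold gradV
  positivity

theorem gradW_nonneg (q : ℝ × Space n) : 0 ≤ F.gradW q := by
  unfold gradW
  positivity

theorem shear_nonneg (q : ℝ × Space n) : 0 ≤ F.shear q := by
  unfold shear
  positivity

/-- The weight with `ε = δ` is at least `1 / (2 δ)` on `(0, δ)`; the remaining factor 2 comes from
the weighted energy estimate. -/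
theorem integral_gradient_le {δ t : ℝ} (hδ : 0 < δ) (hδH : δ ≤ H) (ht : 0 < t) :
    ∫ z in (0 : ℝ)..δ, hmean L (fun q => F.gradV q + F.gradW q) t z ≤ 4 * δ * F.weightedConv δ t := by
  have c : Continuous fun q => F.gradV q + F.gradW q := F.continuous_gradV.add F.continuous_gradW
  have cz := continuous_hmean_z (L := L) c t
  have h0 : ∀ z, 0 ≤ hmean L (fun q => F.gradV q + F.gradW q) t z :=
    hmean_nonneg F.hL (fun q => add_nonneg (F.gradV_nonneg q) (F.gradW_nonneg q)) t
  have h1 : ∫ z in (0 : ℝ)..H, (z + δ)⁻¹ * hmean L (fun q => F.gradV q + F.gradW q) t z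
      ≤ 2 * F.weightedConv δ t := (F.stokes ht).weighted_energy F.hL F.hH hδ
  have cg : ContinuousOn (fun z => (z + δ)⁻¹ * hmean L (fun q => F.gradV q + F.gradW q) t z)
      (Icc 0 H) := (StokesSlice.continuousOn_weight hδ).mul cz.continuousOn
  have h2 : ∫ z in (0 : ℝ)..δ, hmean L (fun q => F.gradV q + F.gradW q) t z
      ≤ ∫ z in (0 : ℝ)..δ, 2 * δ * ((z + δ)⁻¹ * hmean L (fun q => F.gradV q + F.gradW q) t z) := by
    refine intervalIntegral.integral_mono_on hδ.le (cz.intervalIntegrable _ _)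
      (((cg.mono (Icc_subset_Icc_right hδH)).intervalIntegrable_of_Icc hδ.le).const_mul _) fun z hz => ?_
    have e1 : 1 ≤ 2 * δ * (z + δ)⁻¹ := by
      rw [← div_eq_mul_inv, one_le_div (by linarith [hz.1])]
      linarith [hz.2]
    nlinarith [mul_le_mul_of_nonneg_right e1 (h0 z)]
  have h3 : ∫ z in (0 : ℝ)..δ, (z + δ)⁻¹ * hmean L (fun q => F.gradV q + F.gradW q) t z
      ≤ ∫ z in (0 : ℝ)..H, (z + δ)⁻¹ * hmean L (fun q => F.gradV q + F.gradW q) t z := by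
    refine intervalIntegral.integral_mono_interval le_rfl hδ.le hδH ?_
      (cg.intervalIntegrable_of_Icc F.hH.le)
    filter_upwards [ae_restrict_mem measurableSet_Ioc] with z hz
    have : 0 < z + δ := by linarith [hz.1]
    exact mul_nonneg (by positivity) (h0 z)
  rw [intervalIntegral.integral_const_mul] at h2
  nlinarith

/-- Long-time bounds for a flow whose mean heat flux has the upper limit `ν`. -/
theorem eventually_weightedConv_le {ν : ℝ} (hν : 0 < ν) (hH : Real.exp 1 ≤ H)
    (hN : ∀ᶠ t₀ in atTop, ∫ t in (0 : ℝ)..t₀, F.heatFlux t 0 ≤ 2 * ν * t₀) :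
    ∀ᶠ t₀ in atTop, ∀ ε, 0 < ε → ∫ t in (0 : ℝ)..t₀, F.weightedConv ε t
      ≤ 16 * ν * Real.log H * t₀ := by
  have hH1 : 1 ≤ H := (Real.one_le_exp zero_le_one).trans hH
  have hlog : 1 ≤ Real.log H := (Real.le_log_iff_exp_le F.hH).2 hH
  have hH0 := F.hH
  set K := ((ν / H) ^ 3)⁻¹ * ((1 / H) ^ 2)⁻¹ * (2 * H ^ 2 * F.excessEnergy 1 1 0) with hK
  filter_upwards [hN, eventually_ge_atTop (F.transient / ν), eventually_ge_atTop (K / ν),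
    eventually_ge_atTop 0] with t₀ h1 h2 h3 ht₀ ε hε
  rw [div_le_iff₀ hν] at h2 h3
  -- `a = 1 / H` makes the wall contribution `a (H + 1)` bounded and the logarithm `2 log H`; `l = ν
  -- / H` makes `l / a = ν`. The transient constants are at most `ν t₀` for late times.
  have h4 := F.integral_weightedConv_le (a := 1 / H) (l := ν / H) (by positivity)
    ((div_le_one hH0).2 hH1 |>.trans hH1) hε (by positivity) ht₀
  have e1 : Real.log (H / (1 / H)) = 2 * Real.log H := by
    rw [div_div_eq_mul_div, div_one, Real.log_mul hH0.ne' hH0.ne']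
    ring
  have e2 : ν / H / (1 / H) = ν := by field_simp
  have e3 : 3 / 4 * (1 / H) * (H + 1) ≤ 3 / 2 := by
    rw [mul_one_div, div_mul_eq_mul_div, div_le_iff₀ hH0]
    linarith
  rw [e1, e2, ← hK] at h4
  set N := (∫ t in (0 : ℝ)..t₀, F.heatFlux t 0) + F.transient with hNd
  have hN0 : 0 ≤ N := (intervalIntegral.integral_nonneg ht₀ fun t _ => F.dissipation_nonneg t).trans
    (F.integral_dissipation_le_transient ht₀)
  have h5 : N ≤ 3 * ν * t₀ := by linarith
  -- As `log H ≥ 1`, the bracket is at most `9/2 · log H`. With `ν t₀` each from `l / a` and from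
  -- the excess, the total is `27/2 + 2 ≤ 16`.
  have h6 : N * (3 / 4 * (1 / H) * (H + 1) + 1 + 2 * Real.log H)
      ≤ 3 * ν * t₀ * (9 / 2 * Real.log H) :=
    mul_le_mul h5 (by linarith) (by positivity) (by positivity)
  have h7 : ν * t₀ ≤ ν * t₀ * Real.log H := le_mul_of_one_le_right (by positivity) hlog
  have h8 : 0 ≤ ν * t₀ := by positivity
  linarith

theorem eventually_gradient_le {ν δ : ℝ} (hν : 0 < ν) (hH : Real.exp 1 ≤ H)
    (hN : ∀ᶠ t₀ in atTop, ∫ t in (0 : ℝ)..t₀, F.heatFlux t 0 ≤ 2 * ν * t₀) (hδ : 0 ≤ δ)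
    (hδH : δ ≤ H) {G : ℝ × Space n → ℝ} (hG : Continuous G) (hle : ∀ q, G q ≤ F.gradV q + F.gradW q) :
    ∀ᶠ t₀ in atTop, 1 / t₀ * ∫ t in (0 : ℝ)..t₀, ∫ z in (0 : ℝ)..δ, hmean L G t z
      ≤ 64 * δ * Real.log H * ν := by
  rcases hδ.eq_or_lt with rfl | hδ
  · simp
  filter_upwards [F.eventually_weightedConv_le hν hH hN, eventually_gt_atTop 0] with t₀ h1 ht₀
  have c : Continuous fun q => F.gradV q + F.gradW q := F.continuous_gradV.add F.continuous_gradW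
  have h2 : ∫ t in (0 : ℝ)..t₀, ∫ z in (0 : ℝ)..δ, hmean L G t z
      ≤ ∫ t in (0 : ℝ)..t₀, 4 * δ * F.weightedConv δ t := by
    refine intervalIntegral.integral_mono_on_of_le_Ioo ht₀.le
      ((continuous_integral_hmean hG 0 δ).intervalIntegrable _ _)
      (((F.continuous_weightedConv hδ).const_mul _).intervalIntegrable _ _) fun t ht => ?_
    refine le_trans ?_ (F.integral_gradient_le hδ hδH ht.1)
    exact intervalIntegral.integral_mono_on hδ.le ((continuous_hmean_z hG t).intervalIntegrable _ _)
      ((continuous_hmean_z c t).intervalIntegrable _ _) fun z _ => hmean_mono F.hL hG c fun y => hle _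
  rw [intervalIntegral.integral_const_mul] at h2
  have h3 := mul_le_mul_of_nonneg_left (h1 δ hδ) (by positivity : 0 ≤ 4 * δ)
  rw [one_div, inv_mul_le_iff₀ ht₀]
  linarith

/-- The weighted flux contributes `3000 · 16 log H · ν`, the transients at most `ν`, and the
temperature term `6 z² ≤ 6 M² log² H`, turned into a multiple of `ν` by `c ≤ ν`. All are then
weakened to `log³ H`. The starting time does not depend on `z`. -/
theorem eventually_shear_le {ν c M : ℝ} (hc : 0 < c) (hν : c ≤ ν) (hM : 0 < M) (hH : Real.exp 1 ≤ H)
    (hN : ∀ᶠ t₀ in atTop, ∫ t in (0 : ℝ)..t₀, F.heatFlux t 0 ≤ 2 * ν * t₀)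
    (hMH : 2 * (M * Real.log H) ≤ H) :
    ∀ᶠ t₀ in atTop, ∀ z, 0 < z → z ≤ M * Real.log H →
      tmean L F.shear z t₀ ≤ (48001 + 6 * M ^ 2 / c) * Real.log H ^ 3 * ν := by
  have hν0 : 0 < ν := hc.trans_le hν
  have hlog : 1 ≤ Real.log H := (Real.le_log_iff_exp_le F.hH).2 hH
  have hH0 := F.hH
  set E := 2 * H ^ 2 * (F.excessEnergy 1 1 0 + F.excessEnergy (-1) 0 0) with hE
  have hE0 : 0 ≤ E := by
    have := F.excessEnergy_nonneg 1 1 0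
    have := F.excessEnergy_nonneg (-1) 0 0
    positivity
  filter_upwards [F.eventually_weightedConv_le hν0 hH hN, eventually_gt_atTop 0,
    eventually_ge_atTop (H * E / ν)] with t₀ h1 ht₀ h2 z hz hzM
  rw [div_le_iff₀ hν0] at h2
  have hzH : 2 * z ≤ H := by linarith
  have c1 := F.continuous_weightedConv hz
  have c2 : Continuous fun t => ∫ s in (0 : ℝ)..(2 * z), hmean L (fun q => F.T q ^ 2) t s :=
    continuous_integral_hmean (F.cT.pow 2) 0 (2 * z)
  have h3 : ∫ t in (0 : ℝ)..t₀, hmean L F.shear t z ≤ ∫ t in (0 : ℝ)..t₀,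
      (3000 * F.weightedConv z t
        + z * ∫ s in (0 : ℝ)..(2 * z), hmean L (fun q => F.T q ^ 2) t s) :=
    intervalIntegral.integral_mono_on_of_le_Ioo ht₀.le
      ((continuous_hmean_t F.continuous_shear z).intervalIntegrable _ _)
      (((c1.const_mul _).add (c2.const_mul _)).intervalIntegrable _ _)
      fun t ht => (F.stokes ht.1).pointwise F.hL F.hH hz hzH
  rw [intervalIntegral.integral_add ((c1.const_mul _).intervalIntegrable _ _)
    ((c2.const_mul _).intervalIntegrable _ _), intervalIntegral.integral_const_mul,
    intervalIntegral.integral_const_mul] at h3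
  have i1 := (F.continuous_excessEnergy 1 1).intervalIntegrable (μ := volume) 0 t₀
  have i2 := (F.continuous_excessEnergy (-1) 0).intervalIntegrable (μ := volume) 0 t₀
  have i0 : IntervalIntegrable (fun _ : ℝ => 3 * (2 * z)) volume 0 t₀ := by simp
  have h4 : ∫ t in (0 : ℝ)..t₀, ∫ s in (0 : ℝ)..(2 * z), hmean L (fun q => F.T q ^ 2) t s
      ≤ 6 * z * t₀ + E := by
    have e1 := intervalIntegral.integral_mono_on ht₀.le (c2.intervalIntegrable _ _) ((i0.add i1).add i2)
      fun t _ => F.integral_sq_T_le (by positivity) hzH t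
    rw [intervalIntegral.integral_add (i0.add i1) i2, intervalIntegral.integral_add i0 i1,
      intervalIntegral.integral_const, smul_eq_mul] at e1
    have e2 := F.integral_excessEnergy_le (by norm_num) excess_one_one_zero excess_one_one_one ht₀.le
    have e3 := F.integral_excessEnergy_le (by norm_num) excess_neg_zero excess_neg_one ht₀.le
    rw [hE]
    linarith
  have h5 := mul_le_mul_of_nonneg_left h4 hz.le
  have h6 := h1 z hz
  have h7 : z * E ≤ t₀ * ν := le_trans (mul_le_mul_of_nonneg_right (by linarith) hE0) h2
  have h8 : z ^ 2 ≤ M ^ 2 * Real.log H ^ 2 := by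
    rw [← mul_pow]
    gcongr
  have h9 : 6 * (M ^ 2 * Real.log H ^ 2) ≤ 6 * M ^ 2 / c * Real.log H ^ 2 * ν := by
    have e1 : 6 * M ^ 2 = 6 * M ^ 2 / c * c := by field_simp
    calc 6 * (M ^ 2 * Real.log H ^ 2) = 6 * M ^ 2 / c * Real.log H ^ 2 * c := by
          linear_combination Real.log H ^ 2 * e1
      _ ≤ _ := by gcongr
  have l1 : Real.log H ≤ Real.log H ^ 3 := le_self_pow₀ hlog (by norm_num)
  have l2 : Real.log H ^ 2 ≤ Real.log H ^ 3 := pow_le_pow_right₀ hlog (by norm_num)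
  have l3 : 1 ≤ Real.log H ^ 3 := one_le_pow₀ hlog
  have m1 : 16 * ν * Real.log H * t₀ ≤ 16 * ν * Real.log H ^ 3 * t₀ := by gcongr
  have m2 : z * (6 * z * t₀) ≤ 6 * M ^ 2 / c * Real.log H ^ 3 * ν * t₀ := by
    calc z * (6 * z * t₀) = 6 * z ^ 2 * t₀ := by ring
      _ ≤ 6 * (M ^ 2 * Real.log H ^ 2) * t₀ := by gcongr
      _ ≤ 6 * M ^ 2 / c * Real.log H ^ 2 * ν * t₀ := by gcongr
      _ ≤ _ := by gcongr
  have m3 : t₀ * ν ≤ Real.log H ^ 3 * (t₀ * ν) := le_mul_of_one_le_left (by positivity) l3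
  rw [tmean, one_div, inv_mul_le_iff₀ ht₀]
  linarith

/-- The heat stored between two heights stays bounded, so the averaged fluxes differ by `O(1 / t₀)`.
-/
theorem limsup_tmean_flux {z : ℝ} (hz : z ∈ Icc 0 H) :
    limsup (tmean L (F.flux C2Fun.id) z) atTop = limsup (tmean L (F.flux C2Fun.id) 0) atTop := by
  refine limsup_eq_of_tendsto_sub ?_
  have h1 : Tendsto (fun t₀ : ℝ => 2 * (F.energyBound + H) / t₀) atTop (𝓝 0) :=
    tendsto_const_nhds.div_atTop tendsto_id
  refine squeeze_zero_norm' ?_ h1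
  filter_upwards [eventually_gt_atTop 0] with t₀ ht₀
  rw [tmean, tmean, ← mul_sub, norm_mul, Real.norm_eq_abs, Real.norm_eq_abs,
    abs_of_pos (by positivity : 0 < 1 / t₀), one_div_mul_eq_div]
  gcongr
  exact F.abs_integral_heatFlux_sub_le hz ht₀.le

end Flow

/-! ### Long-time averages of a classical solution. -/

section OfSolution

variable {T : ℝ → Space n → ℝ} {v : ℝ → Fin n → Space n → ℝ} {w p : ℝ → Space n → ℝ}

/-- The long-time flux is the same at every height, so averaging over the layer changes nothing. -/
theorem IsSolution.nusselt_eq (hH : 0 < H) (hL : 0 < L) (h : IsSolution n L H T v w p) :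
    nusselt L H T w
      = limsup (tmean L ((h.toFlow hH hL).flux C2Fun.id) 0) atTop := by
  have h1 : ∫ z in (0 : ℝ)..H, avg L (fun t (y : Fin n → ℝ) => w t (y, z) * T t (y, z) - dZ (T t) (y, z))
      = ∫ _ in (0 : ℝ)..H, limsup (tmean L ((h.toFlow hH hL).flux C2Fun.id) 0) atTop := by
    refine StokesMode.integral_congr_Ioo hH.le fun z hz => ?_
    rw [← (h.toFlow hH hL).limsup_tmean_flux (Ioo_subset_Icc_self hz)]
    refine avg_eq_limsup_tmean (f := fun t x => w t x * T t x - dZ (T t) x) (fun t ht y z hz => ?_) hz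
    have hz' := Ioo_subset_Icc_self hz
    have hd := (contDiffOn_ext h.regular_T).differentiableOn two_ne_zero
    rw [dZ_ext hd ht y hz, ← ext_eq (f := w) ht hz', ← ext_eq (f := T) ht hz']
    simp [Flow.flux, C2Fun.id, IsSolution.toFlow, Flow.Tz]
  rw [nusselt, h1, intervalIntegral.integral_const, smul_eq_mul, sub_zero]
  field_simp

theorem IsSolution.eventually_heatFlux_le (hH : 0 < H) (hL : 0 < L) (h : IsSolution n L H T v w p)
    (hν : 0 < nusselt L H T w) : ∀ᶠ t₀ in atTop,
      ∫ t in (0 : ℝ)..t₀, (h.toFlow hH hL).heatFlux t 0 ≤ 2 * nusselt L H T w * t₀ := by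
  have h1 := h.nusselt_eq hH hL
  have h2 := eventually_le_of_limsup_lt (h1 ▸ hν)
    (by rw [← h1]; linarith : _ < 2 * nusselt L H T w)
  filter_upwards [h2, eventually_gt_atTop 0] with t₀ h3 ht₀
  rw [tmean, one_div, inv_mul_le_iff₀ ht₀] at h3
  rw [mul_comm]
  exact h3

theorem IsSolution.gradYSq_eq (hH : 0 < H) (hL : 0 < L) (h : IsSolution n L H T v w p) (t : ℝ)
    (ht : 0 ≤ t) (y : Fin n → ℝ) (z : ℝ) (hz : z ∈ Ioo 0 H) :
    gradYSq (v t) (y, z) = (h.toFlow hH hL).gradV (t, (y, z)) := by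
  refine Finset.sum_congr rfl fun i _ => Finset.sum_congr rfl fun j _ => ?_
  have hd := (contDiffOn_ext (f := fun t => v t i) (h.regular_v i)).differentiableOn two_ne_zero
  rw [dY_ext (f := fun t => v t i) hd ht j y hz]
  rfl

theorem IsSolution.gradSq_eq (hH : 0 < H) (hL : 0 < L) (h : IsSolution n L H T v w p) (t : ℝ)
    (ht : 0 ≤ t) (y : Fin n → ℝ) (z : ℝ) (hz : z ∈ Ioo 0 H) :
    gradSq (w t) (y, z) = (h.toFlow hH hL).gradW (t, (y, z)) := by
  have hd := (contDiffOn_ext h.regular_w).differentiableOn two_ne_zero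
  rw [gradSq, dZ_ext hd ht y hz]
  simp only [dY_ext hd ht _ y hz]
  rfl

theorem IsSolution.dZSq_eq (hH : 0 < H) (hL : 0 < L) (h : IsSolution n L H T v w p) (t : ℝ)
    (ht : 0 ≤ t) (y : Fin n → ℝ) (z : ℝ) (hz : z ∈ Ioo 0 H) :
    dZSq (v t) (y, z) = (h.toFlow hH hL).shear (t, (y, z)) := by
  refine Finset.sum_congr rfl fun i _ => ?_
  have hd := (contDiffOn_ext (f := fun t => v t i) (h.regular_v i)).differentiableOn two_ne_zero
  rw [dZ_ext (f := fun t => v t i) hd ht y hz]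
  rfl

end OfSolution

/-- The average of the layer integral of a nonnegative function. -/
theorem avg_integral_le (hL : 0 < L) {f : ℝ → Space n → ℝ} {G : ℝ × Space n → ℝ} (hG : Continuous G)
    (hG0 : ∀ q, 0 ≤ G q)
    (hfG : ∀ t, 0 ≤ t → ∀ y, ∀ z ∈ Ioo 0 H, f t (y, z) = G (t, (y, z))) {δ K : ℝ}
    (hδ : 0 ≤ δ) (hδH : δ ≤ H)
    (hle : ∀ᶠ t₀ in atTop, 1 / t₀ * ∫ t in (0 : ℝ)..t₀, ∫ z in (0 : ℝ)..δ, hmean L G t z ≤ K) :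
    avg L (fun t (y : Fin n → ℝ) => ∫ z in (0 : ℝ)..δ, f t (y, z)) ≤ K := by
  refine limsup_le_of_eventually_le ?_ ?_
  · filter_upwards [eventually_gt_atTop 0] with t₀ ht₀
    rw [timeAvg_integral_eq hG hfG hδ hδH ht₀.le]
    exact mul_nonneg (by positivity) (intervalIntegral.integral_nonneg ht₀.le fun t _ =>
      intervalIntegral.integral_nonneg hδ fun z _ => hmean_nonneg hL hG0 t z)
  · filter_upwards [hle, eventually_gt_atTop 0] with t₀ h ht₀
    rwa [timeAvg_integral_eq hG hfG hδ hδH ht₀.le]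

/-- The layer integral of the averages of a nonnegative function, if these are limits. -/
theorem integral_avg_le (hL : 0 < L) {f : ℝ → Space n → ℝ} {G : ℝ × Space n → ℝ} (hG : Continuous G)
    (hG0 : ∀ q, 0 ≤ G q)
    (hfG : ∀ t, 0 ≤ t → ∀ y, ∀ z ∈ Ioo 0 H, f t (y, z) = G (t, (y, z))) {δ K : ℝ}
    (hδ : 0 ≤ δ) (hδH : δ ≤ H) (hK : 0 ≤ K) (hf : HasTimeAverages L δ f)
    (hle : ∀ᶠ t₀ in atTop, 1 / t₀ * ∫ t in (0 : ℝ)..t₀, ∫ z in (0 : ℝ)..δ, hmean L G t z ≤ K) :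
    IntervalIntegrable (fun z => avg L fun t (y : Fin n → ℝ) => f t (y, z)) volume 0 δ
      ∧ ∫ z in (0 : ℝ)..δ, avg L (fun t (y : Fin n → ℝ) => f t (y, z)) ≤ K := by
  refine integrable_of_tendsto_of_integral_le (A := tmean L G) (continuous_tmean hG) hδ hK ?_
    (fun t ht z => tmean_nonneg hL hG0 ht z) ?_
  · filter_upwards [hf, ae_restrict_mem measurableSet_Ioo] with z ⟨a, ha⟩ hz
    rw [avg, ha.limsup_eq]
    refine ha.congr' ?_
    filter_upwards [eventually_ge_atTop 0] with t₀ ht₀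
    exact timeAvg_eq_tmean hfG ⟨hz.1, hz.2.trans_le hδH⟩ ht₀
  · simpa only [integral_tmean hG] using hle

/-- The layer integral of the averages of a nonnegative function with uniformly bounded time means. -/
theorem integral_avg_le_of_uniform (hL : 0 < L) {f : ℝ → Space n → ℝ} {G : ℝ × Space n → ℝ}
    (hG : Continuous G) (hG0 : ∀ q, 0 ≤ G q)
    (hfG : ∀ t, 0 ≤ t → ∀ y, ∀ z ∈ Ioo 0 H, f t (y, z) = G (t, (y, z))) {δ K : ℝ}
    (hδ : 0 ≤ δ) (hδH : δ ≤ H) (hle : ∀ z ∈ Ioo 0 δ, ∀ᶠ t₀ in atTop, tmean L G z t₀ ≤ K) :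
    IntervalIntegrable (fun z => avg L fun t (y : Fin n → ℝ) => f t (y, z)) volume 0 δ
      ∧ ∫ z in (0 : ℝ)..δ, avg L (fun t (y : Fin n → ℝ) => f t (y, z)) ≤ δ * K := by
  have h0 : ∀ z, ∀ᶠ t₀ in atTop, 0 ≤ tmean L G z t₀ := fun z => by
    filter_upwards [eventually_gt_atTop 0] with t₀ ht₀
    exact tmean_nonneg hL hG0 ht₀ z
  have hm := aestronglyMeasurable_limsup (continuous_tmean hG) measurableSet_Ioo (fun z _ => h0 z) hle
  have heq : EqOn (fun z => avg L fun t (y : Fin n → ℝ) => f t (y, z))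
      (fun z => limsup (tmean L G z) atTop) (Ioo 0 δ) := fun z hz =>
    avg_eq_limsup_tmean hfG ⟨hz.1, hz.2.trans_le hδH⟩
  have hi : IntegrableOn (fun z => avg L fun t (y : Fin n → ℝ) => f t (y, z)) (Ioo 0 δ) := by
    refine IntegrableOn.congr_fun ?_ heq.symm measurableSet_Ioo
    refine IntegrableOn.of_bound (by simp) hm K ?_
    filter_upwards [ae_restrict_mem measurableSet_Ioo] with z hz
    rw [Real.norm_eq_abs, abs_of_nonneg (limsup_nonneg_of_eventually (h0 z) (hle z hz))]
    exact limsup_le_of_eventually_le (h0 z) (hle z hz)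
  have hi' := (intervalIntegrable_iff_integrableOn_Ioo_of_le hδ).2 hi
  refine ⟨hi', ?_⟩
  have h1 : ∫ z in (0 : ℝ)..δ, avg L (fun t (y : Fin n → ℝ) => f t (y, z)) ≤ ∫ _ in (0 : ℝ)..δ, K :=
    intervalIntegral.integral_mono_on_of_le_Ioo hδ hi' (by simp) fun z hz => by
      refine (heq hz).trans_le ?_
      exact limsup_le_of_eventually_le (h0 z) (hle z hz)
  simpa using h1

/-- `log H = 2 log √H ≤ 2 √H` and `4 M ≤ √H`. This keeps the interval `(0, 2z)` of the interior
estimate inside the layer. -/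
theorem two_mul_log_le {M : ℝ} (hM : 0 < M) (hH : 0 < H) (hMH : 16 * M ^ 2 ≤ H) :
    2 * (M * Real.log H) ≤ H := by
  have h1 := Real.log_le_sub_one_of_pos (Real.sqrt_pos.2 hH)
  rw [Real.log_sqrt hH.le] at h1
  have h2 := Real.sq_sqrt hH.le
  have h3 : 4 * M ≤ √H := Real.le_sqrt_of_sq_le (by linarith)
  nlinarith [Real.sqrt_nonneg H]

end RayleighBenard

end

theorem mainTheorem4 (n : ℕ) (c : ℝ) (hc : 0 < c) :
    (∃ C : ℝ, 0 < C ∧ ∃ H₀ : ℝ, 1 < H₀ ∧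
      ∀ (H L : ℝ), H₀ ≤ H → 0 < L →
      ∀ (T : ℝ → RayleighBenard.Space n → ℝ) (v : ℝ → Fin n → RayleighBenard.Space n → ℝ)
        (w p : ℝ → RayleighBenard.Space n → ℝ),
      RayleighBenard.IsSolution n L H T v w p → c ≤ RayleighBenard.nusselt L H T w →
      ∀ δ : ℝ, 0 ≤ δ → δ ≤ H →
        RayleighBenard.avg L
            (fun t (y : Fin n → ℝ) => ∫ z in (0 : ℝ)..δ, RayleighBenard.gradYSq (v t) (y, z))
          + RayleighBenard.avg L
            (fun t (y : Fin n → ℝ) => ∫ z in (0 : ℝ)..δ, RayleighBenard.gradSq (w t) (y, z))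
          ≤ C * δ * Real.log H * RayleighBenard.nusselt L H T w
        ∧ (RayleighBenard.HasTimeAverages L δ (fun t => RayleighBenard.gradYSq (v t)) →
            RayleighBenard.HasTimeAverages L δ (fun t => RayleighBenard.gradSq (w t)) →
            IntervalIntegrable (fun z => RayleighBenard.avg L
              fun t (y : Fin n → ℝ) => RayleighBenard.gradYSq (v t) (y, z)) volume 0 δ
            ∧ IntervalIntegrable (fun z => RayleighBenard.avg L
              fun t (y : Fin n → ℝ) => RayleighBenard.gradSq (w t) (y, z)) volume 0 δ
            ∧ (∫ z in (0 : ℝ)..δ, RayleighBenard.avg L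
                fun t (y : Fin n → ℝ) => RayleighBenard.gradYSq (v t) (y, z))
              + (∫ z in (0 : ℝ)..δ, RayleighBenard.avg L
                fun t (y : Fin n → ℝ) => RayleighBenard.gradSq (w t) (y, z))
              ≤ C * δ * Real.log H * RayleighBenard.nusselt L H T w))
    ∧ (∀ M : ℝ, 0 < M → ∃ C : ℝ, 0 < C ∧ ∃ H₀ : ℝ, 1 < H₀ ∧
      ∀ (H L : ℝ), H₀ ≤ H → 0 < L →
      ∀ (T : ℝ → RayleighBenard.Space n → ℝ) (v : ℝ → Fin n → RayleighBenard.Space n → ℝ)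
        (w p : ℝ → RayleighBenard.Space n → ℝ),
      RayleighBenard.IsSolution n L H T v w p → c ≤ RayleighBenard.nusselt L H T w →
      ∀ δ : ℝ, 1 / H ≤ M * δ → δ ≤ M * Real.log H →
        IntervalIntegrable (fun z => RayleighBenard.avg L
          fun t (y : Fin n → ℝ) => RayleighBenard.dZSq (v t) (y, z)) volume 0 δ
        ∧ (∫ z in (0 : ℝ)..δ, RayleighBenard.avg L
            fun t (y : Fin n → ℝ) => RayleighBenard.dZSq (v t) (y, z))
          ≤ C * δ * Real.log H ^ 3 * RayleighBenard.nusselt L H T w) := by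
  have he : 1 < Real.exp 1 := Real.one_lt_exp_iff.2 one_pos
  -- `128` is `4 · 16` for each of the two gradients. `H ≥ e` gives `log H ≥ 1`, and `H ≥ 16 M²`
  -- gives `2 M log H ≤ H`.
  refine ⟨⟨128, by norm_num, Real.exp 1, he, ?_⟩, fun M hM => ⟨48001 + 6 * M ^ 2 / c, by positivity,
    max (Real.exp 1) (16 * M ^ 2), lt_max_of_lt_left he, ?_⟩⟩
  · intro H L hH hL T v w p h hc' δ hδ hδH
    have hH0 : 0 < H := (Real.exp_pos 1).trans_le hH
    have hν := hc.trans_le hc'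
    have hN := h.eventually_heatFlux_le hH0 hL hν
    have hV := (h.toFlow hH0 hL).eventually_gradient_le hν hH hN hδ hδH
      (h.toFlow hH0 hL).continuous_gradV fun q =>
        le_add_of_nonneg_right ((h.toFlow hH0 hL).gradW_nonneg q)
    have hW := (h.toFlow hH0 hL).eventually_gradient_le hν hH hN hδ hδH
      (h.toFlow hH0 hL).continuous_gradW fun q =>
        le_add_of_nonneg_left ((h.toFlow hH0 hL).gradV_nonneg q)
    have hlog : 0 ≤ Real.log H := Real.log_nonneg (he.le.trans hH)
    have hK : 0 ≤ 64 * δ * Real.log H * RayleighBenard.nusselt L H T w := by positivity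
    refine ⟨?_, fun hTV hTW => ?_⟩
    · have h1 := RayleighBenard.avg_integral_le hL (h.toFlow hH0 hL).continuous_gradV
        (h.toFlow hH0 hL).gradV_nonneg (h.gradYSq_eq hH0 hL) hδ hδH hV
      have h2 := RayleighBenard.avg_integral_le hL (h.toFlow hH0 hL).continuous_gradW
        (h.toFlow hH0 hL).gradW_nonneg (h.gradSq_eq hH0 hL) hδ hδH hW
      linarith
    · obtain ⟨h1, h2⟩ := RayleighBenard.integral_avg_le hL (h.toFlow hH0 hL).continuous_gradV
        (h.toFlow hH0 hL).gradV_nonneg (h.gradYSq_eq hH0 hL) hδ hδH hK hTV hV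
      obtain ⟨h3, h4⟩ := RayleighBenard.integral_avg_le hL (h.toFlow hH0 hL).continuous_gradW
        (h.toFlow hH0 hL).gradW_nonneg (h.gradSq_eq hH0 hL) hδ hδH hK hTW hW
      exact ⟨h1, h3, by linarith⟩
  · intro H L hH hL T v w p h hc' δ hδM hδ
    have hHe : Real.exp 1 ≤ H := (le_max_left _ _).trans hH
    have hH0 : 0 < H := (Real.exp_pos 1).trans_le hHe
    have hν := hc.trans_le hc'
    have hMH := RayleighBenard.two_mul_log_le hM hH0 ((le_max_right _ _).trans hH)
    have hδ0 : 0 < δ := pos_of_mul_pos_right ((one_div_pos.2 hH0).trans_le hδM) hM.le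
    have hδH : δ ≤ H := by linarith
    have h1 := (h.toFlow hH0 hL).eventually_shear_le hc hc' hM hHe
      (h.eventually_heatFlux_le hH0 hL hν) hMH
    -- The time means are eventually bounded at each height, so the upper limits are bounded and
    -- measurable and no convergence of the averages is required, in contrast to the Fatou argument
    -- in (i).
    obtain ⟨h2, h3⟩ := RayleighBenard.integral_avg_le_of_uniform hL
      (h.toFlow hH0 hL).continuous_shear (h.toFlow hH0 hL).shear_nonneg (h.dZSq_eq hH0 hL)
      hδ0.le hδH fun z hz => h1.mono fun t₀ ht₀ => ht₀ z hz.1 (hz.2.le.trans hδ)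
    exact ⟨h2, h3.trans_eq (by ring)⟩
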